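/- Let $\Gamma=(N,(Y_i,u_i)_{i=1}^N)$ be a finite game in normal form, with $N\ge 2$ players, finite nonempty strategy sets $Y_i=\{y_i^1,\dots,y_i^{K_i}\}$ and utilities $u_i:Y=\prod_j Y_j\to\mathbb{R}$. It is a potential game if there is $u:Y\to\mathbb{R}$ with $u_i(y_i',y_{-i})-u_i(y_i'',y_{-i})=u(y_i',y_{-i})-u(y_i'',y_{-i})$ for all $i$, $y_i',y_i''$ and $y_{-i}$. Let $U_i(\sigma)=\sum_{y\in Y}u_i(y)\prod_j\sigma_j(y_j)$ be the multilinear extension of $u_i$. For a mixed strategy profile $\sigma$, let $\mathrm{BR}_i(\sigma_{-i})$ be the set of maximizers of $U_i(\cdot,\sigma_{-i})$ over the mixed strategies of player $i$, and let $\mathrm{BR}(\sigma)=\prod_i \mathrm{BR}_i(\sigma_{-i})$; the Nash equilibria are the $\sigma$ with $\sigma\in\mathrm{BR}(\sigma)$. The space of mixed strategy profiles is identified, by dropping the weight of each player's first pure strategy, with a convex polytope $X\subset\mathbb{R}^\kappa$, $\kappa=\sum_i(K_i-1)$, and $NE\subset X$ denotes the set of Nash equilibria. A Nash equilibrium $\sigma$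 is regular (in Harsanyi's sense) if for some $r\in Y$ with $\sigma_i(r_i)>0$ for all $i$, the map whose $(i,k)$ component, $k\in Y_i$, is $\sigma_i(k)\,\bigl(U_i(k,\sigma_{-i})-U_i(r_i,\sigma_{-i})\bigr)$ for $k\ne r_i$ and $\sum_{l\in Y_i}\sigma_i(l)-1$ for $k=r_i$ has a nonsingular Jacobian at $\sigma$. The game is regular if all its Nash equilibria are regular. A fictitious play process started at $x_0\in X$ is a locally absolutely continuous map $x:[0,\infty)\to X$ with $x(0)=x_0$ and $\dot x(t)\in \mathrm{BR}(x(t))-x(t)$ for almost every $t\geq 0$. (i) Let $\Gamma$ be a regular potential game. Then for Lebesgue-almost every $x_0\in X$ there is a constant $c=c(\Gamma,x_0)$ such that every fictitious play process $x$ started at $x_0$ satisfies $$d(x(t),NE)\le c\,e^{-t}\qquad\text{for all } t\ge 0 .$$ (ii) For fixed $N$ and $K_1,\dots,K_N$, almost every potential game (with respect to Lebesgue measure on the finite-dimensional linear space of potential games) is regular, and hence the conclusion of (i) holds in almost every potential game. -/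

import Mathlib

open scoped BigOperators

namespace FP

noncomputable section

/-! Finite games in normal form with `N` players. Player `i` has `m i + 1` pure strategies,
labelled `0, …, m i`; thus any finite nonempty strategy sets are covered. -/

/-- Joint pure strategies. -/
abbrev Profile {N : ℕ} (m : Fin N → ℕ) : Type := (i : Fin N) → Fin (m i + 1)

/-- A game, given by the utility function of each player. -/
abbrev Game {N : ℕ} (m : Fin N → ℕ) : Type := Fin N → Profile m → ℝ

/-- The ambient linear space of the mixed strategy profiles. -/
abbrev Weights {N : ℕ} (m : Fin N → ℕ) : Type := (i : Fin N) → Fin (m i + 1) → ℝ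

/-- The joint mixed strategies (the product of the players' probability simplices). -/
def Delta {N : ℕ} (m : Fin N → ℕ) : Set (Weights m) :=
  {σ | ∀ i, σ i ∈ stdSimplex ℝ (Fin (m i + 1))}

/-- The multilinear extension of a function of the pure strategies (expected utility). -/
def expectedUtility {N : ℕ} {m : Fin N → ℕ} (v : Profile m → ℝ) (σ : Weights m) : ℝ :=
  ∑ y : Profile m, v y * ∏ j, σ j (y j)

/-- The best responses of player `i` to the strategies of the other players in `σ`. -/
def bestResponse {N : ℕ} {m : Fin N → ℕ} (Γ : Game m) (i : Fin N) (σ : Weights m) :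
    Set (Fin (m i + 1) → ℝ) :=
  {s | s ∈ stdSimplex ℝ (Fin (m i + 1)) ∧ ∀ s' ∈ stdSimplex ℝ (Fin (m i + 1)),
    expectedUtility (Γ i) (Function.update σ i s') ≤
      expectedUtility (Γ i) (Function.update σ i s)}

/-- The joint best responses. -/
def BR {N : ℕ} {m : Fin N → ℕ} (Γ : Game m) (σ : Weights m) : Set (Weights m) :=
  {τ | ∀ i, τ i ∈ bestResponse Γ i σ}

/-- The Nash equilibria, as mixed strategy profiles. -/
def Nash {N : ℕ} {m : Fin N → ℕ} (Γ : Game m) : Set (Weights m) :=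
  {σ | σ ∈ Delta m ∧ σ ∈ BR Γ σ}

/-- The (exact) potential games, a linear subspace of the space of games. -/
def potentialGames {N : ℕ} (m : Fin N → ℕ) : Submodule ℝ (Game m) where
  carrier := {Γ | ∃ u : Profile m → ℝ, ∀ (i : Fin N) (y : Profile m) (a b : Fin (m i + 1)),
    Γ i (Function.update y i a) - Γ i (Function.update y i b) =
      u (Function.update y i a) - u (Function.update y i b)}
  zero_mem' := ⟨0, fun _ _ _ _ => rfl⟩
  add_mem' := by
    rintro Γ Γ' ⟨u, hu⟩ ⟨u', hu'⟩
    refine ⟨u + u', fun i y a b => ?_⟩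
    simp only [Pi.add_apply]
    linarith [hu i y a b, hu' i y a b]
  smul_mem' := by
    rintro c Γ ⟨u, hu⟩
    refine ⟨c • u, fun i y a b => ?_⟩
    simp only [Pi.smul_apply, smul_eq_mul]
    rw [← mul_sub, ← mul_sub, hu i y a b]

/-- Harsanyi's map with reference profile `r`. Its component for player `i` and pure strategy `k`
is `σᵢᵏ (Uᵢ(k, σ₋ᵢ) - Uᵢ(rᵢ, σ₋ᵢ))` if `k ≠ rᵢ`, and `∑ₗ σᵢˡ - 1` if `k = rᵢ`. -/
def harsanyiMap {N : ℕ} {m : Fin N → ℕ} (Γ : Game m) (r : Profile m) (σ : Weights m) :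
    Weights m := fun i k =>
  if k = r i then (∑ l, σ i l) - 1
  else σ i k * (expectedUtility (Γ i) (Function.update σ i (Pi.single k 1)) -
    expectedUtility (Γ i) (Function.update σ i (Pi.single (r i) 1)))

/-- Regularity of an equilibrium `σ`: the Jacobian at `σ` of Harsanyi's map is nonsingular for some
reference profile in the support of `σ`. -/
def IsRegularEquilibrium {N : ℕ} {m : Fin N → ℕ} (Γ : Game m) (σ : Weights m) : Prop :=
  ∃ r : Profile m, (∀ i, 0 < σ i (r i)) ∧ (fderiv ℝ (harsanyiMap Γ r) σ).det ≠ 0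

/-- A game is regular if all its Nash equilibria are. -/
def IsRegularGame {N : ℕ} {m : Fin N → ℕ} (Γ : Game m) : Prop :=
  ∀ σ ∈ Nash Γ, IsRegularEquilibrium Γ σ

/-- Euclidean space of dimension `κ = ∑ᵢ m i`, which contains the mixed strategy space `X`. -/
abbrev Coord {N : ℕ} (m : Fin N → ℕ) : Type := EuclideanSpace ℝ ((i : Fin N) × Fin (m i))

/-- The mixed strategy space `X`: one coordinate of each mixed strategy is dropped. -/
def X {N : ℕ} (m : Fin N → ℕ) : Set (Coord m) :=
  {x | ∀ i, (∀ k, 0 ≤ x ⟨i, k⟩ ∧ x ⟨i, k⟩ ≤ 1) ∧ ∑ k, x ⟨i, k⟩ ≤ 1}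

/-- The bijection `T` from `X` to the mixed strategy profiles: the weight of player `i`'s
first pure strategy is `1 - ∑ₖ xᵢᵏ`, and the other weights are the `xᵢᵏ`. -/
def T {N : ℕ} {m : Fin N → ℕ} (x : Coord m) : Weights m := fun i =>
  Fin.cons (1 - ∑ k, x ⟨i, k⟩) (fun k => x ⟨i, k⟩)

/-- The best responses in the coordinates of `X`. -/
def BRX {N : ℕ} {m : Fin N → ℕ} (Γ : Game m) (x : Coord m) : Set (Coord m) :=
  {z | z ∈ X m ∧ T z ∈ BR Γ (T x)}

/-- The Nash equilibria in the coordinates of `X`. -/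
def NashX {N : ℕ} {m : Fin N → ℕ} (Γ : Game m) : Set (Coord m) :=
  {x | x ∈ X m ∧ T x ∈ Nash Γ}

/-- `x` (restricted to times `t ≥ 0`) is a fictitious play process with initial condition `x₀`:
it has values in `X`, it is locally absolutely continuous, and `ẋ ∈ BR(x) - x` almost everywhere.
The values of `x` at negative times play no role. -/
def IsFPProcess {N : ℕ} {m : Fin N → ℕ} (Γ : Game m) (x₀ : Coord m) (x : ℝ → Coord m) : Prop :=
  x 0 = x₀ ∧
  (∀ t, 0 ≤ t → x t ∈ X m) ∧
  (∀ b, 0 ≤ b → AbsolutelyContinuousOnInterval x 0 b) ∧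
  ∀ᵐ t : ℝ, 0 ≤ t → ∃ z ∈ BRX Γ (x t), HasDerivAt x (z - x t) t

/-- For almost every initial condition `x₀ ∈ X` there is one constant `c` such that every fictitious
play process from `x₀` is within `c e⁻ᵗ` of the set of Nash equilibria at all times `t ≥ 0`.
(The extended distance is `⊤` when the set is empty.) -/
def ConvergesExponentially {N : ℕ} {m : Fin N → ℕ} (Γ : Game m) : Prop :=
  ∀ᵐ x₀ : Coord m, x₀ ∈ X m → ∃ c : ℝ, ∀ x : ℝ → Coord m, IsFPProcess Γ x₀ x →
    ∀ t : ℝ, 0 ≤ t → Metric.infEDist (x t) (NashX Γ) ≤ ENNReal.ofReal (c * Real.exp (-t))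

end

end FP

/-! Replacing every utility by the potential `u` changes neither best replies nor Harsanyi's map, so
all arguments take place in a game with common utility `u`.

Regularity of an equilibrium `s` means that unused strategies are strictly worse and that the second
derivative of `u` along the support is nondegenerate (`det_harsanyi_ne_zero_iff`). Expected utility
grows along a process at the rate of the total best-reply gain and equilibria are isolated, so each
process converges to one equilibrium (`IsProc.exists_tendsto`). If this limit is pure, the reply is
eventually constant and the distance to it decays like `exp (-t)`. The work is to exclude mixed
limits from almost every start. Near a mixed `s`, let `P` be the vector of payoff advantages over a
reference strategy on the support, and `B` the inverse of the second derivative. The form `P·BP/2`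
is at most `K‖P‖²` in absolute value but has derivative at least `c‖P‖`. If `P` never vanished from
some time on, the form would increase to 0 through negative values and reach 0 in finite time, which
is absurd (`IsProc.exists_advVec_eq_zero`). So the process meets a point where several indifference
conditions hold at once, and two of these have distinct irreducible factors that vanish there
(`mem_multiZeros_of_advVec_eq_zero`).

The set `Q` of such points is null for the Hausdorff measure of dimension `d - 1`, by elimination of
a variable (`hausdorffMeasure_common_zeros`), where `d` is the dimension of the strategy space. Off
`Q`, the reply is locally governed by the sign of a single polynomial `q`, and a player whose reply
switches at `q = 0` has no coordinate in `q` (`compl_multiZeros_subset_goodPoints`). The players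
whose coordinates enter `q` thus move along a fixed contraction, the sign of `q` is known in
advance, and `exp t • x t` is the image of `x 0` under a measure-preserving shear. Hence going back
in time by `t` expands volume by at most `exp (d t)`. This makes solutions off `Q` almost surely
unique (`ae_unique_of_goodPoints`). It also shows that almost no start reaches `Q` (`ae_not_hit`): a
ball of radius `r` in a cover of `Q` has to be tested at about `1 / r` times, at a total cost of
order `r ^ (d - 1)`.

Strategies with identical payoffs would destroy uniqueness. Each process is therefore replaced by
one with the same start and the same payoffs that moves only towards the first strategy of each
duplicate class (`canonicalCurve`). Uniqueness of that curve gives one switching time for all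
processes from the same start, hence one constant.

For genericity, adding separable terms `c i (y i)` to `u` yields a Sard argument: equilibria with a
given support are parametrized by as many numbers as there are coordinates of `c`, and the
nonregular ones come from critical parameters. -/

namespace FP

open MeasureTheory Set Filter Topology

/-! ### Integral solutions, good balls and shears. -/

section AbstractFlow

variable {ι : Type*} [Fintype ι]

/-- The exponentially weighted integral form of the inclusion `ẋ ∈ V x - x` on `[0, ∞)`. -/
def IsSol (V : (ι → ℝ) → Set (ι → ℝ)) (x : ℝ → ι → ℝ) : Prop :=
  (∀ t, 0 ≤ t → ‖x t‖ ≤ 1) ∧ ∃ z : ℝ → ι → ℝ,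
    (∀ t, 0 ≤ t → IntervalIntegrable z volume 0 t) ∧
    (∀ᵐ t : ℝ, 0 ≤ t → z t ∈ V (x t)) ∧
    ∀ t, 0 ≤ t → Real.exp t • x t = x 0 + ∫ r in (0 : ℝ)..t, Real.exp r • z r

theorem intervalIntegrable_exp_smul {z : ℝ → ι → ℝ} {a b : ℝ}
    (h : IntervalIntegrable z volume a b) :
    IntervalIntegrable (fun r => Real.exp r • z r) volume a b :=
  h.continuousOn_smul Real.continuous_exp.continuousOn

theorem IsSol.shift {V : (ι → ℝ) → Set (ι → ℝ)} {x : ℝ → ι → ℝ} (hx : IsSol V x) {s : ℝ}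
    (hs : 0 ≤ s) : IsSol V (fun t => x (s + t)) := by
  obtain ⟨hb, z, hzi, hzV, hz⟩ := hx
  refine ⟨fun t ht => hb _ (by linarith), fun t => z (s + t), fun t ht => ?_, ?_, fun t ht => ?_⟩
  · have h1 : IntervalIntegrable z volume s (s + t) :=
      (hzi s hs).symm.trans (hzi (s + t) (by linarith))
    have := h1.comp_add_left s
    simpa using this
  · have := (quasiMeasurePreserving_add_left (volume : Measure ℝ) s).ae hzV
    filter_upwards [this] with t ht ht0 using ht (by linarith)
  · have h1 := hz s hs
    have h2 := hz (s + t) (by linarith)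
    have hi1 := intervalIntegrable_exp_smul (hzi s hs)
    have hi2 := intervalIntegrable_exp_smul (hzi (s + t) (by linarith))
    have h3 : ∫ r in s..(s + t), Real.exp r • z r =
        Real.exp (s + t) • x (s + t) - Real.exp s • x s := by
      rw [← intervalIntegral.integral_interval_sub_left hi2 hi1, h1, h2]; abel
    have h4 : ∫ r in (0 : ℝ)..t, Real.exp r • z (s + r) =
        Real.exp (-s) • ∫ r in s..(s + t), Real.exp r • z r := by
      rw [← intervalIntegral.integral_smul]
      have := intervalIntegral.integral_comp_add_left (a := 0) (b := t)
        (fun r => Real.exp (-s) • Real.exp r • z r) s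
      rw [add_zero] at this
      rw [← this]
      congr 1; ext1 r
      rw [smul_smul, ← Real.exp_add]; congr 2; ring_nf
    simp only [add_zero]
    rw [h4, h3, smul_sub, smul_smul, smul_smul, ← Real.exp_add, ← Real.exp_add]
    simp

/-- The velocity is a difference of two vectors of norm at most 1. In the weighted form the
displacement is at most `2 * (1 - exp (-d))`, where `d` is the elapsed time. -/
theorem IsSol.norm_sub_le {V : (ι → ℝ) → Set (ι → ℝ)} (hV : ∀ y, ∀ v ∈ V y, ‖v‖ ≤ 1)
    {x : ℝ → ι → ℝ} (hx : IsSol V x) {s t : ℝ} (hs : 0 ≤ s) (hst : s ≤ t) :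
    ‖x t - x s‖ ≤ 2 * (t - s) := by
  obtain ⟨hb, z, hzi, hzV, hz⟩ := hx.shift hs
  have ht : 0 ≤ t - s := by linarith
  have h := hz _ ht
  simp only [add_zero, add_sub_cancel] at h hb
  set d := t - s with hd
  have hI : ‖∫ r in (0 : ℝ)..d, Real.exp r • z r‖ ≤ ∫ r in (0 : ℝ)..d, Real.exp r := by
    apply intervalIntegral.norm_integral_le_of_norm_le ht
    · filter_upwards [hzV] with r hr hr0
      rw [norm_smul, Real.norm_eq_abs, abs_of_pos (Real.exp_pos r)]
      exact mul_le_of_le_one_right (Real.exp_pos r).le (hV _ _ (hr hr0.1.le))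
    · exact Real.continuous_exp.intervalIntegrable _ _
  rw [integral_exp, Real.exp_zero] at hI
  have hxs : ‖x s‖ ≤ 1 := by simpa using hb 0 le_rfl
  have key : x t - x s = (Real.exp (-d) - 1) • x s +
      Real.exp (-d) • ∫ r in (0 : ℝ)..d, Real.exp r • z r := by
    have h2 : x t = Real.exp (-d) • (Real.exp d • x t) := by
      rw [smul_smul, ← Real.exp_add]; simp
    rw [h2, h, smul_add, sub_smul, one_smul]; abel
  have he : Real.exp (-d) ≤ 1 := by simpa using ht
  have he2 : 1 - d ≤ Real.exp (-d) := by linarith [Real.add_one_le_exp (-d)]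
  have he3 : Real.exp (-d) * Real.exp d = 1 := by rw [← Real.exp_add]; simp
  rw [key]
  calc _ ≤ ‖(Real.exp (-d) - 1) • x s‖ +
        ‖Real.exp (-d) • ∫ r in (0 : ℝ)..d, Real.exp r • z r‖ := norm_add_le _ _
    _ ≤ (1 - Real.exp (-d)) * 1 + Real.exp (-d) * (Real.exp d - 1) := by
        rw [norm_smul, norm_smul, Real.norm_eq_abs, Real.norm_eq_abs,
          abs_of_pos (Real.exp_pos _), abs_sub_comm, abs_of_nonneg (by linarith)]
        gcongr
    _ ≤ 2 * d := by rw [mul_sub, he3]; linarith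

theorem IsSol.dist_le {V : (ι → ℝ) → Set (ι → ℝ)} (hV : ∀ y, ∀ v ∈ V y, ‖v‖ ≤ 1)
    {x : ℝ → ι → ℝ} (hx : IsSol V x) {s t : ℝ} (hs : 0 ≤ s) (ht : 0 ≤ t) :
    dist (x t) (x s) ≤ 2 * |t - s| := by
  rcases le_total s t with h | h
  · rw [dist_eq_norm, abs_of_nonneg (by linarith)]; exact hx.norm_sub_le hV hs h
  · rw [dist_comm, dist_eq_norm, abs_sub_comm, abs_of_nonneg (by linarith)]
    exact hx.norm_sub_le hV ht h

theorem IsSol.continuousOn {V : (ι → ℝ) → Set (ι → ℝ)} (hV : ∀ y, ∀ v ∈ V y, ‖v‖ ≤ 1)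
    {x : ℝ → ι → ℝ} (hx : IsSol V x) : ContinuousOn x (Ici 0) := by
  have : LipschitzOnWith 2 x (Ici 0) := LipschitzOnWith.of_dist_le_mul fun t ht s hs => by
    simpa [Real.dist_eq] using hx.dist_le hV hs ht
  exact this.continuousOn

/-- On the ball, `V` is one of two points, according to the sign of a function `q` which does not
depend on the coordinates in `S`; the two points agree off `S`. -/
def GoodBall (V : (ι → ℝ) → Set (ι → ℝ)) (c : ι → ℝ) (r : ℝ) : Prop :=
  ∃ (S : Set ι) (q : (ι → ℝ) → ℝ) (zp zm : ι → ℝ),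
    Continuous q ∧ volume {x | q x = 0} = 0 ∧
    (∀ x x', (∀ a ∉ S, x a = x' a) → q x = q x') ∧
    (∀ a ∉ S, zm a = zp a) ∧
    ∀ x ∈ Metric.ball c r, ∀ v ∈ V x,
      (0 < q x → v = zp) ∧ (q x < 0 → v = zm) ∧ ∀ a ∉ S, v a = zp a

theorem GoodBall.mono {V : (ι → ℝ) → Set (ι → ℝ)} {c c' : ι → ℝ} {r r' : ℝ}
    (h : GoodBall V c r) (hsub : Metric.ball c' r' ⊆ Metric.ball c r) : GoodBall V c' r' := by
  obtain ⟨S, q, zp, zm, h1, h2, h3, h4, h5⟩ := h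
  exact ⟨S, q, zp, zm, h1, h2, h3, h4, fun x hx => h5 x (hsub hx)⟩

/-- In the splitting of the coordinates into those off `S` and those in `S`, the map translates the
first block by a constant and the second block by a vector that depends only on the first. It is a
skew product of translations. -/
theorem measurePreserving_shear (S : Set ι) {w : (ι → ℝ) → ι → ℝ} (hm : Measurable w)
    (hw : ∀ x x', (∀ a ∉ S, x a = x' a) → w x = w x')
    (hc : ∀ a ∉ S, ∀ x x', w x a = w x' a) :
    MeasurePreserving (fun x => x + w x) := by
  classical
  let e := MeasurableEquiv.piEquivPiSubtypeProd (fun _ : ι => ℝ) (fun a => a ∉ S)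
  have he : MeasurePreserving e := volume_preserving_piEquivPiSubtypeProd _ _
  let ext : ({a // a ∉ S} → ℝ) → ι → ℝ := fun y => e.symm (y, 0)
  have hext : Measurable ext := e.symm.measurable.comp (measurable_id.prodMk measurable_const)
  let g1 : ({a // a ∉ S} → ℝ) → ({a // a ∉ S} → ℝ) := fun y => y + (fun a => w 0 a.1 : {a // a ∉ S} → ℝ)
  let g2 : ({a // a ∉ S} → ℝ) → ({a // ¬ a ∉ S} → ℝ) → ({a // ¬ a ∉ S} → ℝ) :=
    fun y y' => y' + (fun a => w (ext y) a.1 : {a // ¬ a ∉ S} → ℝ)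
  have hsk : MeasurePreserving (fun p : ({a // a ∉ S} → ℝ) × ({a // ¬ a ∉ S} → ℝ) =>
      (g1 p.1, g2 p.1 p.2)) := by
    apply MeasurePreserving.skew_product (f := g1) (g := g2)
    · exact measurePreserving_add_right _ _
    · have : Measurable fun p : ({a // a ∉ S} → ℝ) × ({a // ¬ a ∉ S} → ℝ) =>
          p.2 + (fun a => w (ext p.1) a.1 : {a // ¬ a ∉ S} → ℝ) := by
        apply measurable_snd.add
        exact measurable_pi_lambda _ fun a =>
          (measurable_pi_apply _).comp (hm.comp (hext.comp measurable_fst))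
      exact this
    · exact ae_of_all _ fun y => (measurePreserving_add_right _ _).map_eq
  have h := (he.symm e).comp (hsk.comp he)
  convert h using 1
  ext x a
  by_cases ha : a ∈ S
  · have h1 : w x = w (ext (e x).1) := hw _ _ fun b hb => by
      simp [ext, e, MeasurableEquiv.piEquivPiSubtypeProd, Equiv.piEquivPiSubtypeProd, hb]
    simp only [Function.comp, Pi.add_apply]
    rw [h1]
    simp [e, g1, g2, MeasurableEquiv.piEquivPiSubtypeProd, Equiv.piEquivPiSubtypeProd, ha]
  · simp [e, g1, g2, MeasurableEquiv.piEquivPiSubtypeProd, Equiv.piEquivPiSubtypeProd, ha,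
      hc a ha x 0]

end AbstractFlow

/-! ### The flow inside one good ball. -/

section AbstractFlow

variable {ι : Type*} [Fintype ι]

/-- The flow of `ẋ = z - x`. -/
noncomputable def contraction (z : ι → ℝ) (t : ℝ) (x : ι → ℝ) : ι → ℝ :=
  Real.exp (-t) • x + (1 - Real.exp (-t)) • z

open Classical in
/-- The point selected by the sign of `q`. -/
noncomputable def signSelect (q : (ι → ℝ) → ℝ) (zp zm : ι → ℝ) (y : ι → ℝ) : ι → ℝ :=
  if 0 < q y then zp else zm

set_option linter.unusedSectionVars false in
theorem continuous_contraction (z : ι → ℝ) :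
    Continuous fun p : (ι → ℝ) × ℝ => contraction z p.2 p.1 := by
  unfold contraction; fun_prop

theorem volume_contraction_preimage_null (z : ι → ℝ) (t : ℝ) {N : Set (ι → ℝ)}
    (hN : volume N = 0) : volume {x | contraction z t x ∈ N} = 0 := by
  have h1 : {x | contraction z t x ∈ N} =
      (fun x => Real.exp (-t) • x) ⁻¹' ((fun x => x + (1 - Real.exp (-t)) • z) ⁻¹' N) := rfl
  rw [h1, Measure.addHaar_preimage_smul _ (Real.exp_pos _).ne', measure_preimage_add_right, hN,
    mul_zero]

/-- For each fixed time the contraction is an invertible affine map, so it pulls the null set `q =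
0` back to a null set; Fubini then exchanges time and initial point. -/
theorem volume_exceptional_null {q : (ι → ℝ) → ℝ} (hq : Continuous q)
    (h0 : volume {x | q x = 0} = 0) (z : ι → ℝ) :
    volume {x | ¬ ∀ᵐ t : ℝ, q (contraction z t x) ≠ 0} = 0 := by
  have hmeas : MeasurableSet {p : (ι → ℝ) × ℝ | q (contraction z p.2 p.1) ≠ 0} :=
    (isClosed_singleton.preimage (hq.comp (continuous_contraction z))).measurableSet.compl
  have : ∀ᵐ x : ι → ℝ, ∀ᵐ t : ℝ, q (contraction z t x) ≠ 0 := by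
    rw [Measure.ae_ae_comm hmeas]
    refine ae_of_all _ fun t => ?_
    have := volume_contraction_preimage_null z t h0
    rw [ae_iff]
    simpa using this
  exact this

theorem measurable_signSelect {q : (ι → ℝ) → ℝ} (hq : Continuous q) (zp zm : ι → ℝ) :
    Measurable (signSelect q zp zm) := by
  classical
  exact Measurable.ite (measurableSet_lt measurable_const hq.measurable) measurable_const
    measurable_const

/-- Integral of the weighted velocity along the flow, when the velocity is `signSelect`. -/
noncomputable def drift (q : (ι → ℝ) → ℝ) (zp zm : ι → ℝ) (t : ℝ) (x : ι → ℝ) : ι → ℝ :=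
  ∫ r in (0 : ℝ)..t, Real.exp r • signSelect q zp zm (contraction zp r x)

theorem measurable_drift_integrand {q : (ι → ℝ) → ℝ} (hq : Continuous q) (zp zm : ι → ℝ) :
    Measurable fun p : (ι → ℝ) × ℝ =>
      Real.exp p.2 • signSelect q zp zm (contraction zp p.2 p.1) :=
  (Real.measurable_exp.comp measurable_snd).smul
    ((measurable_signSelect hq zp zm).comp (continuous_contraction zp).measurable)

theorem measurable_drift {q : (ι → ℝ) → ℝ} (hq : Continuous q) (zp zm : ι → ℝ) {t : ℝ}
    (ht : 0 ≤ t) : Measurable (drift q zp zm t) := by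
  have h := (measurable_drift_integrand hq zp zm).stronglyMeasurable.integral_prod_right'
    (ν := volume.restrict (Ioc 0 t))
  have h2 : drift q zp zm t = fun x => ∫ r in Ioc 0 t,
      Real.exp r • signSelect q zp zm (contraction zp r x) := by
    ext1 x; exact intervalIntegral.integral_of_le ht
  rw [h2]
  exact h.measurable

theorem intervalIntegrable_signSelect {q : (ι → ℝ) → ℝ} (hq : Continuous q) (zp zm : ι → ℝ)
    (x : ι → ℝ) (a b : ℝ) :
    IntervalIntegrable (fun r => signSelect q zp zm (contraction zp r x)) volume a b := by
  have hm : Measurable fun r => signSelect q zp zm (contraction zp r x) :=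
    (measurable_signSelect hq zp zm).comp
      ((continuous_contraction zp).comp (by fun_prop : Continuous fun r : ℝ => (x, r))).measurable
  have hc : IntervalIntegrable (fun _ : ℝ => max ‖zp‖ ‖zm‖) volume a b :=
    intervalIntegrable_const
  refine hc.mono_fun hm.aestronglyMeasurable (ae_of_all _ fun r => ?_)
  rw [Real.norm_of_nonneg (le_max_of_le_left (norm_nonneg _))]
  simp only [signSelect]
  split_ifs
  · exact le_max_left _ _
  · exact le_max_right _ _

theorem intervalIntegral_exp_smul_apply {z : ℝ → ι → ℝ} {a b : ℝ}
    (h : IntervalIntegrable z volume a b) (i : ι) :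
    (∫ r in a..b, Real.exp r • z r) i = ∫ r in a..b, Real.exp r * z r i :=
  ((ContinuousLinearMap.proj (R := ℝ) (φ := fun _ : ι => ℝ) i).intervalIntegral_comp_comm
    (intervalIntegrable_exp_smul h)).symm

/-- The contraction acts coordinatewise and `q` sees only coordinates off `S`, so the selected point
depends on those coordinates alone; and its own coordinates off `S` do not depend on the selection.
These are the two hypotheses of `measurePreserving_shear`. -/
theorem measurePreserving_drift {S : Set ι} {q : (ι → ℝ) → ℝ} {zp zm : ι → ℝ}
    (hq : Continuous q) (hqS : ∀ x x', (∀ a ∉ S, x a = x' a) → q x = q x')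
    (hz : ∀ a ∉ S, zm a = zp a) {t : ℝ} (ht : 0 ≤ t) :
    MeasurePreserving (fun x => x + drift q zp zm t x) := by
  refine measurePreserving_shear S (measurable_drift hq zp zm ht) (fun x x' hxx => ?_)
    (fun a ha x x' => ?_)
  · unfold drift
    congr 1; ext1 r
    have : q (contraction zp r x) = q (contraction zp r x') :=
      hqS _ _ fun a ha => by simp [contraction, hxx a ha]
    simp [signSelect, this]
  · unfold drift
    rw [intervalIntegral_exp_smul_apply (intervalIntegrable_signSelect hq zp zm x 0 t),
      intervalIntegral_exp_smul_apply (intervalIntegrable_signSelect hq zp zm x' 0 t)]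
    have hs : ∀ y, signSelect q zp zm y a = zp a := fun y => by
      unfold signSelect; split_ifs
      · rfl
      · exact hz a ha
    simp [hs]

theorem IsSol.apply_eq_contraction {V : (ι → ℝ) → Set (ι → ℝ)} {x : ℝ → ι → ℝ}
    (hx : IsSol V x) {δ : ℝ} {a : ι} {zp : ι → ℝ}
    (h : ∀ t ∈ Icc 0 δ, ∀ v ∈ V (x t), v a = zp a) :
    ∀ t ∈ Icc 0 δ, x t a = contraction zp t (x 0) a := by
  rintro t ⟨ht0, htδ⟩
  obtain ⟨hb, z, hzi, hzV, hz⟩ := hx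
  have h1 := congrFun (hz t ht0) a
  rw [Pi.add_apply, intervalIntegral_exp_smul_apply (hzi t ht0)] at h1
  have h2 : ∫ r in (0 : ℝ)..t, Real.exp r * z r a = ∫ r in (0 : ℝ)..t, Real.exp r * zp a := by
    apply intervalIntegral.integral_congr_ae
    filter_upwards [hzV] with r hr hr0
    rw [uIoc_of_le ht0] at hr0
    rw [h r ⟨hr0.1.le, hr0.2.trans htδ⟩ _ (hr hr0.1.le)]
  rw [h2, intervalIntegral.integral_mul_const, integral_exp, Real.exp_zero] at h1
  have h3 : Real.exp (-t) * Real.exp t = 1 := by rw [← Real.exp_add]; simp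
  simp only [Pi.smul_apply, smul_eq_mul] at h1
  have h4 : x t a = Real.exp (-t) * (Real.exp t * x t a) := by rw [← mul_assoc, h3, one_mul]
  rw [h4, h1]
  simp only [contraction, Pi.add_apply, Pi.smul_apply, smul_eq_mul]
  linear_combination (zp a) * h3

/-- Off `S` the solution follows the contraction towards `zp` whatever happens, and this already
determines `q (x t)`. The target is then forced at every time at which `q` is nonzero, hence almost
always, so nothing is left to choose. -/
theorem IsSol.exp_smul_eq {V : (ι → ℝ) → Set (ι → ℝ)} {x : ℝ → ι → ℝ} (hx : IsSol V x)
    {c : ι → ℝ} {r δ : ℝ} {S : Set ι} {q : (ι → ℝ) → ℝ} {zp zm : ι → ℝ}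
    (hqS : ∀ x x', (∀ a ∉ S, x a = x' a) → q x = q x')
    (hV : ∀ x ∈ Metric.ball c r, ∀ v ∈ V x,
      (0 < q x → v = zp) ∧ (q x < 0 → v = zm) ∧ ∀ a ∉ S, v a = zp a)
    (hball : ∀ t ∈ Icc 0 δ, x t ∈ Metric.ball c r)
    (hae : ∀ᵐ t : ℝ, q (contraction zp t (x 0)) ≠ 0) :
    ∀ t ∈ Icc 0 δ, Real.exp t • x t = x 0 + drift q zp zm t (x 0) := by
  intro t ht
  have hq : ∀ t ∈ Icc 0 δ, q (x t) = q (contraction zp t (x 0)) := fun t ht =>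
    hqS _ _ fun a ha => hx.apply_eq_contraction
      (fun t ht v hv => (hV _ (hball t ht) v hv).2.2 a ha) t ht
  obtain ⟨hb, z, hzi, hzV, hz⟩ := hx
  rw [hz t ht.1]
  congr 1
  apply intervalIntegral.integral_congr_ae
  filter_upwards [hzV, hae] with s hs hs1 hs0
  rw [uIoc_of_le ht.1] at hs0
  have hs2 : s ∈ Icc 0 δ := ⟨hs0.1.le, hs0.2.trans ht.2⟩
  have h3 := hV _ (hball s hs2) _ (hs hs0.1.le)
  rw [hq s hs2] at h3
  congr 1
  unfold signSelect
  split_ifs with h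
  · exact h3.1 h
  · exact h3.2.1 (lt_of_le_of_ne (not_lt.1 h) hs1)

/-- Initial points of solutions that stay in the ball up to time `δ` and end in `E`. -/
theorem GoodBall.measure_le {V : (ι → ℝ) → Set (ι → ℝ)} {c : ι → ℝ} {r δ : ℝ}
    (hg : GoodBall V c r) (hδ : 0 ≤ δ) (E : Set (ι → ℝ)) :
    volume {x₀ | ∃ x, IsSol V x ∧ x 0 = x₀ ∧ (∀ t ∈ Icc 0 δ, x t ∈ Metric.ball c r) ∧ x δ ∈ E} ≤
      ENNReal.ofReal (Real.exp δ) ^ Fintype.card ι * volume E := by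
  obtain ⟨S, q, zp, zm, hqc, hq0, hqS, hz, hV⟩ := hg
  set X₀ := {x | ¬ ∀ᵐ t : ℝ, q (contraction zp t x) ≠ 0} with hX₀
  set F : (ι → ℝ) → ι → ℝ := fun x => x + drift q zp zm δ x
  have hF : MeasurePreserving F := measurePreserving_drift hqc hqS hz hδ
  have hsub : {x₀ | ∃ x, IsSol V x ∧ x 0 = x₀ ∧ (∀ t ∈ Icc 0 δ, x t ∈ Metric.ball c r) ∧
      x δ ∈ E} ⊆ X₀ ∪ F ⁻¹' ((fun y => Real.exp (-δ) • y) ⁻¹' toMeasurable volume E) := by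
    rintro x₀ ⟨x, hx, rfl, hb, hE⟩
    by_cases h : ∀ᵐ t : ℝ, q (contraction zp t (x 0)) ≠ 0
    · right
      have := hx.exp_smul_eq hqS hV hb h δ ⟨hδ, le_rfl⟩
      simp only [mem_preimage, F]
      rw [← this, smul_smul, ← Real.exp_add]
      simpa using subset_toMeasurable _ _ hE
    · left; exact h
  refine (measure_mono hsub).trans ((measure_union_le _ _).trans ?_)
  have hm : MeasurableSet ((fun y : ι → ℝ => Real.exp (-δ) • y) ⁻¹' toMeasurable volume E) :=
    (measurable_const_smul _) (measurableSet_toMeasurable _ _)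
  rw [volume_exceptional_null hqc hq0, zero_add, hF.measure_preimage hm.nullMeasurableSet,
    Measure.addHaar_preimage_smul _ (Real.exp_pos _).ne', measure_toMeasurable,
    Module.finrank_fintype_fun_eq_card, abs_of_pos (by positivity), ← Real.exp_nat_mul,
    ← Real.exp_neg, ← ENNReal.ofReal_pow (Real.exp_pos _).le, ← Real.exp_nat_mul]
  simp

/-- Initial points with two different solutions, both staying in the ball up to time `δ`. -/
theorem GoodBall.measure_nonunique {V : (ι → ℝ) → Set (ι → ℝ)} {c : ι → ℝ} {r δ : ℝ}
    (hg : GoodBall V c r) :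
    volume {x₀ | ∃ x y, IsSol V x ∧ IsSol V y ∧ x 0 = x₀ ∧ y 0 = x₀ ∧
      (∀ t ∈ Icc 0 δ, x t ∈ Metric.ball c r) ∧ (∀ t ∈ Icc 0 δ, y t ∈ Metric.ball c r) ∧
      ∃ t ∈ Icc 0 δ, x t ≠ y t} = 0 := by
  obtain ⟨S, q, zp, zm, hqc, hq0, hqS, hz, hV⟩ := hg
  refine measure_mono_null ?_ (volume_exceptional_null hqc hq0 zp)
  rintro x₀ ⟨x, y, hx, hy, hx0, hy0, hbx, hby, t, ht, hne⟩
  intro h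
  apply hne
  have h1 := hx.exp_smul_eq hqS hV hbx (hx0 ▸ h) t ht
  have h2 := hy.exp_smul_eq hqS hV hby (hy0 ▸ h) t ht
  rw [hx0, ← hy0, ← h2] at h1
  exact smul_right_injective _ (Real.exp_pos t).ne' h1

end AbstractFlow

/-! ### From good balls to global volume bounds, uniqueness and avoidance of thin sets. -/

section AbstractFlow

variable {ι : Type*} [Fintype ι]

/-- Points with a good ball of radius `1 / (n + 1)`. -/
def goodSet (V : (ι → ℝ) → Set (ι → ℝ)) (n : ℕ) : Set (ι → ℝ) :=
  {x | GoodBall V x (1 / ((n : ℝ) + 1))}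

/-- Points with a good ball. -/
def goodPoints (V : (ι → ℝ) → Set (ι → ℝ)) : Set (ι → ℝ) :=
  {x | ∃ r, 0 < r ∧ GoodBall V x r}

theorem goodSet_mono (V : (ι → ℝ) → Set (ι → ℝ)) : Monotone (goodSet V) := by
  intro n k hnk x hx
  refine GoodBall.mono hx (Metric.ball_subset_ball ?_)
  have : (n : ℝ) ≤ k := by exact_mod_cast hnk
  gcongr

theorem mem_goodSet_of_dist {V : (ι → ℝ) → Set (ι → ℝ)} {x y : ι → ℝ} {r : ℝ} {n : ℕ}
    (h : GoodBall V x r) (hn : 1 / ((n : ℝ) + 1) ≤ r / 2) (hxy : dist y x ≤ r / 2) :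
    y ∈ goodSet V n := by
  refine GoodBall.mono h (Metric.ball_subset_ball' ?_)
  linarith

theorem exists_goodSet_of_isCompact {V : (ι → ℝ) → Set (ι → ℝ)} {K : Set (ι → ℝ)}
    (hK : IsCompact K) (h : K ⊆ goodPoints V) : ∃ n, K ⊆ goodSet V n := by
  obtain ⟨n, hn⟩ := hK.elim_directed_cover (fun n => interior (goodSet V n))
    (fun n => isOpen_interior) (fun x hx => by
      obtain ⟨r, hr, hg⟩ := h hx
      obtain ⟨n, hn⟩ := exists_nat_one_div_lt (half_pos hr)
      refine mem_iUnion.2 ⟨n, mem_interior_iff_mem_nhds.2 ?_⟩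
      filter_upwards [Metric.closedBall_mem_nhds x (half_pos hr)] with y hy
      exact mem_goodSet_of_dist hg hn.le hy)
    (Monotone.directed_le fun a b hab => interior_mono (goodSet_mono V hab))
  exact ⟨n, hn.trans interior_subset⟩

/-- The expansion factor of the backward flow over a time `t`. -/
noncomputable def expansion (ι : Type*) [Fintype ι] (t : ℝ) : ENNReal :=
  ENNReal.ofReal (Real.exp t) ^ Fintype.card ι

theorem expansion_add (s t : ℝ) : expansion ι (s + t) = expansion ι s * expansion ι t := by
  simp [expansion, Real.exp_add, ENNReal.ofReal_mul (Real.exp_pos s).le, mul_pow]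

theorem expansion_mono : Monotone (expansion ι) := by
  intro s t h
  unfold expansion
  gcongr

theorem expansion_ne_top (t : ℝ) : expansion ι t ≠ ⊤ := by simp [expansion]

/-- Space is cut into disjoint pieces, each inside a ball of a quarter of the good radius. A
solution ending in a piece that contains a good point `c` has moved by at most half the good radius,
so it stayed in the good ball of `c` and `GoodBall.measure_le` applies. Disjointness of the pieces
lets the bounds add up without a multiplicity factor. -/
theorem measure_step {V : (ι → ℝ) → Set (ι → ℝ)} (hV : ∀ y, ∀ v ∈ V y, ‖v‖ ≤ 1) {n : ℕ} {δ : ℝ}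
    (hδ : 0 ≤ δ) (hδn : 4 * δ ≤ 1 / ((n : ℝ) + 1)) (E : Set (ι → ℝ)) :
    volume {x₀ | ∃ x, IsSol V x ∧ x 0 = x₀ ∧ x δ ∈ goodSet V n ∧ x δ ∈ E} ≤
      expansion ι δ * volume E := by
  set ρ : ℝ := 1 / ((n : ℝ) + 1) with hρ
  have hρ0 : 0 < ρ := by positivity
  let P : ℕ → Set (ι → ℝ) :=
    disjointed fun k => Metric.ball (TopologicalSpace.denseSeq (ι → ℝ) k) (ρ / 4)
  have hPs : ∀ k, P k ⊆ Metric.ball (TopologicalSpace.denseSeq (ι → ℝ) k) (ρ / 4) := fun k =>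
    disjointed_subset _ k
  have hPm : ∀ k, MeasurableSet (P k) := fun k =>
    MeasurableSet.disjointed (fun k => measurableSet_ball) k
  have hPd : Pairwise (Function.onFun Disjoint P) := disjoint_disjointed _
  have hPu : ⋃ k, P k = univ := by
    rw [iUnion_disjointed]
    refine eq_univ_of_forall fun x => ?_
    obtain ⟨k, hk⟩ := (TopologicalSpace.denseRange_denseSeq (ι → ℝ)).exists_dist_lt x
      (by positivity : 0 < ρ / 4)
    exact mem_iUnion.2 ⟨k, Metric.mem_ball.2 hk⟩
  set E' := toMeasurable volume E
  have hE' : MeasurableSet E' := measurableSet_toMeasurable _ _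
  have hpiece : ∀ k, volume {x₀ | ∃ x, IsSol V x ∧ x 0 = x₀ ∧ x δ ∈ goodSet V n ∧ x δ ∈ P k ∩ E'}
      ≤ expansion ι δ * volume (P k ∩ E') := by
    intro k
    by_cases hne : (P k ∩ goodSet V n).Nonempty
    · obtain ⟨c, hcP, hcG⟩ := hne
      refine le_trans (measure_mono ?_) (GoodBall.measure_le hcG hδ (P k ∩ E'))
      rintro x₀ ⟨x, hx, hx0, -, hE⟩
      refine ⟨x, hx, hx0, fun t ht => ?_, hE⟩
      have h1 : dist (x δ) c < ρ / 2 := by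
        have a1 := Metric.mem_ball.1 (hPs k hE.1)
        have a2 := Metric.mem_ball.1 (hPs k hcP)
        have := dist_triangle_right (x δ) c (TopologicalSpace.denseSeq (ι → ℝ) k)
        linarith
      have h2 := hx.dist_le hV hδ ht.1
      rw [abs_sub_comm, abs_of_nonneg (by linarith [ht.2])] at h2
      have h3 := dist_triangle (x t) (x δ) c
      rw [Metric.mem_ball]
      linarith [ht.1]
    · have : {x₀ | ∃ x, IsSol V x ∧ x 0 = x₀ ∧ x δ ∈ goodSet V n ∧ x δ ∈ P k ∩ E'} = ∅ := by
        refine eq_empty_of_forall_notMem ?_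
        rintro x₀ ⟨x, -, -, h1, h2⟩
        exact hne ⟨_, h2.1, h1⟩
      rw [this]; simp
  calc _ ≤ volume (⋃ k, {x₀ | ∃ x, IsSol V x ∧ x 0 = x₀ ∧ x δ ∈ goodSet V n ∧
          x δ ∈ P k ∩ E'}) := by
        apply measure_mono
        rintro x₀ ⟨x, hx, hx0, hG, hE⟩
        have : x δ ∈ ⋃ k, P k := hPu ▸ mem_univ _
        obtain ⟨k, hk⟩ := mem_iUnion.1 this
        exact mem_iUnion.2 ⟨k, x, hx, hx0, hG, hk, subset_toMeasurable _ _ hE⟩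
    _ ≤ ∑' k, expansion ι δ * volume (P k ∩ E') :=
        (measure_iUnion_le _).trans (ENNReal.tsum_le_tsum hpiece)
    _ = expansion ι δ * volume E' := by
        rw [ENNReal.tsum_mul_left, ← measure_iUnion
          (fun i j hij => (hPd hij).mono inter_subset_left inter_subset_left)
          (fun k => (hPm k).inter hE'), ← iUnion_inter, hPu, univ_inter]
    _ = _ := by rw [measure_toMeasurable]

/-- Initial points of solutions that stay in `G` up to time `s` and are then in `E`. -/
def reachFrom (V : (ι → ℝ) → Set (ι → ℝ)) (G : Set (ι → ℝ)) (s : ℝ) (E : Set (ι → ℝ)) :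
    Set (ι → ℝ) :=
  {x₀ | ∃ x, IsSol V x ∧ x 0 = x₀ ∧ (∀ t ∈ Icc 0 s, x t ∈ G) ∧ x s ∈ E}

theorem measure_steps {V : (ι → ℝ) → Set (ι → ℝ)} (hV : ∀ y, ∀ v ∈ V y, ‖v‖ ≤ 1) {n : ℕ} {δ : ℝ}
    (hδ : 0 ≤ δ) (hδn : 4 * δ ≤ 1 / ((n : ℝ) + 1)) (E : Set (ι → ℝ)) (k : ℕ) :
    volume (reachFrom V (goodSet V n) (k * δ) E) ≤ expansion ι (k * δ) * volume E := by
  induction k with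
  | zero =>
    simp only [Nat.cast_zero, zero_mul]
    have h1 : expansion ι 0 = 1 := by simp [expansion]
    rw [h1, one_mul]
    apply measure_mono
    rintro x₀ ⟨x, -, rfl, -, h⟩
    exact h
  | succ k ih =>
    have hk : 0 ≤ (k : ℝ) * δ := by positivity
    have e1 : ((k + 1 : ℕ) : ℝ) * δ = δ + k * δ := by push_cast; ring
    rw [e1, expansion_add, mul_assoc]
    refine le_trans ?_ (mul_le_mul_right ih _)
    refine le_trans (measure_mono ?_) (measure_step hV hδ hδn _)
    rintro x₀ ⟨x, hx, hx0, hG, hE⟩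
    refine ⟨x, hx, hx0, hG δ ⟨hδ, by linarith⟩, fun t => x (δ + t), hx.shift hδ, by simp,
      fun t ht => hG _ ⟨by linarith [ht.1], by linarith [ht.2]⟩, hE⟩

/-- A trajectory over a bounded time is compact, so one radius of good balls serves all its points.
The sets for the different radii increase with `n`, so a bound uniform in `n` passes to their union.
-/
theorem measure_reachFrom_le {V : (ι → ℝ) → Set (ι → ℝ)} (hV : ∀ y, ∀ v ∈ V y, ‖v‖ ≤ 1) {s : ℝ}
    (hs : 0 ≤ s) (E : Set (ι → ℝ)) :
    volume (reachFrom V (goodPoints V) s E) ≤ expansion ι s * volume E := by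
  have hsub : reachFrom V (goodPoints V) s E ⊆ ⋃ n, reachFrom V (goodSet V n) s E := by
    rintro x₀ ⟨x, hx, hx0, hG, hE⟩
    obtain ⟨n, hn⟩ := exists_goodSet_of_isCompact
      ((isCompact_Icc (a := (0 : ℝ)) (b := s)).image_of_continuousOn
        ((hx.continuousOn hV).mono Icc_subset_Ici_self)) (image_subset_iff.2 hG)
    exact mem_iUnion.2 ⟨n, x, hx, hx0, fun t ht => hn (mem_image_of_mem x ht), hE⟩
  have hmono : Monotone fun n => reachFrom V (goodSet V n) s E := by
    rintro n k hnk x₀ ⟨x, hx, hx0, hG, hE⟩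
    exact ⟨x, hx, hx0, fun t ht => goodSet_mono V hnk (hG t ht), hE⟩
  refine (measure_mono hsub).trans ?_
  rw [hmono.measure_iUnion]
  refine iSup_le fun n => ?_
  -- With this many steps, the step length `s / k` is at most a quarter of the good radius.
  obtain ⟨k, hk⟩ := exists_nat_gt (4 * s * ((n : ℝ) + 1))
  have hk0 : (0 : ℝ) < k := lt_of_le_of_lt (by positivity) hk
  have h := measure_steps hV (n := n) (δ := s / k) (by positivity) (by
    rw [le_div_iff₀ (by positivity), mul_div_assoc', div_mul_eq_mul_div, div_le_one hk0]
    exact hk.le) E k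
  rwa [mul_div_cancel₀ _ hk0.ne'] at h

/-- Points of `goodSet V n` from which two solutions separate before time `1 / (4 (n + 1))`. -/
def splitSet (V : (ι → ℝ) → Set (ι → ℝ)) (n : ℕ) : Set (ι → ℝ) :=
  {x₀ | x₀ ∈ goodSet V n ∧ ∃ x y, IsSol V x ∧ IsSol V y ∧ x 0 = x₀ ∧ y 0 = x₀ ∧
    ∃ t ∈ Icc 0 (1 / (4 * ((n : ℝ) + 1))), x t ≠ y t}

/-- The statement is local. A point `c` of the set has itself a good ball, and solutions that start
within half its radius cannot leave it in a quarter of its radius as time, since their speed is at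
most 2. There `GoodBall.measure_nonunique` applies. -/
theorem volume_splitSet {V : (ι → ℝ) → Set (ι → ℝ)} (hV : ∀ y, ∀ v ∈ V y, ‖v‖ ≤ 1) (n : ℕ) :
    volume (splitSet V n) = 0 := by
  have hρ : (0 : ℝ) < 1 / ((n : ℝ) + 1) := by positivity
  have hρ4 : 1 / (4 * ((n : ℝ) + 1)) = (1 / ((n : ℝ) + 1)) / 4 := by field_simp
  refine measure_null_of_locally_null _ fun c hc => ?_
  refine ⟨splitSet V n ∩ Metric.ball c (1 / ((n : ℝ) + 1) / 2),
    inter_mem self_mem_nhdsWithin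
      (mem_nhdsWithin_of_mem_nhds (Metric.ball_mem_nhds _ (by positivity))), ?_⟩
  refine measure_mono_null ?_ (GoodBall.measure_nonunique (δ := 1 / (4 * ((n : ℝ) + 1))) hc.1)
  rintro x₀ ⟨⟨-, x, y, hx, hy, hx0, hy0, hne⟩, hball⟩
  have key : ∀ w, IsSol V w → w 0 = x₀ → ∀ t ∈ Icc 0 (1 / (4 * ((n : ℝ) + 1))),
      w t ∈ Metric.ball c (1 / ((n : ℝ) + 1)) := by
    intro w hw hw0 t ht
    have h1 := hw.dist_le hV le_rfl ht.1
    rw [sub_zero, abs_of_nonneg ht.1, hw0] at h1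
    have h2 := Metric.mem_ball.1 hball
    have h3 := dist_triangle (w t) x₀ c
    have h4 := ht.2
    rw [hρ4] at h4
    rw [Metric.mem_ball]
    linarith
  exact ⟨x, y, hx, hy, hx0, hy0, key x hx hx0, key y hy hy0, hne⟩

/-- If two solutions separate at a time `τ`, then at a rational time shortly before `τ` (or at 0, if
`τ = 0`) they still agree and sit at a point of some `splitSet V n`. Each of these countably many
events has null probability, because going back in time along good points preserves null sets. -/
theorem ae_unique_of_goodPoints {V : (ι → ℝ) → Set (ι → ℝ)} (hV : ∀ y, ∀ v ∈ V y, ‖v‖ ≤ 1) :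
    ∀ᵐ x₀ : ι → ℝ, ∀ x y, IsSol V x → IsSol V y → x 0 = x₀ → y 0 = x₀ →
      (∀ t, 0 ≤ t → x t ∈ goodPoints V) → ∀ t, 0 ≤ t → x t = y t := by
  have hnull : ∀ᵐ x₀ : ι → ℝ, ∀ (n : ℕ) (s : ℚ), 0 ≤ s →
      x₀ ∉ reachFrom V (goodPoints V) s (splitSet V n) := by
    simp only [ae_all_iff]
    intro n s hs
    have h := measure_reachFrom_le hV (s := s) (by exact_mod_cast hs) (splitSet V n)
    rw [volume_splitSet hV, mul_zero, nonpos_iff_eq_zero] at h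
    exact measure_eq_zero_iff_ae_notMem.1 h
  filter_upwards [hnull] with x₀ h x y hx hy hx0 hy0 hG
  by_contra! hne
  obtain ⟨t₁, ht₁, hne⟩ := hne
  let D : Set ℝ := {t | 0 ≤ t ∧ x t ≠ y t}
  have hDb : BddBelow D := ⟨0, fun t ht => ht.1⟩
  have hDn : D.Nonempty := ⟨t₁, ht₁, hne⟩
  set τ := sInf D with hτ
  have hτ0 : 0 ≤ τ := le_csInf hDn fun t ht => ht.1
  obtain ⟨r, hr, hg⟩ := hG τ hτ0
  obtain ⟨n, hn⟩ := exists_nat_one_div_lt (half_pos hr)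
  set δ : ℝ := 1 / (4 * ((n : ℝ) + 1)) with hδ
  have hδ0 : 0 < δ := by positivity
  obtain ⟨s, hs0, hsτ, hs1, hs2, hxy⟩ : ∃ s : ℚ, 0 ≤ s ∧ (s : ℝ) ≤ τ ∧ τ - s < δ ∧
      τ - s < r / 4 ∧ x s = y s := by
    rcases hτ0.eq_or_lt with h0 | h0
    · exact ⟨0, le_rfl, by simpa using hτ0, by simpa [← h0] using hδ0,
        by simpa [← h0] using hr, by simp [hx0, hy0]⟩
    · obtain ⟨s, hs, hs'⟩ := exists_rat_btwn
        (max_lt h0 (max_lt (sub_lt_self τ hδ0) (sub_lt_self τ (by positivity : 0 < r / 4))))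
      simp only [max_lt_iff] at hs
      refine ⟨s, by exact_mod_cast hs.1.le, hs'.le, by linarith, by linarith, ?_⟩
      by_contra hc
      exact (notMem_of_lt_csInf hs' hDb) ⟨hs.1.le, hc⟩
  have hs0' : (0 : ℝ) ≤ s := by exact_mod_cast hs0
  have hgs : x s ∈ goodSet V n := by
    refine mem_goodSet_of_dist hg hn.le ?_
    have := hx.dist_le hV hτ0 hs0'
    rw [abs_sub_comm, abs_of_nonneg (by linarith)] at this
    linarith
  obtain ⟨t, ht, hts⟩ := (csInf_lt_iff hDb hDn).1 (show sInf D < s + δ by linarith)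
  have hst : (s : ℝ) ≤ t := hsτ.trans (csInf_le hDb ht)
  refine h n s hs0 ⟨x, hx, hx0, fun t ht => hG t ht.1, hgs, fun t => x (s + t),
    fun t => y (s + t), hx.shift hs0', hy.shift hs0', by simp, by simp [hxy], t - s,
    ⟨by linarith, by linarith⟩, ?_⟩
  simpa using ht.2

/-- Coverings by small balls with arbitrarily small total `(d-1)`-dimensional size, where `d` is
the dimension of the space. -/
def HasThinCovers (Q : Set (ι → ℝ)) : Prop :=
  ∀ η : ℝ, 0 < η → ∃ (c : ℕ → ι → ℝ) (r : ℕ → ℝ), (∀ j, 0 ≤ r j ∧ r j ≤ η) ∧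
    Q ⊆ ⋃ j, Metric.ball (c j) (r j) ∧
    ∑' j, ENNReal.ofReal (r j ^ Fintype.card ι / r j) ≤ ENNReal.ofReal η

theorem eq_zero_of_le_mul_ofReal {a C : ENNReal} (hC : C ≠ ⊤) {η₀ : ℝ} (h0 : 0 < η₀)
    (h : ∀ η, 0 < η → η ≤ η₀ → a ≤ C * ENNReal.ofReal η) : a = 0 := by
  have ht : Tendsto (fun η : ℝ => C * ENNReal.ofReal η) (𝓝[>] 0) (𝓝 0) := by
    have h1 : Tendsto (fun η : ℝ => ENNReal.ofReal η) (𝓝[>] 0) (𝓝 0) := by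
      have := (ENNReal.continuous_ofReal.tendsto 0).mono_left
        (nhdsWithin_le_nhds (s := Ioi (0 : ℝ)))
      simpa using this
    simpa using ENNReal.Tendsto.const_mul h1 (Or.inr hC)
  have : ∀ᶠ η in 𝓝[>] (0 : ℝ), a ≤ C * ENNReal.ofReal η := by
    filter_upwards [Ioc_mem_nhdsGT h0] with η hη using h η hη.1 hη.2
  exact nonpos_iff_eq_zero.1 (ge_of_tendsto ht this)

theorem HasThinCovers.volume_eq_zero {Q : Set (ι → ℝ)} (h : HasThinCovers Q) : volume Q = 0 := by
  refine eq_zero_of_le_mul_ofReal (C := 2 ^ Fintype.card ι) (by simp) one_pos fun η hη hη1 => ?_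
  obtain ⟨c, r, hr, hQ, hsum⟩ := h η hη
  calc volume Q ≤ ∑' j, volume (Metric.ball (c j) (r j)) :=
        (measure_mono hQ).trans (measure_iUnion_le _)
    _ ≤ ∑' j, 2 ^ Fintype.card ι * ENNReal.ofReal (r j ^ Fintype.card ι / r j) := by
        refine ENNReal.tsum_le_tsum fun j => ?_
        rcases (hr j).1.eq_or_lt with h1 | h1
        · simp [← h1]
        have h2 : r j ≤ 1 := (hr j).2.trans hη1
        rw [Real.volume_pi_ball _ h1, mul_pow, ENNReal.ofReal_mul (by positivity)]
        gcongr
        · simp [ENNReal.ofReal_pow]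
        · rw [le_div_iff₀ h1]
          exact mul_le_of_le_one_right (by positivity) h2
    _ ≤ _ := by rw [ENNReal.tsum_mul_left]; gcongr

/-- Almost no point is the initial point of a solution that ever meets a thin set which contains
all points without a good ball. -/
theorem ae_not_hit {V : (ι → ℝ) → Set (ι → ℝ)} (hV : ∀ y, ∀ v ∈ V y, ‖v‖ ≤ 1)
    {Q : Set (ι → ℝ)} (hQc : IsClosed Q) (hQ : Qᶜ ⊆ goodPoints V) (hcov : HasThinCovers Q) :
    ∀ᵐ x₀ : ι → ℝ, ∀ x, IsSol V x → x 0 = x₀ → ∀ t, 0 ≤ t → x t ∉ Q := by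
  -- The first hitting time is kept away from 0 and from infinity, so that a grid of mesh `r j` has
  -- a bounded expansion factor and at most about `(n + 2) / r j` points.
  let N : ℕ → Set (ι → ℝ) := fun n => {x₀ | ∃ x, IsSol V x ∧ x 0 = x₀ ∧
    ∃ h, 1 / ((n : ℝ) + 1) ≤ h ∧ h ≤ n + 1 ∧ (∀ t ∈ Ico 0 h, x t ∉ Q) ∧ x h ∈ Q}
  have hN : ∀ n, volume (N n) = 0 := by
    intro n
    set d := Fintype.card ι
    have hC : ((n : ENNReal) + 2) * (expansion ι (n + 1) * 6 ^ d) ≠ ⊤ := by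
      refine ENNReal.mul_ne_top (by finiteness) (ENNReal.mul_ne_top (expansion_ne_top _) ?_)
      simp
    refine eq_zero_of_le_mul_ofReal hC (η₀ := 1 / ((n : ℝ) + 2)) (by positivity)
      fun η hη hη1 => ?_
    obtain ⟨c, r, hr, hQsub, hsum⟩ := hcov η hη
    have hη2 : η < 1 / ((n : ℝ) + 1) := hη1.trans_lt (by gcongr; norm_num)
    have hη3 : η ≤ 1 := hη1.trans (by rw [div_le_one (by positivity)]; linarith)
    -- At the last grid time `k * r j` strictly before hitting, the solution has met only good
    -- points and is within `r j + 2 * r j` of the centre of the ball that it is about to enter.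
    have hsub : N n ⊆ ⋃ j, ⋃ k ∈ Finset.range (⌊((n : ℝ) + 1) / r j⌋₊ + 1),
        reachFrom V (goodPoints V) (k * r j) (Metric.ball (c j) (3 * r j)) := by
      rintro x₀ ⟨x, hx, hx0, h, hh1, hh2, hh, hhQ⟩
      obtain ⟨j, hj⟩ := mem_iUnion.1 (hQsub hhQ)
      have hrj : 0 < r j := Metric.nonempty_ball.1 ⟨_, hj⟩
      have hrh : r j < h := (hr j).2.trans_lt (hη2.trans_le hh1)
      have hh0 : 0 < h := hrj.trans hrh
      obtain ⟨k, hk⟩ : ∃ k, ⌈h / r j⌉₊ = k + 1 :=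
        Nat.exists_eq_succ_of_ne_zero (Nat.ceil_pos.2 (by positivity)).ne'
      have hk1 : h ≤ (k + 1) * r j := by
        have := Nat.le_ceil (h / r j)
        rw [hk, div_le_iff₀ hrj] at this
        exact_mod_cast this
      have hk2 : k * r j < h := by
        have := Nat.ceil_lt_add_one (a := h / r j) (by positivity)
        rw [hk] at this
        push_cast at this
        rw [← lt_div_iff₀ hrj]
        linarith
      have hk0 : 0 ≤ (k : ℝ) * r j := by positivity
      refine mem_iUnion.2 ⟨j, mem_iUnion₂.2 ⟨k, ?_, x, hx, hx0, fun t ht =>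
        hQ (hh t ⟨ht.1, ht.2.trans_lt hk2⟩), ?_⟩⟩
      · rw [Finset.mem_range, Nat.lt_succ_iff]
        apply Nat.le_floor
        rw [le_div_iff₀ hrj]
        linarith
      · have h1 := hx.dist_le hV hh0.le hk0
        rw [abs_sub_comm, abs_of_nonneg (by linarith)] at h1
        have h2 := Metric.mem_ball.1 hj
        have h3 := dist_triangle (x (k * r j)) (x h) (c j)
        rw [Metric.mem_ball]
        linarith
    have hpiece : ∀ j, volume (⋃ k ∈ Finset.range (⌊((n : ℝ) + 1) / r j⌋₊ + 1),
        reachFrom V (goodPoints V) (k * r j) (Metric.ball (c j) (3 * r j))) ≤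
        ((n : ENNReal) + 2) * (expansion ι (n + 1) * 6 ^ d) *
          ENNReal.ofReal (r j ^ d / r j) := by
      intro j
      rcases (hr j).1.eq_or_lt with hrj | hrj
      · simp [← hrj, reachFrom]
      have hterm : ∀ k ∈ Finset.range (⌊((n : ℝ) + 1) / r j⌋₊ + 1),
          volume (reachFrom V (goodPoints V) (k * r j) (Metric.ball (c j) (3 * r j))) ≤
            expansion ι (n + 1) * 6 ^ d * ENNReal.ofReal (r j ^ d) := by
        intro k hk
        rw [Finset.mem_range, Nat.lt_succ_iff, Nat.le_floor_iff (by positivity),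
          le_div_iff₀ hrj] at hk
        refine (measure_reachFrom_le hV (by positivity) _).trans ?_
        rw [Real.volume_pi_ball _ (by positivity), mul_assoc]
        gcongr
        · exact expansion_mono hk
        · rw [show 2 * (3 * r j) = 6 * r j by ring, mul_pow, ENNReal.ofReal_mul (by positivity)]
          rw [ENNReal.ofReal_pow (by norm_num)]
          simp [d]
      refine (measure_biUnion_finset_le _ _).trans ((Finset.sum_le_sum hterm).trans ?_)
      rw [Finset.sum_const, Finset.card_range, nsmul_eq_mul]
      -- The number of grid times costs one power of the radius: this is why `HasThinCovers` weighs
      -- a ball by `r ^ d / r`.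
      have hcount : (((⌊((n : ℝ) + 1) / r j⌋₊ + 1 : ℕ) : ENNReal)) ≤
          ((n : ENNReal) + 2) * ENNReal.ofReal (1 / r j) := by
        have h1 : ((⌊((n : ℝ) + 1) / r j⌋₊ + 1 : ℕ) : ℝ) ≤ ((n : ℝ) + 2) * (1 / r j) := by
          have h2 := Nat.floor_le (a := ((n : ℝ) + 1) / r j) (by positivity)
          have h3 : 1 ≤ 1 / r j := by
            rw [le_div_iff₀ hrj, one_mul]; exact (hr j).2.trans hη3
          push_cast
          calc _ ≤ ((n : ℝ) + 1) / r j + 1 / r j := add_le_add h2 h3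
            _ = _ := by ring
        have h2 := ENNReal.ofReal_le_ofReal h1
        rw [ENNReal.ofReal_natCast, ENNReal.ofReal_mul (by positivity)] at h2
        refine h2.trans_eq ?_
        congr 1
        rw [ENNReal.ofReal_add (by positivity) (by norm_num)]
        simp
      calc _ ≤ ((n : ENNReal) + 2) * ENNReal.ofReal (1 / r j) *
            (expansion ι (n + 1) * 6 ^ d * ENNReal.ofReal (r j ^ d)) := by gcongr
        _ = _ := by
          rw [div_eq_mul_one_div (r j ^ d), ENNReal.ofReal_mul (by positivity)]
          ring
    calc volume (N n) ≤ _ := (measure_mono hsub).trans (measure_iUnion_le _)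
      _ ≤ _ := ENNReal.tsum_le_tsum hpiece
      _ ≤ _ := by rw [ENNReal.tsum_mul_left]; gcongr
  have h1 : ∀ᵐ x₀ : ι → ℝ, ∀ n, x₀ ∉ N n :=
    ae_all_iff.2 fun n => measure_eq_zero_iff_ae_notMem.1 (hN n)
  have h2 : ∀ᵐ x₀ : ι → ℝ, x₀ ∉ Q := measure_eq_zero_iff_ae_notMem.1 hcov.volume_eq_zero
  filter_upwards [h1, h2] with x₀ hN hx0Q x hx hx0 t ht htQ
  -- Closedness of `Q` makes the infimum a genuine first hitting time; it is positive since the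
  -- start is not in `Q`.
  let D : Set ℝ := Ici 0 ∩ x ⁻¹' Q
  have hDc : IsClosed D := (hx.continuousOn hV).preimage_isClosed_of_isClosed isClosed_Ici hQc
  have hDb : BddBelow D := ⟨0, fun t ht => ht.1⟩
  have hm : sInf D ∈ D := hDc.csInf_mem ⟨t, ht, htQ⟩ hDb
  have hpos : 0 < sInf D := by
    refine lt_of_le_of_ne hm.1 fun h => hx0Q ?_
    rw [← hx0, h]; exact hm.2
  obtain ⟨n1, hn1⟩ := exists_nat_one_div_lt hpos
  obtain ⟨n2, hn2⟩ := exists_nat_gt (sInf D)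
  have hn1' : (n1 : ℝ) ≤ (max n1 n2 : ℕ) := by exact_mod_cast le_max_left _ _
  have hn2' : (n2 : ℝ) ≤ (max n1 n2 : ℕ) := by exact_mod_cast le_max_right _ _
  refine hN (max n1 n2) ⟨x, hx, hx0, sInf D, ?_, by linarith, fun s hs hsQ => ?_, hm.2⟩
  · refine le_trans ?_ hn1.le
    gcongr
  · exact (notMem_of_lt_csInf hs.2 hDb) ⟨hs.1, hsQ⟩

end AbstractFlow

/-! ### Hausdorff measure of zero sets of polynomials, and elimination. -/

section ZeroSets

set_option linter.unusedSectionVars false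

variable {ι : Type*} [Fintype ι] [DecidableEq ι]

theorem totalDegree_pderiv_lt {p : MvPolynomial ι ℝ} {j : ι} (h : MvPolynomial.pderiv j p ≠ 0) :
    (MvPolynomial.pderiv j p).totalDegree < p.totalDegree := by
  obtain ⟨m, hm⟩ := MvPolynomial.ne_zero_iff.1 h
  have key : ∀ m ∈ (MvPolynomial.pderiv j p).support, (m.sum fun _ e => e) + 1 ≤ p.totalDegree := by
    intro m hm
    rw [MvPolynomial.mem_support_iff, MvPolynomial.coeff_pderiv] at hm
    have h1 := MvPolynomial.le_totalDegree (MvPolynomial.mem_support_iff.2 (left_ne_zero_of_mul hm))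
    rwa [Finsupp.sum_add_index' (fun _ => rfl) (fun _ _ _ => rfl),
      Finsupp.sum_single_index rfl] at h1
  have hpos : 0 < p.totalDegree :=
    lt_of_lt_of_le (Nat.succ_pos _) (key m (MvPolynomial.mem_support_iff.2 hm))
  rw [MvPolynomial.totalDegree, Finset.sup_lt_iff hpos]
  exact fun m hm => key m hm

theorem exists_pderiv_ne_zero {p : MvPolynomial ι ℝ} (h : 0 < p.totalDegree) :
    ∃ j, MvPolynomial.pderiv j p ≠ 0 := by
  obtain ⟨m, hm, hm0⟩ : ∃ m ∈ p.support, m ≠ 0 := by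
    by_contra! hc
    have : p.totalDegree ≤ 0 := Finset.sup_le fun m hm => by simp [hc m hm]
    omega
  obtain ⟨j, hj⟩ := Finsupp.ne_iff.1 hm0
  refine ⟨j, MvPolynomial.ne_zero_iff.2 ⟨m - Finsupp.single j 1, ?_⟩⟩
  rw [MvPolynomial.coeff_pderiv, tsub_add_cancel_of_le]
  · exact mul_ne_zero (MvPolynomial.mem_support_iff.1 hm) (by positivity)
  · rw [Finsupp.single_le_iff]; exact Nat.one_le_iff_ne_zero.2 hj

theorem hasStrictFDerivAt_eval (p : MvPolynomial ι ℝ) (x : ι → ℝ) :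
    HasStrictFDerivAt (fun y => MvPolynomial.eval y p)
      (∑ j, MvPolynomial.eval x (MvPolynomial.pderiv j p) •
        (ContinuousLinearMap.proj j : (ι → ℝ) →L[ℝ] ℝ)) x := by
  induction p using MvPolynomial.induction_on with
  | C a => simpa using hasStrictFDerivAt_const a x
  | add p q hp hq =>
    simp only [map_add, add_smul, Finset.sum_add_distrib]
    exact hp.add hq
  | mul_X p i hp =>
    have hX : HasStrictFDerivAt (fun y : ι → ℝ => y i)
      (ContinuousLinearMap.proj i : (ι → ℝ) →L[ℝ] ℝ) x :=
      (ContinuousLinearMap.proj i : (ι → ℝ) →L[ℝ] ℝ).hasStrictFDerivAt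
    have h := hp.mul hX
    simp only [map_mul, MvPolynomial.eval_X]
    refine HasStrictFDerivAt.congr_fderiv h ?_
    ext v
    simp only [sum_apply, smul_apply, add_apply, ContinuousLinearMap.proj_apply, smul_eq_mul,
      MvPolynomial.pderiv_mul, MvPolynomial.pderiv_X, map_add, map_mul, MvPolynomial.eval_X, add_mul,
      Finset.sum_add_distrib, Finset.mul_sum]
    rw [add_comm]
    congr 1
    · exact Finset.sum_congr rfl fun j _ => by ring
    · rw [Finset.sum_eq_single i]
      · simp
      · intro b _ hb; simp [hb.symm]
      · simp

theorem continuous_eval (p : MvPolynomial ι ℝ) : Continuous fun x => MvPolynomial.eval x p :=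
  MvPolynomial.continuous_eval p

/-- Forgetting the coordinate `j`. -/
def forget (j : ι) (x : ι → ℝ) : {a // a ≠ j} → ℝ := fun a => x a

theorem norm_le_max_forget (j : ι) (v : ι → ℝ) : ‖v‖ ≤ max |v j| ‖forget j v‖ := by
  rw [pi_norm_le_iff_of_nonneg (le_max_of_le_left (abs_nonneg _))]
  intro i
  by_cases h : i = j
  · rw [h]; exact le_max_left _ _
  · exact le_max_of_le_right (norm_le_pi_norm (forget j v) ⟨i, h⟩)

/-- The hypothesis says that `v` is almost orthogonal to the gradient `g`. As `g j ≠ 0`, the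
coordinate `v j` is then controlled by the other ones, so forgetting it loses only a constant
factor. -/
theorem norm_le_forget {g : ι → ℝ} {j : ι} (hgj : 0 < |g j|) (v : ι → ℝ)
    (h3 : |∑ i, g i * v i| ≤ |g j| / 2 * ‖v‖) :
    ‖v‖ ≤ (1 + 2 * (∑ i, |g i|) / |g j|) * ‖forget j v‖ := by
  obtain ⟨C, hC⟩ : ∃ C, C = ∑ i, |g i| := ⟨_, rfl⟩
  have hC0 : 0 ≤ C := hC ▸ Finset.sum_nonneg fun _ _ => abs_nonneg _
  rw [← hC]
  have h4 : |g j| * |v j| ≤ |∑ i, g i * v i| + C * ‖forget j v‖ := by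
    have h5 : g j * v j = ∑ i, g i * v i - ∑ i ∈ Finset.univ.erase j, g i * v i := by
      rw [← Finset.add_sum_erase _ _ (Finset.mem_univ j)]; ring
    have h6 : |∑ i ∈ Finset.univ.erase j, g i * v i| ≤ C * ‖forget j v‖ := by
      refine (Finset.abs_sum_le_sum_abs _ _).trans ?_
      rw [hC, Finset.sum_mul]
      refine (Finset.sum_le_sum fun i hi => ?_).trans
        (Finset.sum_le_sum_of_subset_of_nonneg (Finset.erase_subset j _)
          fun i _ _ => by positivity)
      rw [abs_mul]
      gcongr
      exact norm_le_pi_norm (forget j v) ⟨i, Finset.ne_of_mem_erase hi⟩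
    rw [← abs_mul, h5]
    refine (abs_sub _ _).trans ?_
    linarith
  have h7 := norm_le_max_forget j v
  have hq : 0 ≤ 2 * C / |g j| := by positivity
  rcases le_total |v j| ‖forget j v‖ with h8 | h8
  · rw [max_eq_right h8] at h7
    exact h7.trans (le_mul_of_one_le_left (norm_nonneg _) (by linarith))
  · rw [max_eq_left h8] at h7
    have h9 : |g j| / 2 * |v j| ≤ C * ‖forget j v‖ := by
      have : |g j| / 2 * ‖v‖ ≤ |g j| / 2 * |v j| := by gcongr
      linarith
    have h10 : |v j| ≤ 2 * C / |g j| * ‖forget j v‖ := by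
      rw [div_mul_eq_mul_div, le_div_iff₀ hgj]
      linarith
    rw [add_mul]
    have := norm_nonneg (forget j v)
    linarith

theorem hausdorffMeasure_null_of_forget {d : ℝ} (hd : 0 ≤ d) (j : ι) {S : Set (ι → ℝ)} {K : ℝ}
    (hK0 : 0 ≤ K) (hanti : ∀ y ∈ S, ∀ y' ∈ S, ‖y - y'‖ ≤ K * ‖forget j (y - y')‖)
    (hS : μH[d] (forget j '' S) = 0) : μH[d] S = 0 := by
  let f : S → ({a // a ≠ j} → ℝ) := fun y => forget j y
  have hf : AntilipschitzWith ⟨K, hK0⟩ f := by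
    apply AntilipschitzWith.of_le_mul_dist
    intro y y'
    rw [Subtype.dist_eq, dist_eq_norm, dist_eq_norm]
    exact hanti y y.2 y' y'.2
  have h11 := hf.le_hausdorffMeasure_image hd univ
  have h12 : f '' univ = forget j '' S := by
    rw [image_univ]
    exact range_comp (forget j) Subtype.val |>.trans (by rw [Subtype.range_coe])
  rw [h12, hS, mul_zero, nonpos_iff_eq_zero] at h11
  have h13 := (isometry_subtype_coe (s := S)).hausdorffMeasure_image (Or.inl hd) univ
  rwa [h11, image_univ, Subtype.range_coe] at h13

/-- Induction on the degree. Some partial derivative `∂ⱼp` is a nonzero polynomial of smaller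
degree, and its zeros are covered by the induction. Where it does not vanish, strict
differentiability makes the projection along coordinate `j` locally antilipschitz on the zeros of
`p`, so the measure is controlled by the projection of `Z`, which is null. -/
theorem hausdorffMeasure_zeroSet {d : ℝ} (hd : 0 ≤ d) (Z : Set (ι → ℝ))
    (hZ : ∀ j, μH[d] (forget j '' Z) = 0) (n : ℕ) :
    ∀ p : MvPolynomial ι ℝ, p ≠ 0 → p.totalDegree ≤ n →
      μH[d] (Z ∩ {x | MvPolynomial.eval x p = 0}) = 0 := by
  induction n with
  | zero =>
    intro p hp hn
    have h1 := MvPolynomial.totalDegree_eq_zero_iff_eq_C.1 (Nat.le_zero.1 hn)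
    have : Z ∩ {x | MvPolynomial.eval x p = 0} = ∅ := by
      refine eq_empty_of_forall_notMem fun x hx => hp ?_
      have h2 := hx.2
      rw [mem_ofPred_eq, h1, MvPolynomial.eval_C] at h2
      rw [h1, h2, map_zero]
    rw [this, measure_empty]
  | succ n ih =>
    intro p hp hn
    rcases Nat.eq_zero_or_pos p.totalDegree with h0 | hpos
    · exact ih p hp (by omega)
    obtain ⟨j, hj⟩ := exists_pderiv_ne_zero hpos
    have h1 := ih _ hj (by have := totalDegree_pderiv_lt hj; omega)
    set S : Set (ι → ℝ) := {x | x ∈ Z ∧ MvPolynomial.eval x p = 0 ∧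
      MvPolynomial.eval x (MvPolynomial.pderiv j p) ≠ 0} with hS
    suffices h2 : μH[d] S = 0 by
      refine measure_mono_null ?_ (measure_union_null h1 h2)
      intro x hx
      by_cases h : MvPolynomial.eval x (MvPolynomial.pderiv j p) = 0
      · exact Or.inl ⟨hx.1, h⟩
      · exact Or.inr ⟨hx.1, hx.2, h⟩
    refine measure_null_of_locally_null _ fun x hx => ?_
    obtain ⟨g, hg⟩ : ∃ g : ι → ℝ, g = fun i => MvPolynomial.eval x (MvPolynomial.pderiv i p) :=
      ⟨_, rfl⟩
    have hgj : 0 < |g j| := abs_pos.2 (hg ▸ hx.2.2)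
    have hstrict := (hasStrictFDerivAt_eval p x).isLittleO.def (half_pos hgj)
    obtain ⟨U, hU, hUx⟩ : ∃ U ∈ 𝓝 x, ∀ y ∈ U, ∀ y' ∈ U,
        |MvPolynomial.eval y p - MvPolynomial.eval y' p - ∑ i, g i * (y i - y' i)| ≤
          |g j| / 2 * ‖y - y'‖ := by
      rw [nhds_prod_eq] at hstrict
      obtain ⟨U, hU, h⟩ := mem_prod_self_iff.1 hstrict
      refine ⟨U, hU, fun y hy y' hy' => ?_⟩
      have := h (mk_mem_prod hy hy')
      simpa [sum_apply, hg] using this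
    refine ⟨S ∩ U, inter_mem self_mem_nhdsWithin (mem_nhdsWithin_of_mem_nhds hU), ?_⟩
    obtain ⟨K, hK⟩ : ∃ K, K = 1 + 2 * (∑ i, |g i|) / |g j| := ⟨_, rfl⟩
    have hK0 : 0 ≤ K := by
      have : 0 ≤ ∑ i, |g i| := Finset.sum_nonneg fun _ _ => abs_nonneg _
      rw [hK]; positivity
    have hanti : ∀ y ∈ S ∩ U, ∀ y' ∈ S ∩ U,
        ‖y - y'‖ ≤ K * ‖forget j (y - y')‖ := by
      intro y hy y' hy'
      have h3 := hUx y hy.2 y' hy'.2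
      rw [hy.1.2.1, hy'.1.2.1, sub_zero, zero_sub, abs_neg] at h3
      exact hK ▸ norm_le_forget hgj (y - y') h3
    refine hausdorffMeasure_null_of_forget hd j hK0 hanti (measure_mono_null ?_ (hZ j))
    exact image_mono fun y hy => hy.1.1

/-- With `Z` the whole space, the projections live in a space of smaller dimension and are null for
trivial reasons. -/
theorem volume_zeroSet {p : MvPolynomial ι ℝ} (hp : p ≠ 0) :
    volume {x : ι → ℝ | MvPolynomial.eval x p = 0} = 0 := by
  have h := hausdorffMeasure_zeroSet (d := Fintype.card ι) (by positivity) univ (fun j => by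
    rw [Real.hausdorffMeasure_of_finrank_lt]
    · simp
    · rw [Module.finrank_fintype_fun_eq_card]
      exact_mod_cast Fintype.card_subtype_lt (x := j) (by simp)) p.totalDegree p hp le_rfl
  rwa [univ_inter, hausdorffMeasure_pi_real] at h

/-- Eliminating one variable from two coprime polynomials. -/
theorem exists_eliminant {A : Type*} [CommRing A] [IsDomain A] [UniqueFactorizationMonoid A]
    {a b : Polynomial A} (ha : Irreducible a) (hb : Irreducible b) (hab : ¬ Associated a b) :
    ∃ c : A, c ≠ 0 ∧ ∃ s t : Polynomial A, Polynomial.C c = s * a + t * b := by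
  let := UniqueFactorizationMonoid.strongNormalizationMonoid (α := A)
  let := UniqueFactorizationMonoid.toNormalizedGCDMonoid A
  by_cases ha0 : a.natDegree = 0
  · refine ⟨a.coeff 0, fun h => ?_, 1, 0, ?_⟩
    · apply ha.ne_zero; rw [Polynomial.eq_C_of_natDegree_eq_zero ha0, h, map_zero]
    · rw [one_mul, zero_mul, add_zero]; exact (Polynomial.eq_C_of_natDegree_eq_zero ha0).symm
  by_cases hb0 : b.natDegree = 0
  · refine ⟨b.coeff 0, fun h => ?_, 0, 1, ?_⟩
    · apply hb.ne_zero; rw [Polynomial.eq_C_of_natDegree_eq_zero hb0, h, map_zero]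
    · rw [one_mul, zero_mul, zero_add]; exact (Polynomial.eq_C_of_natDegree_eq_zero hb0).symm
  have hap := ha.isPrimitive ha0
  have hbp := hb.isPrimitive hb0
  -- By Gauss's lemma the two polynomials stay irreducible and non-associated over the fraction
  -- field, hence coprime there; clearing denominators in a Bézout identity gives the eliminant.
  let K := FractionRing A
  have ha' := (hap.irreducible_iff_irreducible_map_fraction_map (K := K)).1 ha
  have hndvd : ¬ (a.map (algebraMap A K)) ∣ (b.map (algebraMap A K)) := fun h =>
    hab (ha.associated_of_dvd hb (hap.dvd_of_fraction_map_dvd_fraction_map h))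
  obtain ⟨s, t, hst⟩ := (ha'.coprime_iff_not_dvd.2 hndvd)
  obtain ⟨c, hc, hcs⟩ := IsLocalization.integerNormalization_spec (nonZeroDivisors A) s
  obtain ⟨e, he, het⟩ := IsLocalization.integerNormalization_spec (nonZeroDivisors A) t
  set s' := IsLocalization.integerNormalization (nonZeroDivisors A) s
  set t' := IsLocalization.integerNormalization (nonZeroDivisors A) t
  refine ⟨c * e, mul_ne_zero (nonZeroDivisors.ne_zero hc) (nonZeroDivisors.ne_zero he),
    Polynomial.C e * s', Polynomial.C c * t', ?_⟩
  apply Polynomial.map_injective (algebraMap A K) (IsFractionRing.injective A K)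
  simp only [Polynomial.map_mul, Polynomial.map_add, Polynomial.map_C, hcs, het]
  rw [Algebra.smul_def, Algebra.smul_def, Polynomial.algebraMap_apply, Polynomial.algebraMap_apply,
    map_mul, map_mul]
  linear_combination (- Polynomial.C ((algebraMap A K) c) * Polynomial.C ((algebraMap A K) e)) * hst

theorem exists_eliminant_mvPolynomial (j : ι) {a b : MvPolynomial ι ℝ} (ha : Irreducible a)
    (hb : Irreducible b) (hab : ¬ Associated a b) :
    ∃ c : MvPolynomial {i // i ≠ j} ℝ, c ≠ 0 ∧ ∃ s t : MvPolynomial ι ℝ,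
      MvPolynomial.rename Subtype.val c = s * a + t * b := by
  let Φ : MvPolynomial ι ℝ ≃ₐ[ℝ] Polynomial (MvPolynomial {i // i ≠ j} ℝ) :=
    (MvPolynomial.renameEquiv ℝ (Equiv.optionSubtypeNe j).symm).trans
      (MvPolynomial.optionEquivLeft ℝ _)
  have hΦ : ∀ c, Φ (MvPolynomial.rename Subtype.val c) = Polynomial.C c := by
    intro c
    induction c using MvPolynomial.induction_on with
    | C r => simp [Φ]
    | add p q hp hq => simp only [map_add, hp, hq]
    | mul_X p i hp =>
      rw [map_mul, map_mul, hp, map_mul]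
      congr 1
      have := Equiv.optionSubtypeNe_symm_of_ne i.2
      simp only [MvPolynomial.rename_X, Φ, AlgEquiv.trans_apply, MvPolynomial.renameEquiv_apply,
        this, MvPolynomial.optionEquivLeft_X_some]
  obtain ⟨c, hc, s, t, hst⟩ := exists_eliminant ((MulEquiv.irreducible_iff Φ).2 ha)
    ((MulEquiv.irreducible_iff Φ).2 hb) (fun h => hab (by
      have := h.map (Φ.symm : _ →* MvPolynomial ι ℝ)
      simpa using this))
  refine ⟨c, hc, Φ.symm s, Φ.symm t, ?_⟩
  apply Φ.injective
  rw [hΦ, hst]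
  simp

/-- Eliminating coordinate `j` leaves a nonzero polynomial in the other coordinates which vanishes
on the projection of the common zeros. All projections are thus Lebesgue null in one dimension less,
and `hausdorffMeasure_zeroSet` lifts this back. -/
theorem hausdorffMeasure_common_zeros [Nonempty ι] {a b : MvPolynomial ι ℝ} (ha : Irreducible a)
    (hb : Irreducible b) (hab : ¬ Associated a b) :
    μH[(Fintype.card ι : ℝ) - 1]
      {x : ι → ℝ | MvPolynomial.eval x a = 0 ∧ MvPolynomial.eval x b = 0} = 0 := by
  have hcard : 1 ≤ Fintype.card ι := Fintype.card_pos
  have h1 := hausdorffMeasure_zeroSet (d := (Fintype.card ι : ℝ) - 1)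
    (by have : (1 : ℝ) ≤ Fintype.card ι := by exact_mod_cast hcard
        linarith)
    {x : ι → ℝ | MvPolynomial.eval x a = 0 ∧ MvPolynomial.eval x b = 0} (fun j => by
      obtain ⟨c, hc, s, t, hst⟩ := exists_eliminant_mvPolynomial j ha hb hab
      have hcj : ((Fintype.card {i // i ≠ j} : ℕ) : ℝ) = (Fintype.card ι : ℝ) - 1 := by
        rw [Fintype.card_subtype_compl, Fintype.card_subtype_eq, Nat.cast_sub hcard, Nat.cast_one]
      rw [← hcj, hausdorffMeasure_pi_real]
      refine measure_mono_null ?_ (volume_zeroSet hc)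
      rintro _ ⟨x, ⟨hxa, hxb⟩, rfl⟩
      have h := congrArg (MvPolynomial.eval x) hst
      rw [MvPolynomial.eval_rename, map_add, map_mul, map_mul, hxa, hxb] at h
      rw [mul_zero, mul_zero, add_zero] at h
      exact h) _ a ha.ne_zero le_rfl
  rwa [inter_eq_left.2 fun x hx => hx.1] at h1

end ZeroSets

/-! ### Thin covers, and the local structure of the divisors of a polynomial. -/

section ThinCovers

set_option linter.unusedSectionVars false

variable {ι : Type*} [Fintype ι] [DecidableEq ι]

theorem hasThinCovers_empty : HasThinCovers (∅ : Set (ι → ℝ)) := fun η hη =>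
  ⟨0, 0, fun j => ⟨le_rfl, hη.le⟩, empty_subset _, by simp⟩

/-- A set in an efficient cover is enclosed in a ball centred at one of its points, with radius
slightly above its diameter; the excess is summable and as small as desired. -/
theorem hasThinCovers_of_hausdorffMeasure [Nonempty ι] {Q : Set (ι → ℝ)}
    (hQ : μH[(Fintype.card ι : ℝ) - 1] Q = 0) : HasThinCovers Q := by
  intro η hη
  obtain ⟨k, hk⟩ : ∃ k, Fintype.card ι = k + 1 :=
    Nat.exists_eq_succ_of_ne_zero Fintype.card_ne_zero
  have hd : (Fintype.card ι : ℝ) - 1 = (k : ℝ) := by rw [hk]; push_cast; ring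
  rw [hd, Measure.hausdorffMeasure_apply] at hQ
  have hη2 : (0 : ENNReal) < ENNReal.ofReal (η / 2) := ENNReal.ofReal_pos.2 (half_pos hη)
  have h1 := (ENNReal.iSup_eq_zero.1 ((ENNReal.iSup_eq_zero.1 hQ) (ENNReal.ofReal (η / 2)))) hη2
  have hη3 := hη2
  rw [← h1] at hη3
  obtain ⟨t, ht⟩ := iInf_lt_iff.1 hη3
  obtain ⟨hQt, ht⟩ := iInf_lt_iff.1 ht
  obtain ⟨hdiam, hsum⟩ := iInf_lt_iff.1 ht
  obtain ⟨ε, hε0, hε⟩ := ENNReal.exists_pos_sum_of_countable hη2.ne' ℕ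
  have key : ∀ n, ∃ (c : ι → ℝ) (r : ℝ), (0 ≤ r ∧ r ≤ η) ∧ t n ⊆ Metric.ball c r ∧
      ENNReal.ofReal (r ^ Fintype.card ι / r) ≤
        (⨆ _ : (t n).Nonempty, Metric.ediam (t n) ^ (k : ℝ)) + ε n := by
    intro n
    rcases (t n).eq_empty_or_nonempty with h0 | hne
    -- An empty set gets a ball of radius 0, whose weight is 0 because division by zero gives 0.
    · exact ⟨0, 0, ⟨le_rfl, hη.le⟩, by simp [h0], by simp⟩
    obtain ⟨c, hc⟩ := hne
    have hfin : Metric.ediam (t n) ≠ ⊤ := ne_top_of_le_ne_top ENNReal.ofReal_ne_top (hdiam n)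
    set D := (Metric.ediam (t n)).toReal with hD
    have hD0 : 0 ≤ D := ENNReal.toReal_nonneg
    have hDη : D ≤ η / 2 := ENNReal.toReal_le_of_le_ofReal (by positivity) (hdiam n)
    have hcont : Tendsto (fun r : ℝ => r ^ k) (𝓝[>] D) (𝓝 (D ^ k)) :=
      ((continuous_pow k).tendsto D).mono_left nhdsWithin_le_nhds
    have hev := (hcont.eventually_lt_const (lt_add_of_pos_right (D ^ k)
      (NNReal.coe_pos.2 (hε0 n)))).and
      (Ioo_mem_nhdsGT (show D < η by linarith))
    obtain ⟨r, hr1, hr2, hr3⟩ := hev.exists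
    have hr0 : 0 < r := hD0.trans_lt hr2
    refine ⟨c, r, ⟨hr0.le, hr3.le⟩, fun y hy => ?_, ?_⟩
    · rw [Metric.mem_ball, dist_edist]
      exact (ENNReal.toReal_mono hfin (Metric.edist_le_ediam_of_mem hy hc)).trans_lt hr2
    · rw [hk, pow_succ, mul_div_cancel_right₀ _ hr0.ne', iSup_pos ⟨c, hc⟩, ENNReal.rpow_natCast]
      refine (ENNReal.ofReal_le_ofReal hr1.le).trans ?_
      rw [ENNReal.ofReal_add (by positivity) (NNReal.coe_nonneg _), ENNReal.ofReal_pow hD0, hD,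
        ENNReal.ofReal_toReal hfin, ENNReal.ofReal_coe_nnreal]
  choose c r hr hball hle using key
  refine ⟨c, r, hr, hQt.trans (iUnion_mono hball), ?_⟩
  calc _ ≤ ∑' n, ((⨆ _ : (t n).Nonempty, Metric.ediam (t n) ^ (k : ℝ)) + (ε n : ENNReal)) :=
        ENNReal.tsum_le_tsum hle
    _ = _ + _ := ENNReal.tsum_add
    _ ≤ ENNReal.ofReal (η / 2) + ENNReal.ofReal (η / 2) := add_le_add hsum.le hε.le
    _ = ENNReal.ofReal η := by
        rw [← ENNReal.ofReal_add (by positivity) (by positivity), add_halves]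

/-- The points where two non-associated irreducible factors of `F` vanish. -/
def multiZeros (F : MvPolynomial ι ℝ) : Set (ι → ℝ) :=
  {x | ∃ a b : MvPolynomial ι ℝ, Irreducible a ∧ Irreducible b ∧ a ∣ F ∧ b ∣ F ∧ ¬ Associated a b ∧
    MvPolynomial.eval x a = 0 ∧ MvPolynomial.eval x b = 0}

theorem eval_eq_zero_of_associated {a b : MvPolynomial ι ℝ} (h : Associated a b) {x : ι → ℝ}
    (ha : MvPolynomial.eval x a = 0) : MvPolynomial.eval x b = 0 := by
  obtain ⟨u, rfl⟩ := h
  rw [map_mul, ha, zero_mul]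

theorem multiZeros_eq_biUnion {F : MvPolynomial ι ℝ} (hF : F ≠ 0) :
    ∃ s : Set (MvPolynomial ι ℝ × MvPolynomial ι ℝ), s.Finite ∧
      (∀ p ∈ s, Irreducible p.1 ∧ Irreducible p.2 ∧ ¬ Associated p.1 p.2) ∧
      multiZeros F = ⋃ p ∈ s, {x | MvPolynomial.eval x p.1 = 0 ∧ MvPolynomial.eval x p.2 = 0} := by
  classical
  let f := (UniqueFactorizationMonoid.factors F).toFinset
  refine ⟨{p | p ∈ f ×ˢ f ∧ ¬ Associated p.1 p.2},
    (f ×ˢ f).finite_toSet.subset fun p hp => hp.1, ?_, ?_⟩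
  · rintro p ⟨hp, hpa⟩
    rw [Finset.mem_product, Multiset.mem_toFinset, Multiset.mem_toFinset] at hp
    exact ⟨UniqueFactorizationMonoid.irreducible_of_factor _ hp.1,
      UniqueFactorizationMonoid.irreducible_of_factor _ hp.2, hpa⟩
  · ext x
    simp only [mem_iUnion, exists_prop]
    constructor
    · rintro ⟨a, b, ha, hb, haF, hbF, hab, hax, hbx⟩
      obtain ⟨a', ha', haa⟩ := UniqueFactorizationMonoid.exists_mem_factors_of_dvd hF ha haF
      obtain ⟨b', hb', hbb⟩ := UniqueFactorizationMonoid.exists_mem_factors_of_dvd hF hb hbF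
      refine ⟨(a', b'), ⟨?_, fun h => hab ((haa.trans h).trans hbb.symm)⟩,
        eval_eq_zero_of_associated haa hax, eval_eq_zero_of_associated hbb hbx⟩
      rw [Finset.mem_product, Multiset.mem_toFinset, Multiset.mem_toFinset]
      exact ⟨ha', hb'⟩
    · rintro ⟨⟨a, b⟩, ⟨hp, hab⟩, hax, hbx⟩
      rw [Finset.mem_product, Multiset.mem_toFinset, Multiset.mem_toFinset] at hp
      exact ⟨a, b, UniqueFactorizationMonoid.irreducible_of_factor _ hp.1,
        UniqueFactorizationMonoid.irreducible_of_factor _ hp.2,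
        UniqueFactorizationMonoid.dvd_of_mem_factors hp.1,
        UniqueFactorizationMonoid.dvd_of_mem_factors hp.2, hab, hax, hbx⟩

theorem isClosed_multiZeros {F : MvPolynomial ι ℝ} (hF : F ≠ 0) : IsClosed (multiZeros F) := by
  obtain ⟨s, hs, -, h⟩ := multiZeros_eq_biUnion hF
  rw [h]
  refine hs.isClosed_biUnion fun p _ => ?_
  exact (isClosed_eq (continuous_eval p.1) continuous_const).inter
    (isClosed_eq (continuous_eval p.2) continuous_const)

theorem hasThinCovers_multiZeros {F : MvPolynomial ι ℝ} (hF : F ≠ 0) :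
    HasThinCovers (multiZeros F) := by
  rcases isEmpty_or_nonempty ι with hι | hι
  · have : multiZeros F = ∅ := by
      refine eq_empty_of_forall_notMem ?_
      rintro x ⟨a, b, ha, -, -, -, -, hax, -⟩
      apply ha.ne_zero
      rw [MvPolynomial.eq_C_of_isEmpty a] at hax ⊢
      rw [MvPolynomial.eval_C] at hax
      rw [hax, map_zero]
    rw [this]
    exact hasThinCovers_empty
  · apply hasThinCovers_of_hausdorffMeasure
    obtain ⟨s, hs, hirr, h⟩ := multiZeros_eq_biUnion hF
    rw [h]
    refine (measure_biUnion_null_iff hs.countable).2 fun p hp => ?_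
    obtain ⟨h1, h2, h3⟩ := hirr p hp
    exact hausdorffMeasure_common_zeros h1 h2 h3

theorem exists_irreducible_dvd_eval_eq_zero {p : MvPolynomial ι ℝ} (hp : p ≠ 0) {x : ι → ℝ}
    (hx : MvPolynomial.eval x p = 0) : ∃ a, Irreducible a ∧ a ∣ p ∧ MvPolynomial.eval x a = 0 := by
  obtain ⟨u, hu⟩ := UniqueFactorizationMonoid.factors_prod hp
  have h : MvPolynomial.eval x (UniqueFactorizationMonoid.factors p).prod = 0 := by
    have h1 := congrArg (MvPolynomial.eval x) hu
    rw [map_mul, hx] at h1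
    exact (mul_eq_zero.1 h1).resolve_right ((u.isUnit.map (MvPolynomial.eval x)).ne_zero)
  rw [map_multiset_prod, Multiset.prod_eq_zero_iff, Multiset.mem_map] at h
  obtain ⟨a, ha, hax⟩ := h
  exact ⟨a, UniqueFactorizationMonoid.irreducible_of_factor a ha,
    UniqueFactorizationMonoid.dvd_of_mem_factors ha, hax⟩

theorem eval_eq_of_notMem_vars {q : MvPolynomial ι ℝ} {x y : ι → ℝ}
    (h : ∀ i ∈ q.vars, x i = y i) : MvPolynomial.eval x q = MvPolynomial.eval y q :=
  MvPolynomial.eval₂Hom_congr' rfl (fun i hi _ => h i hi) rfl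

theorem vars_subset_of_dvd {p q : MvPolynomial ι ℝ} (hp : p ≠ 0) (h : q ∣ p) :
    q.vars ⊆ p.vars := by
  obtain ⟨r, rfl⟩ := h
  intro i hi
  have hq : q ≠ 0 := left_ne_zero_of_mul hp
  have hr : r ≠ 0 := right_ne_zero_of_mul hp
  rw [MvPolynomial.mem_vars_iff_degreeOf_ne_zero] at hi ⊢
  rw [MvPolynomial.degreeOf_mul_eq hq hr]
  omega

/-- Away from `multiZeros F`, the divisors of `F` have locally the form `q ^ n * g`, where `q` is
one irreducible polynomial and `g` has no zeros. -/
theorem exists_local_factor {F : MvPolynomial ι ℝ} (hF : F ≠ 0) {x : ι → ℝ}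
    (hx : x ∉ multiZeros F) : ∃ q : MvPolynomial ι ℝ, q ≠ 0 ∧ ∀ p, p ∣ F →
      ∃ n g, p = q ^ n * g ∧ MvPolynomial.eval x g ≠ 0 := by
  by_cases h : MvPolynomial.eval x F = 0
  · obtain ⟨q, hq, hqF, hqx⟩ := exists_irreducible_dvd_eval_eq_zero hF h
    refine ⟨q, hq.ne_zero, fun p hp => ?_⟩
    have hp0 : p ≠ 0 := ne_zero_of_dvd_ne_zero hF hp
    obtain ⟨n, g, hqg, hpg⟩ := (FiniteMultiplicity.of_not_isUnit hq.not_isUnit hp0)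
      |>.exists_eq_pow_mul_and_not_dvd
      |>.elim fun g hg => (⟨_, g, hg.2, hg.1⟩ : ∃ n g, ¬ q ∣ g ∧ p = q ^ n * g)
    refine ⟨n, g, hpg, fun hgx => ?_⟩
    have hg0 : g ≠ 0 := by rintro rfl; simp at hqg
    have hgF : g ∣ F := (Dvd.intro_left _ hpg.symm).trans hp
    obtain ⟨a, ha, hag, hax⟩ := exists_irreducible_dvd_eval_eq_zero hg0 hgx
    -- A zero of `g` at `x` would come from an irreducible factor not associated to `q`, which also
    -- vanishes at `x`.
    refine hx ⟨q, a, hq, ha, hqF, hag.trans hgF, fun hassoc => ?_, hqx, hax⟩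
    exact hqg (hassoc.dvd.trans hag)
  · refine ⟨1, one_ne_zero, fun p hp => ⟨0, p, by simp, fun hpx => h ?_⟩⟩
    obtain ⟨r, rfl⟩ := hp
    rw [map_mul, hpx, zero_mul]

end ThinCovers

/-! ### Payoffs of pure strategies, and reduction to a common utility. -/

section Payoffs

variable {N : ℕ} {m : Fin N → ℕ}

/-- The payoff of the pure strategy `k` of player `i` against `σ`. -/
noncomputable def pay (u : Profile m → ℝ) (i : Fin N) (k : Fin (m i + 1)) (σ : Weights m) : ℝ :=
  expectedUtility u (Function.update σ i (Pi.single k 1))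

theorem prod_update (σ : Weights m) (i : Fin N) (s : Fin (m i + 1) → ℝ) (y : Profile m) :
    ∏ j, Function.update σ i s j (y j) = s (y i) * ∏ j ∈ Finset.univ.erase i, σ j (y j) := by
  rw [← Finset.mul_prod_erase _ _ (Finset.mem_univ i), Function.update_self]
  congr 1
  refine Finset.prod_congr rfl fun j hj => ?_
  rw [Function.update_of_ne (Finset.ne_of_mem_erase hj)]

theorem expectedUtility_update (u : Profile m → ℝ) (σ : Weights m) (i : Fin N)
    (s : Fin (m i + 1) → ℝ) :
    expectedUtility u (Function.update σ i s) = ∑ k, s k * pay u i k σ := by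
  simp only [expectedUtility, pay, prod_update, Finset.mul_sum]
  rw [Finset.sum_comm]
  refine Finset.sum_congr rfl fun y _ => ?_
  rw [Finset.sum_eq_single (y i)]
  · rw [Pi.single_eq_same]; ring
  · intro k _ hk; rw [Pi.single_eq_of_ne hk.symm]; ring
  · simp

theorem expectedUtility_eq_sum_pay (u : Profile m → ℝ) (σ : Weights m) (i : Fin N) :
    expectedUtility u σ = ∑ k, σ i k * pay u i k σ := by
  rw [← expectedUtility_update, Function.update_eq_self]

/-- The payoff of `k` ignores what player `i` does in `σ`, and exchanging `k` with `l` in coordinate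
`i` reindexes the sum. Payoffs of different strategies become payoffs of one strategy `l` for
different utilities, so that pointwise identities between utilities carry over. -/
theorem pay_eq_pay_update (u : Profile m → ℝ) (i : Fin N) (k l : Fin (m i + 1)) (σ : Weights m) :
    pay u i k σ = pay (fun y => u (Function.update y i k)) i l σ := by
  simp only [pay, expectedUtility, prod_update]
  let e : Profile m → Profile m := fun y => Function.update y i (Equiv.swap k l (y i))
  have he : Function.Involutive e := fun y => by
    ext j
    by_cases hj : j = i
    · subst hj; simp [e]
    · simp [e, hj]
  rw [← Equiv.sum_comp (Function.Involutive.toPerm e he)]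
  refine Finset.sum_congr rfl fun y _ => ?_
  have h1 : Function.Involutive.toPerm e he y = e y := rfl
  have h2 : ∏ j ∈ Finset.univ.erase i, σ j (e y j) = ∏ j ∈ Finset.univ.erase i, σ j (y j) :=
    Finset.prod_congr rfl fun j hj => by simp [e, Finset.ne_of_mem_erase hj]
  rw [h1, h2]
  by_cases hy : y i = l
  · have h3 : e y = Function.update y i k := by simp [e, hy]
    have h4 : e y i = k := by simp [h3]
    rw [h4, hy, h3, Pi.single_eq_same, Pi.single_eq_same]
  · have h4 : e y i ≠ k := by
      simp only [e, Function.update_self]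
      intro h
      rw [Equiv.swap_apply_eq_iff, Equiv.swap_apply_left] at h
      exact hy h
    rw [Pi.single_eq_of_ne h4, Pi.single_eq_of_ne hy]; ring

theorem pay_sub_eq (v w : Profile m → ℝ) (i : Fin N) (σ : Weights m)
    (h : ∀ (y : Profile m) (a b : Fin (m i + 1)),
      v (Function.update y i a) - v (Function.update y i b) =
        w (Function.update y i a) - w (Function.update y i b)) (k l : Fin (m i + 1)) :
    pay v i k σ - pay v i l σ = pay w i k σ - pay w i l σ := by
  rw [pay_eq_pay_update v i k l, pay_eq_pay_update w i k l, pay_eq_pay_update v i l l,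
    pay_eq_pay_update w i l l]
  simp only [pay, expectedUtility, ← Finset.sum_sub_distrib, ← sub_mul, h]

theorem mem_bestResponse_iff (Γ : Game m) (i : Fin N) (σ : Weights m) (s : Fin (m i + 1) → ℝ) :
    s ∈ bestResponse Γ i σ ↔ s ∈ stdSimplex ℝ (Fin (m i + 1)) ∧
      ∀ k, s k ≠ 0 → ∀ l, pay (Γ i) i l σ ≤ pay (Γ i) i k σ := by
  simp only [bestResponse, mem_ofPred_eq, expectedUtility_update]
  refine and_congr_right fun hs => ⟨fun h k hk l => ?_, fun h s' hs' => ?_⟩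
  · obtain ⟨b, -, hb⟩ := Finset.exists_max_image Finset.univ (fun k => pay (Γ i) i k σ)
      ⟨k, Finset.mem_univ k⟩
    have h1 := h (Pi.single b 1) (single_mem_stdSimplex ℝ b)
    have h2 : ∑ k, (Pi.single b 1 : Fin (m i + 1) → ℝ) k * pay (Γ i) i k σ = pay (Γ i) i b σ := by
      simp [Pi.single_apply]
    rw [h2] at h1
    have h3 : ∑ k, s k * (pay (Γ i) i b σ - pay (Γ i) i k σ) ≤ 0 := by
      simp only [mul_sub, Finset.sum_sub_distrib, ← Finset.sum_mul, hs.2]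
      linarith
    have h4 : ∀ k ∈ Finset.univ, 0 ≤ s k * (pay (Γ i) i b σ - pay (Γ i) i k σ) := fun k hk =>
      mul_nonneg (hs.1 k) (sub_nonneg.2 (hb k hk))
    have h5 := (Finset.sum_eq_zero_iff_of_nonneg h4).1 (le_antisymm h3 (Finset.sum_nonneg h4)) k
      (Finset.mem_univ k)
    have h6 := (mul_eq_zero.1 h5).resolve_left hk
    linarith [hb l (Finset.mem_univ l)]
  · obtain ⟨b, hb⟩ : ∃ b, s b ≠ 0 := by
      by_contra! hc
      have := hs.2
      simp [hc] at this
    have h1 : ∑ k, s k * pay (Γ i) i k σ = pay (Γ i) i b σ := by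
      have : ∀ k ∈ Finset.univ, s k * pay (Γ i) i k σ = s k * pay (Γ i) i b σ := fun k _ => by
        by_cases hk : s k = 0
        · simp [hk]
        · rw [le_antisymm (h b hb k) (h k hk b)]
      rw [Finset.sum_congr rfl this, ← Finset.sum_mul, hs.2, one_mul]
    rw [h1]
    calc ∑ k, s' k * pay (Γ i) i k σ ≤ ∑ k, s' k * pay (Γ i) i b σ :=
          Finset.sum_le_sum fun k _ => mul_le_mul_of_nonneg_left (h b hb k) (hs'.1 k)
      _ = _ := by rw [← Finset.sum_mul, hs'.2, one_mul]

/-- `u` is a potential of `Γ`. -/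
def IsPotential (Γ : Game m) (u : Profile m → ℝ) : Prop :=
  ∀ (i : Fin N) (y : Profile m) (a b : Fin (m i + 1)),
    Γ i (Function.update y i a) - Γ i (Function.update y i b) =
      u (Function.update y i a) - u (Function.update y i b)

theorem IsPotential.BR_eq {Γ : Game m} {u : Profile m → ℝ} (h : IsPotential Γ u) :
    BR Γ = BR fun _ => u := by
  ext σ τ
  simp only [BR, mem_ofPred_eq, mem_bestResponse_iff]
  refine forall_congr' fun i => and_congr_right fun _ => ?_
  refine forall_congr' fun k => imp_congr_right fun _ => forall_congr' fun l => ?_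
  have := pay_sub_eq (Γ i) u i σ (h i) k l
  constructor <;> intro h' <;> linarith

theorem IsPotential.harsanyiMap_eq {Γ : Game m} {u : Profile m → ℝ} (h : IsPotential Γ u) :
    harsanyiMap Γ = harsanyiMap fun _ => u := by
  ext r σ i k
  have := pay_sub_eq (Γ i) u i σ (h i) k (r i)
  simp only [pay] at this
  simp only [harsanyiMap, this]

theorem IsPotential.isRegularGame_iff {Γ : Game m} {u : Profile m → ℝ} (h : IsPotential Γ u) :
    IsRegularGame Γ ↔ IsRegularGame fun _ : Fin N => u := by
  simp only [IsRegularGame, Nash, IsRegularEquilibrium, h.BR_eq, h.harsanyiMap_eq]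

theorem IsPotential.convergesExponentially_iff {Γ : Game m} {u : Profile m → ℝ}
    (h : IsPotential Γ u) :
    ConvergesExponentially Γ ↔ ConvergesExponentially fun _ : Fin N => u := by
  simp only [ConvergesExponentially, IsFPProcess, NashX, Nash, BRX, h.BR_eq]

end Payoffs

/-! ### Payoff differences as polynomials, and good balls for the canonical best replies. -/

section Canonical

variable {N : ℕ} {m : Fin N → ℕ}

/-- The index set of the coordinates of the mixed strategy space. -/
abbrev Idx (m : Fin N → ℕ) : Type := (i : Fin N) × Fin (m i)

/-- The map `T` on plain coordinate vectors. -/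
def toWeights (x : Idx m → ℝ) : Weights m := fun i =>
  Fin.cons (1 - ∑ k, x ⟨i, k⟩) (fun k => x ⟨i, k⟩)

theorem T_eq (x : Coord m) : T x = toWeights x.ofLp := rfl

theorem toWeights_succ (x : Idx m → ℝ) (i : Fin N) (k : Fin (m i)) :
    toWeights x i k.succ = x ⟨i, k⟩ := by simp [toWeights]

theorem sum_toWeights (x : Idx m → ℝ) (i : Fin N) : ∑ k, toWeights x i k = 1 := by
  rw [Fin.sum_univ_succ]
  simp [toWeights]

theorem toWeights_injective : Function.Injective (toWeights (m := m)) := by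
  intro x y h
  ext ⟨i, k⟩
  have := congrFun (congrFun h i) k.succ
  rwa [toWeights_succ, toWeights_succ] at this

theorem continuous_toWeights : Continuous (toWeights (m := m)) := by
  refine continuous_pi fun i => continuous_pi fun k => ?_
  refine Fin.cases ?_ (fun k => ?_) k
  · simp only [toWeights, Fin.cons_zero]; fun_prop
  · simp only [toWeights, Fin.cons_succ]; fun_prop

theorem mem_X_iff (x : Coord m) : x ∈ X m ↔ toWeights x.ofLp ∈ Delta m := by
  have key : ∀ i, ((∀ k, 0 ≤ x ⟨i, k⟩ ∧ x ⟨i, k⟩ ≤ 1) ∧ ∑ k, x ⟨i, k⟩ ≤ 1) ↔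
      toWeights x.ofLp i ∈ stdSimplex ℝ (Fin (m i + 1)) := by
    intro i
    constructor
    · rintro ⟨h1, h2⟩
      refine ⟨fun k => ?_, sum_toWeights _ i⟩
      refine Fin.cases ?_ (fun k => ?_) k
      · simp only [toWeights, Fin.cons_zero]; linarith
      · rw [toWeights_succ]; exact (h1 k).1
    · intro h
      refine ⟨fun k => ?_, ?_⟩
      · have h1 := h.1 k.succ
        have h2 : toWeights x.ofLp i k.succ ≤ 1 := by
          rw [← h.2]
          exact Finset.single_le_sum (fun l _ => h.1 l) (Finset.mem_univ _)
        rw [toWeights_succ] at h1 h2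
        exact ⟨h1, h2⟩
      · have := h.1 0
        simp only [toWeights, Fin.cons_zero] at this
        linarith
  exact forall_congr' key

open MvPolynomial in
/-- The weights as polynomials in the coordinates. -/
noncomputable def weightPoly (i : Fin N) (k : Fin (m i + 1)) : MvPolynomial (Idx m) ℝ :=
  Fin.cons (α := fun _ => MvPolynomial (Idx m) ℝ) (1 - ∑ k : Fin (m i), MvPolynomial.X ⟨i, k⟩)
    (fun k => MvPolynomial.X ⟨i, k⟩) k

theorem eval_weightPoly (x : Idx m → ℝ) (i : Fin N) (k : Fin (m i + 1)) :
    MvPolynomial.eval x (weightPoly i k) = toWeights x i k := by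
  refine Fin.cases ?_ (fun k => ?_) k <;> simp [weightPoly, toWeights]

/-- The payoffs as polynomials in the coordinates. -/
noncomputable def payPoly (u : Profile m → ℝ) (i : Fin N) (k : Fin (m i + 1)) :
    MvPolynomial (Idx m) ℝ :=
  ∑ y : Profile m, MvPolynomial.C (u y * (Pi.single k 1 : Fin (m i + 1) → ℝ) (y i)) *
    ∏ j ∈ Finset.univ.erase i, weightPoly j (y j)

theorem eval_payPoly (u : Profile m → ℝ) (i : Fin N) (k : Fin (m i + 1)) (x : Idx m → ℝ) :
    MvPolynomial.eval x (payPoly u i k) = pay u i k (toWeights x) := by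
  simp only [payPoly, pay, expectedUtility, prod_update, map_sum, map_mul, map_prod,
    MvPolynomial.eval_C, eval_weightPoly, mul_assoc]

theorem weightPoly_mem_supported (i : Fin N) (k : Fin (m i + 1)) {s : Set (Idx m)}
    (hs : ∀ a : Idx m, a.1 = i → a ∈ s) : weightPoly i k ∈ MvPolynomial.supported ℝ s := by
  refine Fin.cases ?_ (fun k => ?_) k
  · simp only [weightPoly, Fin.cons_zero]
    exact sub_mem (one_mem _) (sum_mem fun k _ => MvPolynomial.X_mem_supported.2 (hs _ rfl))
  · simp only [weightPoly, Fin.cons_succ]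
    exact MvPolynomial.X_mem_supported.2 (hs _ rfl)

theorem payPoly_mem_supported (u : Profile m → ℝ) (i : Fin N) (k : Fin (m i + 1)) :
    payPoly u i k ∈ MvPolynomial.supported ℝ {a : Idx m | a.1 ≠ i} := by
  refine sum_mem fun y _ => mul_mem (Subalgebra.algebraMap_mem _ _) (prod_mem fun j hj => ?_)
  exact weightPoly_mem_supported j _ fun a ha => by
    change a.1 ≠ i
    rw [ha]
    exact Finset.ne_of_mem_erase hj

/-- The difference of the payoffs of two pure strategies. -/
noncomputable def diffPoly (u : Profile m → ℝ) (i : Fin N) (k l : Fin (m i + 1)) :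
    MvPolynomial (Idx m) ℝ := payPoly u i k - payPoly u i l

theorem eval_diffPoly (u : Profile m → ℝ) (i : Fin N) (k l : Fin (m i + 1)) (x : Idx m → ℝ) :
    MvPolynomial.eval x (diffPoly u i k l) =
      pay u i k (toWeights x) - pay u i l (toWeights x) := by
  rw [diffPoly, map_sub, eval_payPoly, eval_payPoly]

/-- This absence of own coordinates is what produces the shear structure: a surface on which a
player switches is parallel to the coordinates of that player. -/
theorem vars_diffPoly (u : Profile m → ℝ) (i : Fin N) (k l : Fin (m i + 1)) :
    ∀ a ∈ (diffPoly u i k l).vars, a.1 ≠ i := by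
  have := sub_mem (payPoly_mem_supported u i k) (payPoly_mem_supported u i l)
  exact fun a ha => MvPolynomial.mem_supported.1 this ha

/-- Two pure strategies with the same payoffs everywhere. -/
def Duplicate (u : Profile m → ℝ) (i : Fin N) (k l : Fin (m i + 1)) : Prop :=
  ∀ y : Profile m, u (Function.update y i k) = u (Function.update y i l)

theorem Duplicate.symm {u : Profile m → ℝ} {i : Fin N} {k l : Fin (m i + 1)}
    (h : Duplicate u i k l) : Duplicate u i l k := fun y => (h y).symm

theorem Duplicate.trans {u : Profile m → ℝ} {i : Fin N} {k l n : Fin (m i + 1)}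
    (h : Duplicate u i k l) (h' : Duplicate u i l n) : Duplicate u i k n :=
  fun y => (h y).trans (h' y)

theorem Duplicate.pay_eq {u : Profile m → ℝ} {i : Fin N} {k l : Fin (m i + 1)}
    (h : Duplicate u i k l) (σ : Weights m) : pay u i k σ = pay u i l σ := by
  rw [pay_eq_pay_update u i k l, pay_eq_pay_update u i l l]
  congr 1
  exact funext h

theorem expectedUtility_single (u : Profile m → ℝ) (y : Profile m) :
    expectedUtility u (fun i => Pi.single (y i) 1) = u y := by
  unfold expectedUtility
  rw [Finset.sum_eq_single y]
  · simp
  · intro z _ hz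
    obtain ⟨j, hj⟩ := Function.ne_iff.1 hz
    rw [Finset.prod_eq_zero (Finset.mem_univ j) (Pi.single_eq_of_ne hj _), mul_zero]
  · simp

/-- The coordinates of a pure strategy profile. -/
def vertex (y : Profile m) : Idx m → ℝ := fun a => if y a.1 = a.2.succ then 1 else 0

theorem toWeights_vertex (y : Profile m) : toWeights (vertex y) = fun i => Pi.single (y i) 1 := by
  ext i k
  have hsucc : ∀ k : Fin (m i), toWeights (vertex y) i k.succ =
      (Pi.single (y i) 1 : Fin (m i + 1) → ℝ) k.succ := fun k => by
    rw [toWeights_succ]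
    simp [vertex, Pi.single_apply, eq_comm]
  refine Fin.cases ?_ hsucc k
  have h1 := sum_toWeights (vertex y) i
  have h2 : ∑ k, (Pi.single (y i) 1 : Fin (m i + 1) → ℝ) k = 1 := by simp
  rw [Fin.sum_univ_succ] at h1 h2
  rw [Finset.sum_congr rfl fun k _ => hsucc k] at h1
  linarith

theorem pay_vertex (u : Profile m → ℝ) (i : Fin N) (k : Fin (m i + 1)) (y : Profile m) :
    pay u i k (fun i => Pi.single (y i) 1) = u (Function.update y i k) := by
  rw [pay, ← expectedUtility_single u]
  congr 1
  ext j l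
  by_cases hj : j = i
  · subst hj; simp
  · simp [hj]

theorem diffPoly_ne_zero {u : Profile m → ℝ} {i : Fin N} {k l : Fin (m i + 1)}
    (h : ¬ Duplicate u i k l) : diffPoly u i k l ≠ 0 := by
  obtain ⟨y, hy⟩ := not_forall.1 h
  intro h0
  have := eval_diffPoly u i k l (vertex y)
  rw [h0, map_zero, toWeights_vertex, pay_vertex, pay_vertex] at this
  exact hy (by linarith)

open Classical in
/-- The product of the nonzero payoff differences. -/
noncomputable def indiffPoly (u : Profile m → ℝ) : MvPolynomial (Idx m) ℝ :=
  ∏ i : Fin N, ∏ k : Fin (m i + 1), ∏ l : Fin (m i + 1),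
    if Duplicate u i k l then 1 else diffPoly u i k l

theorem indiffPoly_ne_zero (u : Profile m → ℝ) : indiffPoly u ≠ 0 := by
  classical
  refine Finset.prod_ne_zero_iff.2 fun i _ => Finset.prod_ne_zero_iff.2 fun k _ =>
    Finset.prod_ne_zero_iff.2 fun l _ => ?_
  split_ifs with h
  · exact one_ne_zero
  · exact diffPoly_ne_zero h

theorem diffPoly_dvd_indiffPoly {u : Profile m → ℝ} {i : Fin N} {k l : Fin (m i + 1)}
    (h : ¬ Duplicate u i k l) : diffPoly u i k l ∣ indiffPoly u := by
  classical
  have h1 := Finset.dvd_prod_of_mem (fun i : Fin N => ∏ k : Fin (m i + 1), ∏ l : Fin (m i + 1),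
    if Duplicate u i k l then 1 else diffPoly u i k l) (Finset.mem_univ i)
  have h2 := Finset.dvd_prod_of_mem (fun k : Fin (m i + 1) => ∏ l : Fin (m i + 1),
    if Duplicate u i k l then 1 else diffPoly u i k l) (Finset.mem_univ k)
  have h3 := Finset.dvd_prod_of_mem (fun l : Fin (m i + 1) =>
    if Duplicate u i k l then 1 else diffPoly u i k l) (Finset.mem_univ l)
  simp only [if_neg h] at h3
  exact h3.trans (h2.trans h1)

/-- `k` is the first strategy among its duplicates. -/
def IsFirst (u : Profile m → ℝ) (i : Fin N) (k : Fin (m i + 1)) : Prop :=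
  ∀ l < k, ¬ Duplicate u i l k

theorem IsFirst.eq_of_duplicate {u : Profile m → ℝ} {i : Fin N} {k l : Fin (m i + 1)}
    (hk : IsFirst u i k) (hl : IsFirst u i l) (h : Duplicate u i k l) : k = l := by
  rcases lt_trichotomy k l with h' | h' | h'
  · exact absurd h (hl k h')
  · exact h'
  · exact absurd h.symm (hk l h')

/-- Best responses that use no strategy which has an earlier duplicate. -/
def canonicalBR (u : Profile m → ℝ) (x : Idx m → ℝ) : Set (Idx m → ℝ) :=
  {z | toWeights z ∈ Delta m ∧ ∀ i k, toWeights z i k ≠ 0 →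
    (∀ l, pay u i l (toWeights x) ≤ pay u i k (toWeights x)) ∧ IsFirst u i k}

theorem norm_le_one_of_mem_Delta {z : Idx m → ℝ} (h : toWeights z ∈ Delta m) : ‖z‖ ≤ 1 := by
  rw [pi_norm_le_iff_of_nonneg zero_le_one]
  rintro ⟨i, k⟩
  have h1 := (h i).1 k.succ
  have h2 : toWeights z i k.succ ≤ 1 := by
    rw [← (h i).2]
    exact Finset.single_le_sum (fun l _ => (h i).1 l) (Finset.mem_univ _)
  rw [toWeights_succ] at h1 h2
  rw [Real.norm_eq_abs, abs_le]
  constructor <;> linarith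

theorem norm_le_one_of_mem_canonicalBR (u : Profile m → ℝ) :
    ∀ x, ∀ z ∈ canonicalBR u x, ‖z‖ ≤ 1 := fun _ _ hz => norm_le_one_of_mem_Delta hz.1

/-- Two distinct strategies used in `v` and `v'` are not duplicates, as both are first in their
class. Optimality at `x` and at `x'` would give their payoff difference opposite weak signs, against
the hypothesis. So both replies put all weight on one and the same strategy. -/
theorem canonicalBR_apply_eq {u : Profile m → ℝ} {x x' v v' : Idx m → ℝ} {i : Fin N}
    (h : ∀ k l, ¬ Duplicate u i k l →
      0 < MvPolynomial.eval x (diffPoly u i k l) * MvPolynomial.eval x' (diffPoly u i k l))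
    (hv : v ∈ canonicalBR u x) (hv' : v' ∈ canonicalBR u x') : toWeights v i = toWeights v' i := by
  have key : ∀ k k', toWeights v i k ≠ 0 → toWeights v' i k' ≠ 0 → k = k' := by
    intro k k' hk hk'
    obtain ⟨h1, h2⟩ := hv.2 i k hk
    obtain ⟨h3, h4⟩ := hv'.2 i k' hk'
    by_contra hne
    have hd : ¬ Duplicate u i k k' := fun hd => hne (h2.eq_of_duplicate h4 hd)
    have := h k k' hd
    rw [eval_diffPoly, eval_diffPoly] at this
    have h5 := mul_nonpos_of_nonneg_of_nonpos (sub_nonneg.2 (h1 k')) (sub_nonpos.2 (h3 k))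
    linarith
  have hex : ∀ w : Idx m → ℝ, ∃ k, toWeights w i k ≠ 0 := fun w => by
    by_contra! hc
    have := sum_toWeights w i
    simp [hc] at this
  obtain ⟨k, hk⟩ := hex v
  obtain ⟨k', hk'⟩ := hex v'
  have hkk := key k k' hk hk'
  subst hkk
  have hsingle : ∀ w : Idx m → ℝ, (∀ l, toWeights w i l ≠ 0 → l = k) →
      toWeights w i = Pi.single k 1 := by
    intro w hw
    have h0 : ∀ l, l ≠ k → toWeights w i l = 0 := fun l hl => by
      by_contra hc; exact hl (hw l hc)
    ext l
    by_cases hl : l = k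
    · subst hl
      have := sum_toWeights w i
      rw [Finset.sum_eq_single l (fun b _ hb => h0 b hb) (by simp)] at this
      rw [this, Pi.single_eq_same]
    · rw [h0 l hl, Pi.single_eq_of_ne hl]
  rw [hsingle v fun l hl => key l k hl hk', hsingle v' fun l hl => (key k l hk hl).symm]

/-- Near `c` every nontrivial payoff difference is `q ^ n * g` with `g` of constant sign, so replies
change only when `q` changes sign. A player whose differences contain the factor `q` has no
coordinate in `q`; conversely a player with a coordinate in `q` has a constant reply. -/
theorem compl_multiZeros_subset_goodPoints (u : Profile m → ℝ) :
    (multiZeros (indiffPoly u))ᶜ ⊆ goodPoints (canonicalBR u) := by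
  classical
  intro c hc
  obtain ⟨q, hq, hfac⟩ := exists_local_factor (indiffPoly_ne_zero u) hc
  have hfac' : ∀ (i : Fin N) (k l : Fin (m i + 1)), ∃ n g, ¬ Duplicate u i k l →
      diffPoly u i k l = q ^ n * g ∧ MvPolynomial.eval c g ≠ 0 := by
    intro i k l
    by_cases h : Duplicate u i k l
    · exact ⟨0, 0, fun h' => absurd h h'⟩
    · obtain ⟨n, g, h1⟩ := hfac _ (diffPoly_dvd_indiffPoly h)
      exact ⟨n, g, fun _ => h1⟩
  choose n g hng using hfac'
  have hev : ∀ᶠ x in 𝓝 c, ∀ (i : Fin N) (k l : Fin (m i + 1)), ¬ Duplicate u i k l →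
      0 < MvPolynomial.eval x (g i k l) * MvPolynomial.eval c (g i k l) := by
    simp only [eventually_all]
    intro i k l hd
    have hne := (hng i k l hd).2
    refine (((continuous_eval (g i k l)).mul continuous_const).tendsto c).eventually
      (lt_mem_nhds ?_)
    exact mul_self_pos.2 hne
  obtain ⟨r, hr, hball⟩ := Metric.eventually_nhds_iff_ball.1 hev
  have hgg : ∀ x ∈ Metric.ball c r, ∀ x' ∈ Metric.ball c r, ∀ (i : Fin N) (k l : Fin (m i + 1)),
      ¬ Duplicate u i k l →
      0 < MvPolynomial.eval x (g i k l) * MvPolynomial.eval x' (g i k l) := by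
    intro x hx x' hx' i k l hd
    have h1 := hball x hx i k l hd
    have h2 := hball x' hx' i k l hd
    have h3 : 0 < MvPolynomial.eval c (g i k l) * MvPolynomial.eval c (g i k l) :=
      mul_self_pos.2 (hng i k l hd).2
    by_contra hcon
    have h4 := mul_pos h1 h2
    have h5 := mul_nonpos_of_nonpos_of_nonneg (not_lt.1 hcon) h3.le
    nlinarith
  have hsame : ∀ x ∈ Metric.ball c r, ∀ x' ∈ Metric.ball c r,
      0 < MvPolynomial.eval x q * MvPolynomial.eval x' q →
      ∀ v ∈ canonicalBR u x, ∀ v' ∈ canonicalBR u x', v = v' := by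
    intro x hx x' hx' hqq v hv v' hv'
    apply toWeights_injective
    funext i
    refine canonicalBR_apply_eq (fun k l hd => ?_) hv hv'
    rw [(hng i k l hd).1, map_mul, map_mul, map_pow, map_pow, mul_mul_mul_comm, ← mul_pow]
    exact mul_pos (pow_pos hqq _) (hgg x hx x' hx' i k l hd)
  -- The coordinates of all players who do not occur in `q`: only these players may switch.
  let S : Set (Idx m) := {a | ∀ b ∈ q.vars, b.1 ≠ a.1}
  have hoff : ∀ x ∈ Metric.ball c r, ∀ x' ∈ Metric.ball c r, ∀ v ∈ canonicalBR u x,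
      ∀ v' ∈ canonicalBR u x', ∀ a ∉ S, v a = v' a := by
    intro x hx x' hx' v hv v' hv' a ha
    obtain ⟨b, hb, hba⟩ : ∃ b ∈ q.vars, b.1 = a.1 := by
      by_contra! hcon; exact ha hcon
    have h1 : toWeights v a.1 = toWeights v' a.1 := by
      refine canonicalBR_apply_eq (fun k l hd => ?_) hv hv'
      -- If `q` divided this difference, its variables would avoid the player `a.1`, but `b` is one
      -- of them.
      have h2 : n a.1 k l = 0 := by
        by_contra hn
        have h3 : q ∣ diffPoly u a.1 k l :=
          (hng a.1 k l hd).1 ▸ (dvd_pow_self q hn).mul_right _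
        exact vars_diffPoly u a.1 k l b (vars_subset_of_dvd (diffPoly_ne_zero hd) h3 hb) hba
      have h3 := (hng a.1 k l hd).1
      rw [h2, pow_zero, one_mul] at h3
      rw [h3]
      exact hgg x hx x' hx' a.1 k l hd
    have := congrFun h1 a.2.succ
    rwa [toWeights_succ, toWeights_succ] at this
  obtain ⟨z₀, hz₀⟩ : ∃ z₀ : Idx m → ℝ, ∀ x ∈ Metric.ball c r, ∀ v ∈ canonicalBR u x,
      ∀ a ∉ S, v a = z₀ a := by
    by_cases h : ∃ x ∈ Metric.ball c r, ∃ v, v ∈ canonicalBR u x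
    · obtain ⟨x', hx', v', hv'⟩ := h
      exact ⟨v', fun x hx v hv => hoff x hx x' hx' v hv v' hv'⟩
    · exact ⟨0, fun x hx v hv => absurd ⟨x, hx, v, hv⟩ h⟩
  -- Picks the common reply on one side of `q = 0`; the default `z₀` serves when no point of the
  -- ball on that side has a reply.
  have hsel : ∀ P : (Idx m → ℝ) → Prop,
      (∀ x ∈ Metric.ball c r, ∀ x' ∈ Metric.ball c r, P x → P x' →
        0 < MvPolynomial.eval x q * MvPolynomial.eval x' q) →
      ∃ z : Idx m → ℝ, (∀ a ∉ S, z a = z₀ a) ∧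
        ∀ x ∈ Metric.ball c r, P x → ∀ v ∈ canonicalBR u x, v = z := by
    intro P hP
    by_cases h : ∃ x ∈ Metric.ball c r, P x ∧ ∃ v, v ∈ canonicalBR u x
    · obtain ⟨x', hx', hPx', v', hv'⟩ := h
      exact ⟨v', hz₀ x' hx' v' hv', fun x hx hPx v hv =>
        hsame x hx x' hx' (hP x hx x' hx' hPx hPx') v hv v' hv'⟩
    · exact ⟨z₀, fun _ _ => rfl, fun x hx hPx v hv => absurd ⟨x, hx, hPx, v, hv⟩ h⟩
  obtain ⟨zp, hzp, hzp'⟩ := hsel (fun x => 0 < MvPolynomial.eval x q)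
    fun x _ x' _ h h' => mul_pos h h'
  obtain ⟨zm, hzm, hzm'⟩ := hsel (fun x => MvPolynomial.eval x q < 0)
    fun x _ x' _ h h' => mul_pos_of_neg_of_neg h h'
  refine ⟨r, hr, S, fun x => MvPolynomial.eval x q, zp, zm, continuous_eval q, volume_zeroSet hq,
    fun x x' hxx => ?_, fun a ha => (hzm a ha).trans (hzp a ha).symm, fun x hx v hv =>
    ⟨fun h => hzp' x hx h v hv, fun h => hzm' x hx h v hv, fun a ha =>
      (hz₀ x hx v hv a ha).trans (hzp a ha).symm⟩⟩
  refine eval_eq_of_notMem_vars fun b hb => hxx b fun hbS => ?_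
  exact hbS b hb rfl

/-- From almost every initial point, the solutions of the canonical inclusion are unique and never
meet a point where two irreducible factors of payoff differences vanish. -/
theorem ae_unique_and_not_hit (u : Profile m → ℝ) :
    ∀ᵐ x₀ : Idx m → ℝ,
      (∀ x, IsSol (canonicalBR u) x → x 0 = x₀ → ∀ t, 0 ≤ t → x t ∉ multiZeros (indiffPoly u)) ∧
      ∀ x y, IsSol (canonicalBR u) x → IsSol (canonicalBR u) y → x 0 = x₀ → y 0 = x₀ →
        ∀ t, 0 ≤ t → x t = y t := by
  have hF := indiffPoly_ne_zero u
  filter_upwards [ae_not_hit (norm_le_one_of_mem_canonicalBR u) (isClosed_multiZeros hF)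
    (compl_multiZeros_subset_goodPoints u) (hasThinCovers_multiZeros hF),
    ae_unique_of_goodPoints (norm_le_one_of_mem_canonicalBR u)] with x₀ h1 h2
  exact ⟨h1, fun x y hx hy hx0 hy0 => h2 x y hx hy hx0 hy0 fun t ht =>
    compl_multiZeros_subset_goodPoints u (h1 x hx hx0 t ht)⟩

end Canonical

/-! ### Absolutely continuous functions with one-sided derivative bounds. -/

section AbsolutelyContinuous

theorem absolutelyContinuousOnInterval_of_dist_le {X Y : Type*} [PseudoMetricSpace X]
    [PseudoMetricSpace Y] {f : ℝ → X} {g : ℝ → Y} {a b : ℝ}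
    (hf : AbsolutelyContinuousOnInterval f a b) (h : ∀ s t, dist (g s) (g t) ≤ dist (f s) (f t)) :
    AbsolutelyContinuousOnInterval g a b := by
  refine squeeze_zero (fun E => Finset.sum_nonneg fun i _ => dist_nonneg)
    (fun E => Finset.sum_le_sum fun i _ => h _ _) hf

theorem mul_sub_le_of_ae_hasDerivAt {g : ℝ → ℝ} {a b c : ℝ} (hab : a ≤ b)
    (hg : AbsolutelyContinuousOnInterval g a b)
    (h : ∀ᵐ t : ℝ, t ∈ Icc a b → ∃ d, c ≤ d ∧ HasDerivAt g d t) : c * (b - a) ≤ g b - g a := by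
  rw [← hg.integral_deriv_eq_sub]
  have h1 : ∫ _ in a..b, c = c * (b - a) := by
    rw [intervalIntegral.integral_const, smul_eq_mul, mul_comm]
  rw [← h1]
  refine intervalIntegral.integral_mono_ae_restrict hab intervalIntegrable_const
    hg.intervalIntegrable_deriv ?_
  rw [EventuallyLE, ae_restrict_iff' measurableSet_Icc]
  filter_upwards [h] with t ht hti
  obtain ⟨d, hd, hd'⟩ := ht hti
  rw [hd'.deriv]
  exact hd

theorem sub_le_mul_of_ae_hasDerivAt {g : ℝ → ℝ} {a b c : ℝ} (hab : a ≤ b)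
    (hg : AbsolutelyContinuousOnInterval g a b)
    (h : ∀ᵐ t : ℝ, t ∈ Icc a b → ∃ d, d ≤ c ∧ HasDerivAt g d t) : g b - g a ≤ c * (b - a) := by
  have := mul_sub_le_of_ae_hasDerivAt (c := -c) hab hg.neg (h.mono fun t ht hti => by
    obtain ⟨d, hd, hd'⟩ := ht hti
    exact ⟨-d, neg_le_neg hd, hd'.neg⟩)
  simp only [Pi.neg_apply] at this
  linarith

theorem absolutelyContinuousOnInterval_const (c a b : ℝ) :
    AbsolutelyContinuousOnInterval (fun _ => c) a b :=
  ContDiffOn.absolutelyContinuousOnInterval contDiffOn_const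

theorem absolutelyContinuousOnInterval_exp (a b : ℝ) :
    AbsolutelyContinuousOnInterval Real.exp a b :=
  ContDiffOn.absolutelyContinuousOnInterval Real.contDiff_exp.contDiffOn

theorem absolutelyContinuousOnInterval_sum {κ : Type*} (s : Finset κ) {f : κ → ℝ → ℝ} {a b : ℝ}
    (h : ∀ k ∈ s, AbsolutelyContinuousOnInterval (f k) a b) :
    AbsolutelyContinuousOnInterval (fun t => ∑ k ∈ s, f k t) a b := by
  classical
  induction s using Finset.induction_on with
  | empty =>
    simp only [Finset.sum_empty]
    exact absolutelyContinuousOnInterval_const 0 a b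
  | insert k s hk ih =>
    simp only [Finset.sum_insert hk]
    exact (h k (Finset.mem_insert_self k s)).add
      (ih fun l hl => h l (Finset.mem_insert_of_mem hl))

end AbsolutelyContinuous

/-! ### From the differential inclusion to the integral form. -/

section Inclusion

variable {N : ℕ} {m : Fin N → ℕ}

/-- The differential form of the inclusion `ẋ ∈ V x - x`, for curves in the strategy space. -/
structure IsProc (V : (Idx m → ℝ) → Set (Idx m → ℝ)) (x : ℝ → Idx m → ℝ) : Prop where
  mem : ∀ t, 0 ≤ t → toWeights (x t) ∈ Delta m
  ac : ∀ b, 0 ≤ b → ∀ a, AbsolutelyContinuousOnInterval (fun t => x t a) 0 b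
  deriv : ∀ᵐ t : ℝ, 0 ≤ t → ∃ z ∈ V (x t), HasDerivAt x (z - x t) t

/-- The product `exp t • x t` has derivative `exp t • z`. Defining `z` coordinatewise as derivative
plus value supplies integrability without a measurable selection. -/
theorem IsProc.isSol {V : (Idx m → ℝ) → Set (Idx m → ℝ)} {x : ℝ → Idx m → ℝ}
    (hx : IsProc V x) : IsSol V x := by
  refine ⟨fun t ht => norm_le_one_of_mem_Delta (hx.mem t ht),
    fun t a => _root_.deriv (fun s => x s a) t + x t a, fun t ht => ?_, ?_, fun t ht => ?_⟩
  · rw [intervalIntegrable_iff_integrableOn_Ioc_of_le ht]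
    refine Integrable.of_eval fun a => ?_
    have h := (hx.ac t ht a).intervalIntegrable_deriv.add
      (hx.ac t ht a).continuousOn.intervalIntegrable
    exact (intervalIntegrable_iff_integrableOn_Ioc_of_le ht).1 h
  · filter_upwards [hx.deriv] with t ht ht0
    obtain ⟨z, hz, hd⟩ := ht ht0
    have : (fun a => _root_.deriv (fun s => x s a) t + x t a) = z := by
      ext a
      rw [((hasDerivAt_pi.1 hd) a).deriv]
      simp
    rwa [this]
  · ext a
    have hac := (absolutelyContinuousOnInterval_exp 0 t).mul (hx.ac t ht a)
    have h1 := hac.integral_deriv_eq_sub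
    have hint : IntervalIntegrable
        (fun t a => _root_.deriv (fun s => x s a) t + x t a) volume 0 t := by
      rw [intervalIntegrable_iff_integrableOn_Ioc_of_le ht]
      refine Integrable.of_eval fun a => ?_
      have h := (hx.ac t ht a).intervalIntegrable_deriv.add
        (hx.ac t ht a).continuousOn.intervalIntegrable
      exact (intervalIntegrable_iff_integrableOn_Ioc_of_le ht).1 h
    rw [Pi.add_apply, intervalIntegral_exp_smul_apply hint]
    have h2 : ∫ r in (0 : ℝ)..t, Real.exp r * (_root_.deriv (fun s => x s a) r + x r a) =
        ∫ r in (0 : ℝ)..t, _root_.deriv (Real.exp * fun s => x s a) r := by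
      refine intervalIntegral.integral_congr_ae ?_
      filter_upwards [hx.deriv] with r hr hr0
      rw [uIoc_of_le ht] at hr0
      obtain ⟨z, hz, hd⟩ := hr hr0.1.le
      have hd' := hasDerivAt_pi.1 hd a
      rw [((Real.hasDerivAt_exp r).mul hd').deriv, hd'.deriv]
      ring
    rw [h2, h1]
    simp

/-- The best responses in plain coordinates. -/
def coordBR (u : Profile m → ℝ) (x : Idx m → ℝ) : Set (Idx m → ℝ) :=
  {z | toWeights z ∈ Delta m ∧ ∀ i k, toWeights z i k ≠ 0 →
    ∀ l, pay u i l (toWeights x) ≤ pay u i k (toWeights x)}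

theorem mem_BRX_iff (u : Profile m → ℝ) (x z : Coord m) :
    z ∈ BRX (fun _ => u) x ↔ z.ofLp ∈ coordBR u x.ofLp := by
  simp only [BRX, BR, mem_ofPred_eq, mem_bestResponse_iff, coordBR, T_eq, mem_X_iff, Delta]
  exact ⟨fun h => ⟨h.1, fun i => (h.2 i).2⟩, fun h => ⟨h.1, fun i => ⟨h.1 i, h.2 i⟩⟩⟩

theorem IsFPProcess.isProc {u : Profile m → ℝ} {x₀ : Coord m} {x : ℝ → Coord m}
    (hx : IsFPProcess (fun _ => u) x₀ x) : IsProc (coordBR u) fun t => (x t).ofLp := by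
  obtain ⟨-, hX, hac, hd⟩ := hx
  refine ⟨fun t ht => (mem_X_iff _).1 (hX t ht), fun b hb a => ?_, ?_⟩
  · refine absolutelyContinuousOnInterval_of_dist_le (hac b hb) fun s t =>
      (dist_le_pi_dist _ _ a).trans ?_
    have := (PiLp.lipschitzWith_ofLp 2 (fun _ : Idx m => ℝ)).dist_le_mul (x s) (x t)
    simpa using this
  · filter_upwards [hd] with t ht ht0
    obtain ⟨z, hz, hd⟩ := ht ht0
    refine ⟨z.ofLp, (mem_BRX_iff u _ _).1 hz, ?_⟩
    exact (PiLp.continuousLinearEquiv 2 ℝ (fun _ : Idx m => ℝ)).hasFDerivAt.comp_hasDerivAt t hd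

end Inclusion

/-! ### Merging duplicate strategies. -/

section Merging

variable {N : ℕ} {m : Fin N → ℕ}

theorem exists_isFirst (u : Profile m → ℝ) (i : Fin N) (k : Fin (m i + 1)) :
    ∃ l, Duplicate u i l k ∧ IsFirst u i l := by
  induction k using WellFoundedLT.induction with
  | ind k ih =>
    by_cases h : IsFirst u i k
    · exact ⟨k, fun _ => rfl, h⟩
    · obtain ⟨l, hl⟩ := not_forall.1 h
      obtain ⟨hlk, hd⟩ := Classical.not_imp.1 hl
      obtain ⟨n, hn, hn'⟩ := ih l hlk
      exact ⟨n, hn.trans (not_not.1 hd), hn'⟩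

/-- The first duplicate of a strategy. -/
noncomputable def firstDup (u : Profile m → ℝ) (i : Fin N) (k : Fin (m i + 1)) : Fin (m i + 1) :=
  (exists_isFirst u i k).choose

theorem duplicate_firstDup (u : Profile m → ℝ) (i : Fin N) (k : Fin (m i + 1)) :
    Duplicate u i (firstDup u i k) k := (exists_isFirst u i k).choose_spec.1

theorem isFirst_firstDup (u : Profile m → ℝ) (i : Fin N) (k : Fin (m i + 1)) :
    IsFirst u i (firstDup u i k) := (exists_isFirst u i k).choose_spec.2

/-- Moves all weight to the first duplicates. -/
noncomputable def merge (u : Profile m → ℝ) (σ : Weights m) : Weights m := fun i l =>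
  ∑ k, σ i k * (Pi.single (firstDup u i k) 1 : Fin (m i + 1) → ℝ) l

theorem sum_merge_mul (u : Profile m → ℝ) (σ : Weights m) (i : Fin N) (f : Fin (m i + 1) → ℝ) :
    ∑ l, merge u σ i l * f l = ∑ k, σ i k * f (firstDup u i k) := by
  simp only [merge, Finset.sum_mul]
  rw [Finset.sum_comm]
  refine Finset.sum_congr rfl fun k _ => ?_
  rw [Finset.sum_eq_single (firstDup u i k)]
  · rw [Pi.single_eq_same]; ring
  · intro l _ hl; rw [Pi.single_eq_of_ne hl]; ring
  · simp

theorem sum_merge (u : Profile m → ℝ) (σ : Weights m) (i : Fin N) :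
    ∑ l, merge u σ i l = ∑ k, σ i k := by
  simpa using sum_merge_mul u σ i fun _ => 1

theorem sum_merge_mul_pay (u : Profile m → ℝ) (σ τ : Weights m) (i : Fin N) :
    ∑ l, merge u σ i l * pay u i l τ = ∑ l, σ i l * pay u i l τ := by
  rw [sum_merge_mul]
  exact Finset.sum_congr rfl fun k _ => by rw [(duplicate_firstDup u i k).pay_eq]

theorem merge_nonneg {u : Profile m → ℝ} {σ : Weights m} {i : Fin N} (h : ∀ k, 0 ≤ σ i k)
    (l : Fin (m i + 1)) : 0 ≤ merge u σ i l := by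
  classical
  refine Finset.sum_nonneg fun k _ => mul_nonneg (h k) ?_
  rw [Pi.single_apply]
  split_ifs <;> norm_num

theorem merge_sub_smul (u : Profile m → ℝ) (σ τ : Weights m) (c : ℝ) :
    merge u (σ - c • τ) = merge u σ - c • merge u τ := by
  ext i l
  simp only [merge, Pi.sub_apply, Pi.smul_apply, smul_eq_mul, Finset.mul_sum,
    ← Finset.sum_sub_distrib]
  exact Finset.sum_congr rfl fun k _ => by ring

/-- Profiles whose strategies have the same payoffs, player by player. -/
def PayEquiv (u : Profile m → ℝ) (σ τ : Weights m) : Prop :=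
  ∀ i ρ, ∑ l, σ i l * pay u i l ρ = ∑ l, τ i l * pay u i l ρ

/-- The players are exchanged one at a time; each exchange is harmless because the hypothesis holds
against every profile `ρ` of the others. -/
theorem PayEquiv.expectedUtility_eq {u : Profile m → ℝ} {σ τ : Weights m} (h : PayEquiv u σ τ) :
    expectedUtility u σ = expectedUtility u τ := by
  classical
  have key : ∀ s : Finset (Fin N), expectedUtility u (s.piecewise τ σ) = expectedUtility u σ := by
    intro s
    induction s using Finset.induction_on with
    | empty => rw [Finset.piecewise_empty]
    | insert i s hi ih =>
      rw [← ih, Finset.piecewise_insert, expectedUtility_update, ← h i]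
      rw [expectedUtility_eq_sum_pay u _ i, Finset.piecewise_eq_of_notMem _ _ _ hi]
  rw [← key Finset.univ, Finset.piecewise_univ]

theorem PayEquiv.pay_eq {u : Profile m → ℝ} {σ τ : Weights m} (h : PayEquiv u σ τ)
    (i : Fin N) (k : Fin (m i + 1)) : pay u i k σ = pay u i k τ := by
  refine PayEquiv.expectedUtility_eq fun j ρ => ?_
  by_cases hj : j = i
  · subst hj; simp
  · rw [Function.update_of_ne hj, Function.update_of_ne hj, h j ρ]

/-- The coordinates of a profile. -/
def toCoord (σ : Weights m) : Idx m → ℝ := fun a => σ a.1 a.2.succ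

theorem toWeights_toCoord {σ : Weights m} (h : ∀ i, ∑ k, σ i k = 1) : toWeights (toCoord σ) = σ := by
  ext i k
  refine Fin.cases ?_ (fun k => ?_) k
  · have := h i
    rw [Fin.sum_univ_succ] at this
    simp only [toWeights, Fin.cons_zero, toCoord]
    linarith
  · rw [toWeights_succ]; rfl

theorem toCoord_toWeights (x : Idx m → ℝ) : toCoord (toWeights x) = x := by
  ext ⟨i, k⟩
  exact toWeights_succ x i k

theorem hasDerivAt_toWeights {x : ℝ → Idx m → ℝ} {z : Idx m → ℝ} {t : ℝ}
    (h : HasDerivAt x (z - x t) t) :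
    HasDerivAt (fun s => toWeights (x s)) (toWeights z - toWeights (x t)) t := by
  have h' := hasDerivAt_pi.1 h
  refine hasDerivAt_pi.2 fun i => hasDerivAt_pi.2 fun k => ?_
  refine Fin.cases ?_ (fun k => ?_) k
  · simp only [toWeights, Fin.cons_zero, Pi.sub_apply]
    have h1 : HasDerivAt (fun s => ∑ k, x s ⟨i, k⟩) (∑ k, (z - x t) ⟨i, k⟩) t :=
      HasDerivAt.fun_sum fun k _ => h' ⟨i, k⟩
    refine (h1.const_sub 1).congr_deriv ?_
    simp only [Pi.sub_apply, Finset.sum_sub_distrib]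
    ring
  · simp only [Pi.sub_apply, toWeights_succ]
    exact h' ⟨i, k⟩

/-- The canonical process which has the same payoffs as a given one. -/
noncomputable def canonicalCurve (u : Profile m → ℝ) (x : ℝ → Idx m → ℝ) (t : ℝ) : Idx m → ℝ :=
  -- The decaying term makes the curve start at `x 0` and has no effect on payoffs, because merging
  -- preserves them.
  toCoord (Real.exp (-t) • (toWeights (x 0) - merge u (toWeights (x 0))) + merge u (toWeights (x t)))

theorem canonicalCurve_zero (u : Profile m → ℝ) (x : ℝ → Idx m → ℝ) :
    canonicalCurve u x 0 = x 0 := by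
  simp [canonicalCurve, toCoord_toWeights]

theorem toWeights_canonicalCurve (u : Profile m → ℝ) (x : ℝ → Idx m → ℝ) (t : ℝ) :
    toWeights (canonicalCurve u x t) =
      Real.exp (-t) • (toWeights (x 0) - merge u (toWeights (x 0))) + merge u (toWeights (x t)) := by
  refine toWeights_toCoord fun i => ?_
  simp only [Pi.add_apply, Pi.smul_apply, Pi.sub_apply, smul_eq_mul, Finset.sum_add_distrib,
    ← Finset.mul_sum, Finset.sum_sub_distrib, sum_merge, sum_toWeights]
  ring

theorem pay_canonicalCurve (u : Profile m → ℝ) (x : ℝ → Idx m → ℝ) (t : ℝ) (i : Fin N)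
    (k : Fin (m i + 1)) :
    pay u i k (toWeights (canonicalCurve u x t)) = pay u i k (toWeights (x t)) := by
  refine PayEquiv.pay_eq (fun j ρ => ?_) i k
  rw [toWeights_canonicalCurve]
  simp only [Pi.add_apply, Pi.smul_apply, Pi.sub_apply, smul_eq_mul, add_mul, sub_mul, mul_assoc,
    Finset.sum_add_distrib, ← Finset.mul_sum, Finset.sum_sub_distrib, sum_merge_mul_pay]
  ring

theorem IsProc.ac_toWeights {V : (Idx m → ℝ) → Set (Idx m → ℝ)} {x : ℝ → Idx m → ℝ}
    (hx : IsProc V x) {b : ℝ} (hb : 0 ≤ b) (i : Fin N) (k : Fin (m i + 1)) :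
    AbsolutelyContinuousOnInterval (fun s => toWeights (x s) i k) 0 b := by
  refine Fin.cases ?_ (fun k => ?_) k
  · simp only [toWeights, Fin.cons_zero]
    exact (absolutelyContinuousOnInterval_const 1 0 b).sub
      (absolutelyContinuousOnInterval_sum _ fun k _ => hx.ac b hb ⟨i, k⟩)
  · simp only [toWeights_succ]
    exact hx.ac b hb _

/-- The function `exp t * σᵢᵏ(t)` has derivative `exp t` times a weight of the target, which is
nonnegative. The bound is what keeps `canonicalCurve` nonnegative. -/
theorem IsProc.exp_mul_le {V : (Idx m → ℝ) → Set (Idx m → ℝ)}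
    (hV : ∀ y, ∀ z ∈ V y, toWeights z ∈ Delta m) {x : ℝ → Idx m → ℝ}
    (hx : IsProc V x) {t : ℝ} (ht : 0 ≤ t) (i : Fin N) (k : Fin (m i + 1)) :
    Real.exp (-t) * toWeights (x 0) i k ≤ toWeights (x t) i k := by
  have h1 := mul_sub_le_of_ae_hasDerivAt (c := 0) ht
    ((absolutelyContinuousOnInterval_exp 0 t).mul (hx.ac_toWeights ht i k)) (by
      filter_upwards [hx.deriv] with s hs hsi
      obtain ⟨z, hz, hd⟩ := hs hsi.1
      have hd' := hasDerivAt_pi.1 (hasDerivAt_pi.1 (hasDerivAt_toWeights hd) i) k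
      refine ⟨_, ?_, (Real.hasDerivAt_exp s).mul hd'⟩
      have : Real.exp s * toWeights (x s) i k +
          Real.exp s * (toWeights z - toWeights (x s)) i k = Real.exp s * toWeights z i k := by
        simp only [Pi.sub_apply]; ring
      rw [this]
      exact mul_nonneg (Real.exp_pos s).le ((hV _ z hz i).1 k))
  simp only [Pi.mul_apply, Real.exp_zero, one_mul, zero_mul] at h1
  rw [Real.exp_neg, inv_mul_le_iff₀ (Real.exp_pos t)]
  linarith

/-- Merging is linear, so the curve is `exp (-t)` times the start plus the merger of `x t - exp (-t)
x 0`, a vector with nonnegative weights. If `x` aims at `z`, the curve aims at the merger of `z`,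
which is again a best reply since all payoffs are unchanged. -/
theorem IsProc.canonicalCurve {u : Profile m → ℝ} {x : ℝ → Idx m → ℝ}
    (hx : IsProc (coordBR u) x) : IsProc (canonicalBR u) (canonicalCurve u x) := by
  have hw := toWeights_canonicalCurve u x
  refine ⟨fun t ht i => ⟨fun k => ?_, sum_toWeights _ i⟩, fun b hb a => ?_, ?_⟩
  · have h1 : toWeights (FP.canonicalCurve u x t) = Real.exp (-t) • toWeights (x 0) +
        merge u (toWeights (x t) - Real.exp (-t) • toWeights (x 0)) := by
      rw [hw, merge_sub_smul, smul_sub]; abel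
    rw [h1]
    refine add_nonneg (mul_nonneg (Real.exp_pos _).le ((hx.mem 0 le_rfl i).1 k))
      (merge_nonneg (fun l => ?_) k)
    have := hx.exp_mul_le (fun _ _ hz => hz.1) ht i l
    simp only [Pi.sub_apply, Pi.smul_apply, smul_eq_mul]
    linarith
  · have h1 : AbsolutelyContinuousOnInterval (fun t : ℝ => Real.exp (-t)) 0 b :=
      ContDiffOn.absolutelyContinuousOnInterval (by fun_prop)
    have h2 : AbsolutelyContinuousOnInterval
        (fun t => merge u (toWeights (x t)) a.1 a.2.succ) 0 b := by
      unfold merge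
      exact absolutelyContinuousOnInterval_sum _ fun k _ =>
        (hx.ac_toWeights hb a.1 k).mul (absolutelyContinuousOnInterval_const _ 0 b)
    exact (h1.mul (absolutelyContinuousOnInterval_const
      ((toWeights (x 0) - merge u (toWeights (x 0))) a.1 a.2.succ) 0 b)).add h2
  · filter_upwards [hx.deriv] with t ht ht0
    obtain ⟨z, hz, hd⟩ := ht ht0
    refine ⟨toCoord (merge u (toWeights z)), ⟨?_, ?_⟩, ?_⟩
    · rw [toWeights_toCoord fun i => by rw [sum_merge, sum_toWeights]]
      exact fun i => ⟨fun l => merge_nonneg (fun k => (hz.1 i).1 k) l, by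
        rw [sum_merge, sum_toWeights]⟩
    · rw [toWeights_toCoord fun i => by rw [sum_merge, sum_toWeights]]
      intro i l hl
      obtain ⟨k, -, hk⟩ := Finset.exists_ne_zero_of_sum_ne_zero hl
      have hk1 := left_ne_zero_of_mul hk
      have hk2 : l = firstDup u i k := by
        by_contra hne
        exact right_ne_zero_of_mul hk (Pi.single_eq_of_ne hne _)
      subst hk2
      refine ⟨fun n => ?_, isFirst_firstDup u i k⟩
      rw [pay_canonicalCurve, pay_canonicalCurve, (duplicate_firstDup u i k).pay_eq]
      exact hz.2 i k hk1 n
    · have hd' := hasDerivAt_toWeights hd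
      refine hasDerivAt_pi.2 fun a => ?_
      have h1 : HasDerivAt (fun s => merge u (toWeights (x s)) a.1 a.2.succ)
          (merge u (toWeights z - toWeights (x t)) a.1 a.2.succ) t := by
        unfold merge
        exact HasDerivAt.fun_sum fun k _ =>
          (hasDerivAt_pi.1 (hasDerivAt_pi.1 hd' a.1) k).mul_const _
      have h2 : HasDerivAt (fun s : ℝ => Real.exp (-s)) (-Real.exp (-t)) t := by
        simpa using (hasDerivAt_neg t).exp
      have h3 := (h2.mul_const ((toWeights (x 0) - merge u (toWeights (x 0))) a.1 a.2.succ)).add h1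
      refine h3.congr_deriv ?_
      have h4 := merge_sub_smul u (toWeights z) (toWeights (x t)) 1
      rw [one_smul, one_smul] at h4
      rw [h4]
      simp only [Pi.sub_apply, toCoord, FP.canonicalCurve, Pi.add_apply, Pi.smul_apply, smul_eq_mul]
      ring

end Merging

/-! ### Derivatives of payoffs, and regularity in terms of strictness and nondegeneracy. -/

section Derivatives

variable {N : ℕ} {m : Fin N → ℕ}

/-- The expected utility as a continuous multilinear map. -/
noncomputable def utilityMultilinear (u : Profile m → ℝ) :
    ContinuousMultilinearMap ℝ (fun i : Fin N => Fin (m i + 1) → ℝ) ℝ where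
  toMultilinearMap := MultilinearMap.mk' (expectedUtility u)
    (fun σ i s s' => by simp only [expectedUtility_update, Pi.add_apply, add_mul,
      Finset.sum_add_distrib])
    (fun σ i c s => by simp only [expectedUtility_update, Pi.smul_apply, smul_eq_mul, mul_assoc,
      Finset.mul_sum])
  cont := by
    change Continuous (expectedUtility u)
    unfold expectedUtility
    fun_prop

theorem utilityMultilinear_apply (u : Profile m → ℝ) (σ : Weights m) :
    utilityMultilinear u σ = expectedUtility u σ := rfl

theorem continuous_expectedUtility (u : Profile m → ℝ) : Continuous (expectedUtility u) :=
  (utilityMultilinear u).cont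

theorem continuous_pay (u : Profile m → ℝ) (i : Fin N) (k : Fin (m i + 1)) :
    Continuous (pay u i k) :=
  (continuous_expectedUtility u).comp (continuous_id.update i continuous_const)

theorem hasFDerivAt_expectedUtility (u : Profile m → ℝ) (σ : Weights m) :
    HasFDerivAt (expectedUtility u) ((utilityMultilinear u).linearDeriv σ) σ :=
  (utilityMultilinear u).hasFDerivAt σ

theorem linearDeriv_utilityMultilinear (u : Profile m → ℝ) (σ h : Weights m) :
    (utilityMultilinear u).linearDeriv σ h = ∑ i, ∑ k, h i k * pay u i k σ := by
  simp only [ContinuousMultilinearMap.linearDeriv_apply, utilityMultilinear_apply,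
    expectedUtility_update]

/-- Sets the component of player `i` to zero. -/
noncomputable def dropPlayer (i : Fin N) : Weights m →L[ℝ] Weights m :=
  ContinuousLinearMap.pi fun j => if j = i then 0 else ContinuousLinearMap.proj j

theorem dropPlayer_apply (i j : Fin N) (h : Weights m) :
    dropPlayer i h j = if j = i then 0 else h j := by
  simp only [dropPlayer, ContinuousLinearMap.coe_pi']
  split_ifs <;> rfl

theorem update_eq_dropPlayer_add (i : Fin N) (s : Fin (m i + 1) → ℝ) (σ : Weights m) :
    Function.update σ i s = dropPlayer i σ + Function.update (0 : Weights m) i s := by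
  funext j
  rw [Pi.add_apply, dropPlayer_apply]
  by_cases hj : j = i
  · subst hj; simp
  · simp [hj]

/-- The derivative of a payoff. -/
noncomputable def payDeriv (u : Profile m → ℝ) (i : Fin N) (k : Fin (m i + 1)) (σ : Weights m) :
    Weights m →L[ℝ] ℝ :=
  ((utilityMultilinear u).linearDeriv (Function.update σ i (Pi.single k 1))) ∘L dropPlayer i

theorem hasFDerivAt_pay (u : Profile m → ℝ) (i : Fin N) (k : Fin (m i + 1)) (σ : Weights m) :
    HasFDerivAt (pay u i k) (payDeriv u i k σ) σ := by
  refine (hasFDerivAt_expectedUtility u _).comp σ ?_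
  have : (fun σ : Weights m => Function.update σ i (Pi.single k 1)) =
      fun σ => dropPlayer i σ + Function.update (0 : Weights m) i (Pi.single k 1) :=
    funext fun σ => update_eq_dropPlayer_add i _ σ
  rw [this]
  exact (dropPlayer i).hasFDerivAt.add_const _

theorem payDeriv_apply (u : Profile m → ℝ) (i : Fin N) (k : Fin (m i + 1)) (σ h : Weights m) :
    payDeriv u i k σ h = ∑ j ∈ Finset.univ.erase i,
      ∑ l, h j l * pay u j l (Function.update σ i (Pi.single k 1)) := by
  rw [payDeriv, ContinuousLinearMap.comp_apply, linearDeriv_utilityMultilinear,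
    ← Finset.add_sum_erase _ _ (Finset.mem_univ i)]
  simp only [dropPlayer_apply, if_true, Pi.zero_apply, zero_mul, Finset.sum_const_zero, zero_add]
  exact Finset.sum_congr rfl fun j hj => by rw [if_neg (Finset.ne_of_mem_erase hj)]

theorem continuous_payDeriv_apply (u : Profile m → ℝ) (i : Fin N) (k : Fin (m i + 1)) :
    Continuous fun p : Weights m × Weights m => payDeriv u i k p.1 p.2 := by
  simp only [payDeriv_apply]
  refine continuous_finsetSum _ fun j _ => continuous_finsetSum _ fun l _ => ?_
  have h1 : Continuous fun p : Weights m × Weights m => p.2 j l := by fun_prop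
  exact h1.mul ((continuous_pay u j l).comp (continuous_fst.update i continuous_const))

/-- A coordinate of a profile as a linear form. -/
noncomputable def coordForm (i : Fin N) (k : Fin (m i + 1)) : Weights m →L[ℝ] ℝ :=
  (ContinuousLinearMap.proj k : (Fin (m i + 1) → ℝ) →L[ℝ] ℝ) ∘L
    (ContinuousLinearMap.proj i : Weights m →L[ℝ] Fin (m i + 1) → ℝ)

theorem coordForm_apply (i : Fin N) (k : Fin (m i + 1)) (σ : Weights m) :
    coordForm i k σ = σ i k := rfl

/-- The derivative of Harsanyi's map. -/
noncomputable def harsanyiDeriv (Γ : Game m) (r : Profile m) (σ : Weights m) :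
    Weights m →L[ℝ] Weights m :=
  ContinuousLinearMap.pi fun i => ContinuousLinearMap.pi fun k =>
    if k = r i then ∑ l, coordForm i l
    else σ i k • (payDeriv (Γ i) i k σ - payDeriv (Γ i) i (r i) σ) +
      (pay (Γ i) i k σ - pay (Γ i) i (r i) σ) • coordForm i k

theorem harsanyiDeriv_apply (Γ : Game m) (r : Profile m) (σ h : Weights m) (i : Fin N)
    (k : Fin (m i + 1)) : harsanyiDeriv Γ r σ h i k =
      if k = r i then ∑ l, h i l
      else σ i k * (payDeriv (Γ i) i k σ h - payDeriv (Γ i) i (r i) σ h) +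
        (pay (Γ i) i k σ - pay (Γ i) i (r i) σ) * h i k := by
  change (if k = r i then ∑ l, coordForm i l
    else σ i k • (payDeriv (Γ i) i k σ - payDeriv (Γ i) i (r i) σ) +
      (pay (Γ i) i k σ - pay (Γ i) i (r i) σ) • coordForm i k : Weights m →L[ℝ] ℝ) h = _
  split_ifs
  · simp [_root_.sum_apply, coordForm_apply]
  · simp [coordForm_apply]

theorem hasFDerivAt_harsanyiMap (Γ : Game m) (r : Profile m) (σ : Weights m) :
    HasFDerivAt (harsanyiMap Γ r) (harsanyiDeriv Γ r σ) σ := by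
  refine hasFDerivAt_pi.2 fun i => hasFDerivAt_pi.2 fun k => ?_
  by_cases hk : k = r i
  · simp only [harsanyiMap, if_pos hk]
    exact (HasFDerivAt.fun_sum fun l _ => (coordForm i l).hasFDerivAt).sub_const 1
  · simp only [harsanyiMap, if_neg hk]
    exact (coordForm i k).hasFDerivAt.mul
      ((hasFDerivAt_pay (Γ i) i k σ).sub (hasFDerivAt_pay (Γ i) i (r i) σ))

theorem mem_Nash_iff (u : Profile m → ℝ) (σ : Weights m) :
    σ ∈ Nash (fun _ : Fin N => u) ↔ σ ∈ Delta m ∧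
      ∀ i k, σ i k ≠ 0 → ∀ l, pay u i l σ ≤ pay u i k σ := by
  simp only [Nash, BR, mem_ofPred_eq, mem_bestResponse_iff]
  exact ⟨fun h => ⟨h.1, fun i => (h.2 i).2⟩, fun h => ⟨h.1, fun i => ⟨h.1 i, h.2 i⟩⟩⟩

theorem harsanyiMap_eq_zero {u : Profile m → ℝ} {σ : Weights m}
    (h : σ ∈ Nash (fun _ : Fin N => u)) {r : Profile m} (hr : ∀ i, σ i (r i) ≠ 0) :
    harsanyiMap (fun _ => u) r σ = 0 := by
  rw [mem_Nash_iff] at h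
  funext i
  funext k
  simp only [harsanyiMap, Pi.zero_apply]
  split_ifs with hk
  · rw [(h.1 i).2, sub_self]
  · by_cases hσ : σ i k = 0
    · rw [hσ, zero_mul]
    · have h1 := h.2 i k hσ (r i)
      have h2 := h.2 i (r i) (hr i) k
      simp only [pay] at h1 h2
      rw [le_antisymm h2 h1, sub_self, mul_zero]

/-- Second-order nondegeneracy of an equilibrium on its support. -/
def IsNondegenerate (u : Profile m → ℝ) (r : Profile m) (σ : Weights m) : Prop :=
  ∀ h : Weights m, (∀ i k, σ i k = 0 → h i k = 0) → (∀ i, ∑ k, h i k = 0) →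
    (∀ i k, σ i k ≠ 0 → payDeriv u i k σ h = payDeriv u i (r i) σ h) → h = 0

theorem det_ne_zero_iff_injective {E : Type*} [NormedAddCommGroup E] [NormedSpace ℝ E]
    [FiniteDimensional ℝ E] (f : E →L[ℝ] E) : f.det ≠ 0 ↔ Function.Injective f := by
  constructor
  · intro h
    exact (LinearMap.equivOfDetNeZero (f : E →ₗ[ℝ] E) h).injective
  · intro h h0
    exact (LinearMap.bot_lt_ker_of_det_eq_zero h0).ne' (LinearMap.ker_eq_bot.2 h)

/-- At an equilibrium the Jacobian decouples. In the row of an unused strategy only the diagonal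
entry survives, namely its payoff gap. In the row of a used one the gap is zero and what remains is
a positive multiple of the derivative of the gap, apart from the rows which fix the sums. -/
theorem det_harsanyi_ne_zero_iff {u : Profile m → ℝ} {σ : Weights m}
    (h : σ ∈ Nash (fun _ : Fin N => u)) {r : Profile m} (hr : ∀ i, 0 < σ i (r i)) :
    (fderiv ℝ (harsanyiMap (fun _ => u) r) σ).det ≠ 0 ↔
      (∀ i k, σ i k = 0 → pay u i k σ < pay u i (r i) σ) ∧ IsNondegenerate u r σ := by
  rw [(hasFDerivAt_harsanyiMap (fun _ => u) r σ).fderiv]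
  have hN := (mem_Nash_iff u σ).1 h
  have heq : ∀ i k, σ i k ≠ 0 → pay u i k σ - pay u i (r i) σ = 0 := fun i k hk =>
    sub_eq_zero.2 (le_antisymm (hN.2 i (r i) (hr i).ne' k) (hN.2 i k hk (r i)))
  constructor
  · intro hdet
    have hinj := (det_ne_zero_iff_injective _).1 hdet
    have hsurj : Function.Surjective (harsanyiDeriv (fun _ => u) r σ) :=
      LinearMap.injective_iff_surjective.1 hinj
    refine ⟨fun i k hk => ?_, fun v hv1 hv2 hv3 => ?_⟩
    · refine lt_of_le_of_ne (hN.2 i (r i) (hr i).ne' k) fun hpay => ?_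
      -- A tie at an unused strategy makes its row vanish, so the value 1 could not be attained
      -- there.
      obtain ⟨v, hv⟩ := hsurj fun _ _ => 1
      have h1 := congrFun (congrFun hv i) k
      have hkr : k ≠ r i := fun hkr => (hr i).ne' (hkr ▸ hk)
      rw [harsanyiDeriv_apply, if_neg hkr, hk, hpay] at h1
      simp at h1
    · apply hinj
      rw [map_zero]
      funext i
      funext k
      rw [harsanyiDeriv_apply]
      split_ifs with hk
      · exact hv2 i
      · by_cases hσ : σ i k = 0
        · rw [hσ, hv1 i k hσ]; simp
        · rw [hv3 i k hσ, heq i k hσ]; simp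
  · rintro ⟨h1, h2⟩
    refine (det_ne_zero_iff_injective _).2 ((injective_iff_map_eq_zero _).2 fun v hv => ?_)
    have hv' : ∀ i k, harsanyiDeriv (fun _ => u) r σ v i k = 0 := fun i k => by rw [hv]; rfl
    refine h2 v (fun i k hk => ?_) (fun i => ?_) (fun i k hk => ?_)
    · have hkr : k ≠ r i := fun hkr => (hr i).ne' (hkr ▸ hk)
      have := hv' i k
      rw [harsanyiDeriv_apply, if_neg hkr, hk, zero_mul, zero_add] at this
      exact (mul_eq_zero.1 this).resolve_left (sub_neg.2 (h1 i k hk)).ne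
    · have := hv' i (r i)
      rwa [harsanyiDeriv_apply, if_pos rfl] at this
    · by_cases hkr : k = r i
      · rw [hkr]
      · have := hv' i k
        rw [harsanyiDeriv_apply, if_neg hkr, heq i k hk, zero_mul, add_zero] at this
        exact sub_eq_zero.1 ((mul_eq_zero.1 this).resolve_left hk)

/-- Using `r` is an open condition, so nearby equilibria are zeros of the same Harsanyi map, and a
map with injective derivative at `σ` does not return to its value there. -/
theorem eventually_eq_of_mem_Nash {u : Profile m → ℝ} {σ : Weights m} {r : Profile m} (hr : ∀ i, 0 < σ i (r i))
    (hdet : (fderiv ℝ (harsanyiMap (fun _ => u) r) σ).det ≠ 0) :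
    ∀ᶠ τ in 𝓝 σ, τ ∈ Nash (fun _ : Fin N => u) → τ = σ := by
  have hinj := (det_ne_zero_iff_injective _).1 hdet
  have hd : HasFDerivAt (harsanyiMap (fun _ => u) r) _ σ :=
    (hasFDerivAt_harsanyiMap (fun _ => u) r σ).differentiableAt.hasFDerivAt
  obtain ⟨C, -, hC⟩ := (fderiv ℝ (harsanyiMap (fun _ => u) r) σ).toLinearMap.exists_antilipschitzWith
    (LinearMap.ker_eq_bot.2 hinj)
  have h1 := hd.eventually_ne (c := 0) ⟨C, hC⟩
  rw [eventually_nhdsWithin_iff] at h1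
  have h2 : ∀ᶠ τ in 𝓝 σ, ∀ i, 0 < τ i (r i) := by
    rw [eventually_all]
    intro i
    exact ((continuous_apply (r i)).comp (continuous_apply i)).tendsto σ |>.eventually
      (lt_mem_nhds (hr i))
  filter_upwards [h1, h2] with τ h3 h4 hτ
  by_contra hne
  exact h3 hne (harsanyiMap_eq_zero hτ fun i => (h4 i).ne')

end Derivatives

/-! ### Payoff advantages and their symmetric derivative matrix. -/

section LocalGrowth

open scoped Classical

variable {N : ℕ} {m : Fin N → ℕ}

/-- Two-player form of the payoffs: changing the strategy of `j ≠ i`. -/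
theorem pay_update_of_ne (u : Profile m → ℝ) {i j : Fin N} (hij : j ≠ i) (k : Fin (m i + 1))
    (σ : Weights m) (v : Fin (m j + 1) → ℝ) :
    pay u i k (Function.update σ j v) =
      ∑ l, v l * pay u j l (Function.update σ i (Pi.single k 1)) := by
  rw [pay, Function.update_comm hij, expectedUtility_update]

theorem payDeriv_single (u : Profile m → ℝ) {i j : Fin N} (hij : j ≠ i) (k : Fin (m i + 1))
    (σ : Weights m) (v : Fin (m j + 1) → ℝ) :
    payDeriv u i k σ (Pi.single j v) =
      ∑ l, v l * pay u j l (Function.update σ i (Pi.single k 1)) := by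
  rw [payDeriv_apply, Finset.sum_eq_single_of_mem j (Finset.mem_erase.2 ⟨hij, Finset.mem_univ _⟩)]
  · simp
  · intro j' _ hj'
    simp [hj']

theorem payDeriv_single_self (u : Profile m → ℝ) (i : Fin N) (k : Fin (m i + 1))
    (σ : Weights m) (v : Fin (m i + 1) → ℝ) :
    payDeriv u i k σ (Pi.single i v) = 0 := by
  rw [payDeriv_apply]
  refine Finset.sum_eq_zero fun j hj => ?_
  simp [Finset.ne_of_mem_erase hj]

/-- The payoff advantage of `k` over `r i`. -/
noncomputable def adv (u : Profile m → ℝ) (r : Profile m) (i : Fin N) (k : Fin (m i + 1))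
    (σ : Weights m) : ℝ := pay u i k σ - pay u i (r i) σ

/-- The derivative of the payoff advantage. -/
noncomputable def advDeriv (u : Profile m → ℝ) (r : Profile m) (i : Fin N) (k : Fin (m i + 1))
    (σ : Weights m) : Weights m →L[ℝ] ℝ := payDeriv u i k σ - payDeriv u i (r i) σ

theorem hasFDerivAt_adv (u : Profile m → ℝ) (r : Profile m) (i : Fin N) (k : Fin (m i + 1))
    (σ : Weights m) : HasFDerivAt (adv u r i k) (advDeriv u r i k σ) σ :=
  (hasFDerivAt_pay u i k σ).sub (hasFDerivAt_pay u i (r i) σ)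

theorem continuous_adv (u : Profile m → ℝ) (r : Profile m) (i : Fin N) (k : Fin (m i + 1)) :
    Continuous (adv u r i k) := (continuous_pay u i k).sub (continuous_pay u i (r i))

theorem continuous_advDeriv_apply (u : Profile m → ℝ) (r : Profile m) (i : Fin N)
    (k : Fin (m i + 1)) : Continuous fun p : Weights m × Weights m => advDeriv u r i k p.1 p.2 :=
  (continuous_payDeriv_apply u i k).sub (continuous_payDeriv_apply u i (r i))

/-- The direction which moves weight from `r i` to `k`. -/
noncomputable def dir (r : Profile m) (i : Fin N) (k : Fin (m i + 1)) : Weights m :=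
  Pi.single i (Pi.single k 1 - Pi.single (r i) 1)

theorem advDeriv_dir_self (u : Profile m → ℝ) (r : Profile m) (i : Fin N) (k l : Fin (m i + 1))
    (σ : Weights m) : advDeriv u r i k σ (dir r i l) = 0 := by
  simp [advDeriv, dir, payDeriv_single_self]

theorem advDeriv_dir (u : Profile m → ℝ) (r : Profile m) {i j : Fin N} (hij : j ≠ i)
    (k : Fin (m i + 1)) (l : Fin (m j + 1)) (σ : Weights m) :
    advDeriv u r i k σ (dir r j l) =
      adv u r i k (Function.update σ j (Pi.single l 1)) -
      adv u r i k (Function.update σ j (Pi.single (r j) 1)) := by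
  simp only [advDeriv, dir, sub_apply, payDeriv_single u hij, adv,
    pay_update_of_ne u hij, Pi.sub_apply, sub_mul, Finset.sum_sub_distrib]
  ring

/-- Both sides are the same mixed second difference of the one utility `u`. This symmetry needs a
common utility, and the quadratic form of the convergence argument rests on it. -/
theorem advDeriv_dir_comm (u : Profile m → ℝ) (r : Profile m) (i j : Fin N)
    (k : Fin (m i + 1)) (l : Fin (m j + 1)) (σ : Weights m) :
    advDeriv u r i k σ (dir r j l) = advDeriv u r j l σ (dir r i k) := by
  by_cases hij : j = i
  · subst hij
    rw [advDeriv_dir_self, advDeriv_dir_self]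
  · rw [advDeriv_dir u r hij, advDeriv_dir u r (Ne.symm hij)]
    simp only [adv, pay, Function.update_comm hij]
    ring

theorem adv_update_add (u : Profile m → ℝ) (r : Profile m) {i j : Fin N} (hij : j ≠ i)
    (k : Fin (m i + 1)) (l : Fin (m j + 1)) (σ : Weights m) :
    adv u r i k (σ + dir r j l) = adv u r i k σ + advDeriv u r i k σ (dir r j l) := by
  have h1 : σ + dir r j l =
      Function.update σ j (σ j + (Pi.single l 1 - Pi.single (r j) 1)) := by
    ext j' l'
    by_cases h : j' = j
    · subst h; simp [dir]
    · simp [dir, h]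
  have h2 : adv u r i k σ = adv u r i k (Function.update σ j (σ j)) := by
    rw [Function.update_eq_self]
  rw [h1, h2, advDeriv, dir, sub_apply, payDeriv_single u hij, payDeriv_single u hij, adv, adv]
  simp only [pay_update_of_ne u hij, Pi.add_apply, Pi.sub_apply, add_mul, Finset.sum_add_distrib]
  ring

/-- The strategies in the support of `s`, without the reference strategies. -/
abbrev SuppIdx (s : Weights m) (r : Profile m) : Type :=
  {a : (i : Fin N) × Fin (m i + 1) // s a.1 a.2 ≠ 0 ∧ a.2 ≠ r a.1}

theorem sum_dir (r : Profile m) (i j : Fin N) (k : Fin (m i + 1)) : ∑ l, dir r i k j l = 0 := by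
  by_cases h : j = i
  · subst h; simp [dir, Finset.sum_sub_distrib]
  · simp [dir, h]

theorem dir_apply_of_ne (r : Profile m) (i j : Fin N) (k : Fin (m i + 1)) (l : Fin (m j + 1))
    (h : l ≠ r j) :
    dir r i k j l = if (⟨i, k⟩ : (i : Fin N) × Fin (m i + 1)) = ⟨j, l⟩ then 1 else 0 := by
  by_cases hij : j = i
  · subst hij
    simp [dir, Pi.single_apply, h, eq_comm]
  · rw [if_neg fun hc => hij (congrArg Sigma.fst hc).symm]
    simp [dir, hij]

theorem sum_dir_apply {s : Weights m} {r : Profile m} (w : SuppIdx s r → ℝ) (a : SuppIdx s r) :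
    (∑ b, w b • dir r b.1.1 b.1.2) a.1.1 a.1.2 = w a := by
  rw [Finset.sum_apply, Finset.sum_apply, Finset.sum_eq_single a]
  · rw [Pi.smul_apply, Pi.smul_apply, dir_apply_of_ne _ _ _ _ _ a.2.2, if_pos rfl, smul_eq_mul,
      mul_one]
  · intro b _ hb
    rw [Pi.smul_apply, Pi.smul_apply, dir_apply_of_ne _ _ _ _ _ a.2.2,
      if_neg fun hc => hb (Subtype.ext hc), smul_zero]
  · simp

theorem eq_of_support_of_sum {s : Weights m} {r : Profile m} {g h : Weights m}
    (hg : ∀ i k, s i k = 0 → g i k = 0) (hh : ∀ i k, s i k = 0 → h i k = 0)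
    (hgs : ∀ i, ∑ k, g i k = 0) (hhs : ∀ i, ∑ k, h i k = 0)
    (heq : ∀ a : SuppIdx s r, g a.1.1 a.1.2 = h a.1.1 a.1.2) : g = h := by
  have key : ∀ i k, k ≠ r i → g i k = h i k := by
    intro i k hk
    by_cases hs : s i k = 0
    · rw [hg i k hs, hh i k hs]
    · exact heq ⟨⟨i, k⟩, hs, hk⟩
  ext i k
  by_cases hk : k = r i
  · subst hk
    have h1 := hgs i
    have h2 := hhs i
    rw [← Finset.add_sum_erase _ _ (Finset.mem_univ (r i))] at h1 h2
    rw [Finset.sum_congr rfl fun l hl => key i l (Finset.ne_of_mem_erase hl)] at h1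
    linarith
  · exact key i k hk

theorem sum_dir_support {s : Weights m} {r : Profile m} (hr : ∀ i, s i (r i) ≠ 0)
    (w : SuppIdx s r → ℝ) (i : Fin N) (k : Fin (m i + 1)) (h : s i k = 0) :
    (∑ b, w b • dir r b.1.1 b.1.2) i k = 0 := by
  rw [Finset.sum_apply, Finset.sum_apply]
  refine Finset.sum_eq_zero fun b _ => ?_
  have hk : k ≠ r i := fun hk => hr i (hk ▸ h)
  rw [Pi.smul_apply, Pi.smul_apply, dir_apply_of_ne _ _ _ _ _ hk, if_neg, smul_zero]
  intro hb
  obtain ⟨⟨j, l⟩, h1, h2⟩ := b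
  cases hb
  exact h1 h

theorem sum_sum_dir {s : Weights m} {r : Profile m} (w : SuppIdx s r → ℝ) (i : Fin N) :
    ∑ k, (∑ b, w b • dir r b.1.1 b.1.2) i k = 0 := by
  simp only [Finset.sum_apply, Pi.smul_apply, smul_eq_mul]
  rw [Finset.sum_comm]
  refine Finset.sum_eq_zero fun b _ => ?_
  rw [← Finset.mul_sum, sum_dir, mul_zero]

/-- The derivatives of the advantages in the directions `dir` form a symmetric square matrix,
invertible by nondegeneracy. Its inverse recovers a tangent vector of the support from the changes
of the advantages that it causes. -/
theorem exists_symm_inverse {u : Profile m → ℝ} {r : Profile m} {s : Weights m}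
    (hr : ∀ i, s i (r i) ≠ 0) (hs : IsNondegenerate u r s) :
    ∃ B : Matrix (SuppIdx s r) (SuppIdx s r) ℝ, B.IsSymm ∧
      ∀ h : Weights m, (∀ i k, s i k = 0 → h i k = 0) → (∀ i, ∑ k, h i k = 0) →
        ∀ a : SuppIdx s r, ∑ b, B a b * advDeriv u r b.1.1 b.1.2 s h = h a.1.1 a.1.2 := by
  let A : Matrix (SuppIdx s r) (SuppIdx s r) ℝ :=
    fun a b => advDeriv u r a.1.1 a.1.2 s (dir r b.1.1 b.1.2)
  have hA : A.IsSymm := by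
    ext a b
    exact advDeriv_dir_comm u r _ _ _ _ s
  have hAw : ∀ w a, (A.mulVec w) a =
      advDeriv u r a.1.1 a.1.2 s (∑ b, w b • dir r b.1.1 b.1.2) := by
    intro w a
    rw [map_sum]
    refine Finset.sum_congr rfl fun b _ => ?_
    rw [map_smul, smul_eq_mul, mul_comm]
  have hinj : Function.Injective A.mulVec := by
    refine (injective_iff_map_eq_zero A.mulVecLin).2 fun w hw => ?_
    have h0 := hs (∑ b, w b • dir r b.1.1 b.1.2) (sum_dir_support hr w) (sum_sum_dir w)
      (fun i k hk => by
        by_cases hkr : k = r i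
        · rw [hkr]
        · have := hAw w ⟨⟨i, k⟩, hk, hkr⟩
          rw [show A.mulVec w = 0 from hw] at this
          exact sub_eq_zero.1 this.symm)
    ext a
    rw [← sum_dir_apply w a, h0]; rfl
  have hunit : IsUnit A := Matrix.mulVec_injective_iff_isUnit.1 hinj
  have hdet : IsUnit A.det := (Matrix.isUnit_iff_isUnit_det A).1 hunit
  refine ⟨A⁻¹, ?_, fun h h1 h2 a => ?_⟩
  · rw [Matrix.IsSymm, Matrix.transpose_nonsing_inv, hA.eq]
  · have h3 : h = ∑ b : SuppIdx s r, h b.1.1 b.1.2 • dir r b.1.1 b.1.2 :=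
      eq_of_support_of_sum h1 (sum_dir_support hr _) h2 (sum_sum_dir _)
        fun a => (sum_dir_apply (fun b : SuppIdx s r => h b.1.1 b.1.2) a).symm
    have h4 : A⁻¹.mulVec (A.mulVec fun b => h b.1.1 b.1.2) = fun b => h b.1.1 b.1.2 := by
      rw [Matrix.mulVec_mulVec, Matrix.nonsing_inv_mul _ hdet, Matrix.one_mulVec]
    have h5 := congrFun h4 a
    rw [← h5]
    refine Finset.sum_congr rfl fun b _ => ?_
    rw [hAw, ← h3]

end LocalGrowth

/-! ### Growth of the quadratic form near a regular equilibrium. -/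

section LocalGrowth

open scoped Classical

variable {N : ℕ} {m : Fin N → ℕ}

/-- The profile `ζ` is a best response to `σ`. -/
def IsReply (u : Profile m → ℝ) (σ ζ : Weights m) : Prop :=
  ζ ∈ Delta m ∧ ∀ i k, ζ i k ≠ 0 → ∀ l, pay u i l σ ≤ pay u i k σ

theorem sum_suppIdx {s : Weights m} {r : Profile m} (f : (i : Fin N) → Fin (m i + 1) → ℝ)
    (h0 : ∀ i k, s i k = 0 → f i k = 0) (hr : ∀ i, f i (r i) = 0) :
    ∑ a : SuppIdx s r, f a.1.1 a.1.2 = ∑ i, ∑ k, f i k := by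
  rw [← Fintype.sum_sigma' (f := f), ← Finset.sum_filter_of_ne
    (p := fun a : (i : Fin N) × Fin (m i + 1) => s a.1 a.2 ≠ 0 ∧ a.2 ≠ r a.1)]
  · exact (Finset.sum_subtype _ (by simp) fun a : (i : Fin N) × Fin (m i + 1) => f a.1 a.2).symm
  · rintro ⟨i, k⟩ - hne
    exact ⟨fun h => hne (h0 i k h), fun h => hne (by change k = r i at h; subst h; exact hr i)⟩

theorem exists_mem_support {ζ : Weights m} (h : ζ ∈ Delta m) (i : Fin N) : ∃ k, ζ i k ≠ 0 := by
  by_contra! hc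
  have := (h i).2
  simp [hc] at this

theorem IsReply.player_gain {u : Profile m → ℝ} {σ ζ : Weights m} (h : IsReply u σ ζ)
    {s : Weights m} (hs : s ∈ Delta m) (r : Profile m) (i : Fin N) :
    ∃ M, (∀ k, adv u r i k σ ≤ M) ∧
      ∑ k, adv u r i k σ * (ζ i k - s i k) = ∑ k, s i k * (M - adv u r i k σ) := by
  obtain ⟨k₀, hk₀⟩ := exists_mem_support h.1 i
  have hmax : ∀ k, adv u r i k σ ≤ adv u r i k₀ σ := fun k =>
    sub_le_sub_right (h.2 i k₀ hk₀ k) _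
  refine ⟨adv u r i k₀ σ, hmax, ?_⟩
  have h1 : ∑ k, adv u r i k σ * ζ i k = adv u r i k₀ σ := by
    have h2 : ∀ k, adv u r i k σ * ζ i k = adv u r i k₀ σ * ζ i k := fun k => by
      by_cases hk : ζ i k = 0
      · rw [hk, mul_zero, mul_zero]
      · rw [le_antisymm (hmax k) (sub_le_sub_right (h.2 i k hk k₀) _)]
    rw [Finset.sum_congr rfl fun k _ => h2 k, ← Finset.mul_sum, (h.1 i).2, mul_one]
  simp only [mul_sub, Finset.sum_sub_distrib, h1, ← Finset.sum_mul, (hs i).2, one_mul]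
  congr 1
  exact Finset.sum_congr rfl fun k _ => mul_comm _ _

/-- The gain over `s` is the average shortfall of the strategies of `s` from the best advantage. If
the advantage of `k` is positive, the reference strategy, whose advantage is 0, falls short by at
least that much; if it is negative, `k` itself does. Both have weight at least `δ`. -/
theorem IsReply.gain {u : Profile m → ℝ} {σ ζ : Weights m} (h : IsReply u σ ζ)
    {s : Weights m} (hs : s ∈ Delta m) {r : Profile m} (hr : ∀ i, s i (r i) ≠ 0)
    (hsupp : ∀ i k, s i k = 0 → ζ i k = 0) {δ : ℝ}
    (hδ : ∀ i k, s i k ≠ 0 → δ ≤ s i k) (a : SuppIdx s r) :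
    δ * |adv u r a.1.1 a.1.2 σ| ≤
      ∑ b : SuppIdx s r, adv u r b.1.1 b.1.2 σ * (ζ b.1.1 b.1.2 - s b.1.1 b.1.2) := by
  rw [sum_suppIdx (s := s) (r := r) (fun i k => adv u r i k σ * (ζ i k - s i k))
    (fun i k hk => by rw [hk, hsupp i k hk]; ring) (fun i => by simp [adv])]
  choose M hM hsum using fun i => h.player_gain hs r i
  have hterm : ∀ i k, 0 ≤ s i k * (M i - adv u r i k σ) := fun i k =>
    mul_nonneg ((hs i).1 k) (sub_nonneg.2 (hM i k))
  obtain ⟨⟨i, k⟩, hk, hkr⟩ := a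
  have h1 : ∑ l, s i l * (M i - adv u r i l σ) ≤ ∑ i, ∑ l, s i l * (M i - adv u r i l σ) :=
    Finset.single_le_sum (f := fun i => ∑ l, s i l * (M i - adv u r i l σ))
      (fun i _ => Finset.sum_nonneg fun l _ => hterm i l) (Finset.mem_univ i)
  have h2 : ∀ l, s i l * (M i - adv u r i l σ) ≤ ∑ l, s i l * (M i - adv u r i l σ) := fun l =>
    Finset.single_le_sum (f := fun l => s i l * (M i - adv u r i l σ))
      (fun l _ => hterm i l) (Finset.mem_univ l)
  simp only [hsum]
  refine le_trans ?_ h1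
  have hr0 : adv u r i (r i) σ = 0 := by simp [adv]
  have hM0 : 0 ≤ M i := hr0 ▸ hM i (r i)
  rcases le_total 0 (adv u r i k σ) with hp | hp
  · refine le_trans ?_ (h2 (r i))
    rw [hr0, sub_zero, abs_of_nonneg hp]
    exact mul_le_mul (hδ i _ (hr i)) (hM i k) hp ((hs i).1 _)
  · refine le_trans ?_ (h2 k)
    rw [abs_of_nonpos hp]
    exact mul_le_mul (hδ i k hk) (by linarith) (by linarith) ((hs i).1 _)

theorem eventually_reply_support {u : Profile m → ℝ} {r : Profile m} {s : Weights m}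
    (hstrict : ∀ i k, s i k = 0 → pay u i k s < pay u i (r i) s) :
    ∀ᶠ σ in 𝓝 s, ∀ ζ, IsReply u σ ζ → ∀ i k, s i k = 0 → ζ i k = 0 := by
  have h1 : ∀ᶠ σ in 𝓝 s, ∀ i k, s i k = 0 → pay u i k σ < pay u i (r i) σ := by
    simp only [eventually_all]
    intro i k hk
    exact (continuous_pay u i k).continuousAt.eventually_lt
      (continuous_pay u i (r i)).continuousAt (hstrict i k hk)
  filter_upwards [h1] with σ hσ ζ hζ i k hk
  by_contra hne
  exact absurd (hζ.2 i k hne (r i)) (not_le.2 (hσ i k hk))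

theorem isCompact_Delta : IsCompact (Delta m) := by
  have : Delta m = Set.univ.pi fun i => stdSimplex ℝ (Fin (m i + 1)) := by
    ext σ; simp [Delta]
  rw [this]
  exact isCompact_univ_pi fun i => isCompact_stdSimplex ℝ _

/-- The vector of payoff advantages on the support. -/
noncomputable def advVec (u : Profile m → ℝ) (s : Weights m) (r : Profile m) (σ : Weights m) :
    SuppIdx s r → ℝ := fun a => adv u r a.1.1 a.1.2 σ

theorem exists_pos_le_support {s : Weights m} (hs : s ∈ Delta m) :
    ∃ δ, 0 < δ ∧ ∀ i k, s i k ≠ 0 → δ ≤ s i k := by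
  obtain ⟨δ, hδ, h⟩ : ∃ δ, 0 < δ ∧ ∀ a : (i : Fin N) × Fin (m i + 1), s a.1 a.2 ≠ 0 →
      δ ≤ s a.1 a.2 := by
    have : ∀ t : Finset ((i : Fin N) × Fin (m i + 1)), ∃ δ : ℝ, 0 < δ ∧ ∀ a ∈ t, s a.1 a.2 ≠ 0 →
        δ ≤ s a.1 a.2 := by
      intro t
      induction t using Finset.induction_on with
      | empty => exact ⟨1, one_pos, by simp⟩
      | insert a t ha ih =>
        obtain ⟨δ, hδ, h⟩ := ih
        by_cases h0 : s a.1 a.2 = 0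
        · refine ⟨δ, hδ, fun b hb hb0 => ?_⟩
          rcases Finset.mem_insert.1 hb with rfl | hb
          · exact absurd h0 hb0
          · exact h b hb hb0
        · refine ⟨min δ (s a.1 a.2), lt_min hδ (lt_of_le_of_ne ((hs a.1).1 a.2) (Ne.symm h0)),
            fun b hb hb0 => ?_⟩
          rcases Finset.mem_insert.1 hb with rfl | hb
          · exact min_le_right _ _
          · exact (min_le_left _ _).trans (h b hb hb0)
    obtain ⟨δ, hδ, h⟩ := this Finset.univ
    exact ⟨δ, hδ, fun a => h a (Finset.mem_univ a)⟩
  exact ⟨δ, hδ, fun i k => h ⟨i, k⟩⟩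

/-- If the derivative of the advantages were taken at `s` and along `ζ - s`, then `B` would return
`ζ - s` on the support and `IsReply.gain` would give the bound `δ‖P‖`. The replacement is legitimate
because replies near `s` use only the support of `s`, and it costs an error that is small uniformly
in `ζ`, by compactness. -/
theorem eventually_growth {u : Profile m → ℝ} {r : Profile m} {s : Weights m} (hs : s ∈ Delta m)
    (hr : ∀ i, s i (r i) ≠ 0) (hstrict : ∀ i k, s i k = 0 → pay u i k s < pay u i (r i) s)
    {B : Matrix (SuppIdx s r) (SuppIdx s r) ℝ}
    (hB : ∀ h : Weights m, (∀ i k, s i k = 0 → h i k = 0) → (∀ i, ∑ k, h i k = 0) →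
        ∀ a : SuppIdx s r, ∑ b, B a b * advDeriv u r b.1.1 b.1.2 s h = h a.1.1 a.1.2) :
    ∃ c, 0 < c ∧ ∀ᶠ σ in 𝓝 s, ∀ ζ, IsReply u σ ζ → c * ‖advVec u s r σ‖ ≤
      ∑ a, advVec u s r σ a * ∑ b, B a b * advDeriv u r b.1.1 b.1.2 σ (ζ - σ) := by
  obtain ⟨δ, hδ, hδs⟩ := exists_pos_le_support hs
  obtain ⟨n, hn⟩ : ∃ n : ℝ, n = Fintype.card (SuppIdx s r) := ⟨_, rfl⟩
  have hn0 : 0 ≤ n := hn ▸ Nat.cast_nonneg _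
  -- An error of at most `ε` in each of the `n` components uses up at most half of `δ`.
  obtain ⟨ε, hε, hεn⟩ : ∃ ε, 0 < ε ∧ n * ε ≤ δ / 2 := by
    refine ⟨δ / 2 / (n + 1), by positivity, ?_⟩
    rw [mul_div_assoc', div_le_iff₀ (by positivity)]
    nlinarith
  let err : SuppIdx s r → Weights m × Weights m → ℝ := fun a p =>
    ∑ b, B a b * (advDeriv u r b.1.1 b.1.2 p.1 (p.2 - p.1) - advDeriv u r b.1.1 b.1.2 s (p.2 - s))
  have herr : ∀ a, Continuous (err a) := fun a => by
    refine continuous_finsetSum _ fun b _ => continuous_const.mul (Continuous.sub ?_ ?_)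
    · exact (continuous_advDeriv_apply u r b.1.1 b.1.2).comp
        (continuous_fst.prodMk (continuous_snd.sub continuous_fst))
    · exact (advDeriv u r b.1.1 b.1.2 s).continuous.comp (continuous_snd.sub continuous_const)
  have hsmall : ∀ᶠ σ in 𝓝 s, ∀ ζ ∈ Delta m, ∀ a, |err a (σ, ζ)| < ε := by
    refine isCompact_Delta.eventually_forall_of_forall_eventually fun ζ _ => ?_
    rw [eventually_all]
    intro a
    refine (herr a).abs.continuousAt.eventually_lt continuousAt_const ?_
    simpa [err] using hε
  refine ⟨δ / 2, by positivity, ?_⟩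
  filter_upwards [hsmall, eventually_reply_support hstrict] with σ h1 h2 ζ hζ
  obtain ⟨P, hP⟩ : ∃ P, P = advVec u s r σ := ⟨_, rfl⟩
  have hB' : ∀ a, ∑ b, B a b * advDeriv u r b.1.1 b.1.2 σ (ζ - σ) =
      (ζ a.1.1 a.1.2 - s a.1.1 a.1.2) + err a (σ, ζ) := by
    intro a
    have h3 := hB (ζ - s) (fun i k hk => by simp [hk, h2 ζ hζ i k hk])
      (fun i => by simp [Finset.sum_sub_distrib, (hζ.1 i).2, (hs i).2]) a
    simp only [err, mul_sub, Finset.sum_sub_distrib] at h3 ⊢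
    rw [h3]
    simp
  simp only [hB', mul_add, Finset.sum_add_distrib]
  have h4 : δ * ‖P‖ ≤ ∑ b : SuppIdx s r, advVec u s r σ b * (ζ b.1.1 b.1.2 - s b.1.1 b.1.2) := by
    by_cases hne : Nonempty (SuppIdx s r)
    · obtain ⟨a, ha⟩ : ∃ a, ‖P‖ = ‖P a‖ := by
        obtain ⟨a, -, ha⟩ := Finset.exists_max_image Finset.univ (fun a => ‖P a‖)
          Finset.univ_nonempty
        refine ⟨a, le_antisymm ((pi_norm_le_iff_of_nonneg (norm_nonneg _)).2 fun b =>
          ha b (Finset.mem_univ b)) (norm_le_pi_norm P a)⟩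
      rw [ha, hP, Real.norm_eq_abs]
      exact hζ.gain hs hr (h2 ζ hζ) hδs a
    · rw [not_nonempty_iff] at hne
      rw [Subsingleton.elim P 0]
      simp
  have h5 : |∑ a, advVec u s r σ a * err a (σ, ζ)| ≤ δ / 2 * ‖P‖ := by
    calc |∑ a, advVec u s r σ a * err a (σ, ζ)| ≤ ∑ a, |advVec u s r σ a * err a (σ, ζ)| :=
          Finset.abs_sum_le_sum_abs _ _
      _ ≤ ∑ _a : SuppIdx s r, ‖P‖ * ε := by
          refine Finset.sum_le_sum fun a _ => ?_
          rw [abs_mul]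
          refine mul_le_mul ?_ (h1 ζ hζ.1 a).le (abs_nonneg _) (norm_nonneg _)
          rw [hP]
          exact norm_le_pi_norm (advVec u s r σ) a
      _ = n * ε * ‖P‖ := by
          rw [Finset.sum_const, Finset.card_univ, nsmul_eq_mul, ← hn]; ring
      _ ≤ _ := mul_le_mul_of_nonneg_right hεn (norm_nonneg _)
  have h6 := (abs_le.1 h5).1
  rw [← hP]
  rw [← hP] at h4 h6
  linarith

end LocalGrowth

/-! ### Extinction in finite time for a square-root differential inequality. -/

section AbsolutelyContinuous

theorem absolutelyContinuousOnInterval_prod {κ : Type*} (s : Finset κ) {f : κ → ℝ → ℝ} {a b : ℝ}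
    (h : ∀ k ∈ s, AbsolutelyContinuousOnInterval (f k) a b) :
    AbsolutelyContinuousOnInterval (fun t => ∏ k ∈ s, f k t) a b := by
  classical
  induction s using Finset.induction_on with
  | empty =>
    simp only [Finset.prod_empty]
    exact absolutelyContinuousOnInterval_const 1 a b
  | insert k s hk ih =>
    simp only [Finset.prod_insert hk]
    exact (h k (Finset.mem_insert_self k s)).mul
      (ih fun l hl => h l (Finset.mem_insert_of_mem hl))

theorem absolutelyContinuousOnInterval_comp {f φ : ℝ → ℝ} {a b : ℝ} {K : NNReal}
    (hf : AbsolutelyContinuousOnInterval f a b) (hφ : LipschitzOnWith K φ (f '' uIcc a b)) :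
    AbsolutelyContinuousOnInterval (fun t => φ (f t)) a b := by
  have h1 : Tendsto (fun E : ℕ × (ℕ → ℝ × ℝ) => (K : ℝ) *
      ∑ i ∈ Finset.range E.1, dist (f (E.2 i).1) (f (E.2 i).2))
      (AbsolutelyContinuousOnInterval.totalLengthFilter ⊓
        𝓟 (AbsolutelyContinuousOnInterval.disjWithin a b)) (𝓝 0) := by
    have := Tendsto.const_mul (K : ℝ) hf
    rwa [mul_zero] at this
  refine squeeze_zero' (Eventually.of_forall fun E => Finset.sum_nonneg fun i _ => dist_nonneg)
    ?_ h1
  filter_upwards [mem_inf_of_right (mem_principal_self _)] with E hE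
  rw [Finset.mul_sum]
  refine Finset.sum_le_sum fun i hi => ?_
  exact hφ.dist_le_mul _ (mem_image_of_mem f (hE.1 i hi).1) _ (mem_image_of_mem f (hE.1 i hi).2)

theorem lipschitzOnWith_sqrt {δ : ℝ} (hδ : 0 < δ) :
    LipschitzOnWith (Real.toNNReal (1 / (2 * √δ))) Real.sqrt (Ici δ) := by
  refine LipschitzOnWith.of_dist_le_mul fun x hx y hy => ?_
  have hs : 0 < √δ := Real.sqrt_pos.2 hδ
  rw [Real.coe_toNNReal _ (by positivity), Real.dist_eq, Real.dist_eq]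
  have hx' : √δ ≤ √x := Real.sqrt_le_sqrt hx
  have hy' : √δ ≤ √y := Real.sqrt_le_sqrt hy
  have h1 : x - y = (√x - √y) * (√x + √y) := by
    have hx2 := Real.sq_sqrt (hδ.le.trans hx)
    have hy2 := Real.sq_sqrt (hδ.le.trans hy)
    linear_combination hy2 - hx2
  rw [h1, abs_mul, abs_of_pos (a := √x + √y) (by linarith), one_div, ← div_eq_inv_mul,
    le_div_iff₀ (by positivity)]
  exact mul_le_mul_of_nonneg_left (by linarith) (abs_nonneg _)

/-- A nonnegative function whose derivative is at most `-κ √y` cannot stay positive. -/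
theorem not_forall_pos_of_deriv_le_sqrt {y : ℝ → ℝ} {T κ : ℝ} (hκ : 0 < κ)
    (hac : ∀ b, T ≤ b → AbsolutelyContinuousOnInterval y T b) (hpos : ∀ t, T ≤ t → 0 < y t)
    (hd : ∀ᵐ t : ℝ, T ≤ t → ∃ d, d ≤ -(κ * √(y t)) ∧ HasDerivAt y d t) : False := by
  -- The function `√y` falls at rate at least `κ / 2`, so it is exhausted by this time.
  obtain ⟨b, hb⟩ : ∃ b, b = T + 2 * √(y T) / κ := ⟨_, rfl⟩
  have hTb : T ≤ b := by
    rw [hb]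
    have := Real.sqrt_nonneg (y T)
    have : 0 ≤ 2 * √(y T) / κ := by positivity
    linarith
  have hcont := (hac b hTb).continuousOn
  rw [uIcc_of_le hTb] at hcont
  obtain ⟨t₀, ht₀, hmin⟩ := isCompact_Icc.exists_isMinOn (nonempty_Icc.2 hTb) hcont
  -- The square root is Lipschitz only away from 0, so the positive minimum over the interval is
  -- needed for `√y` to be absolutely continuous.
  have hδ : 0 < y t₀ := hpos t₀ ht₀.1
  have hac' : AbsolutelyContinuousOnInterval (fun t => √(y t)) T b := by
    refine absolutelyContinuousOnInterval_comp (hac b hTb) ((lipschitzOnWith_sqrt hδ).mono ?_)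
    rintro _ ⟨t, ht, rfl⟩
    rw [uIcc_of_le hTb] at ht
    exact hmin ht
  have h1 := sub_le_mul_of_ae_hasDerivAt (c := -(κ / 2)) hTb hac' (by
    filter_upwards [hd] with t ht hti
    obtain ⟨d, hd, hd'⟩ := ht hti.1
    have hy := hpos t hti.1
    refine ⟨_, ?_, hd'.sqrt hy.ne'⟩
    have hs := Real.sqrt_pos.2 hy
    rw [div_le_iff₀ (by positivity)]
    linarith)
  have h2 := Real.sqrt_pos.2 (hpos b hTb)
  have h3 : κ / 2 * (b - T) = √(y T) := by
    rw [hb]; field_simp; ring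
  linarith

end AbsolutelyContinuous

/-! ### The quadratic form along a process, and the finite-time argument. -/

section FiniteTime

open scoped Classical

variable {N : ℕ} {m : Fin N → ℕ}

theorem IsProc.ac_pay {V : (Idx m → ℝ) → Set (Idx m → ℝ)} {x : ℝ → Idx m → ℝ}
    (hx : IsProc V x) {b : ℝ} (hb : 0 ≤ b) (u : Profile m → ℝ) (i : Fin N) (k : Fin (m i + 1)) :
    AbsolutelyContinuousOnInterval (fun t => pay u i k (toWeights (x t))) 0 b := by
  simp only [pay, expectedUtility, prod_update]
  exact absolutelyContinuousOnInterval_sum _ fun y _ =>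
    ((absolutelyContinuousOnInterval_prod _ fun j _ => hx.ac_toWeights hb j (y j)).const_mul
      _).const_mul _

theorem IsProc.ac_adv {V : (Idx m → ℝ) → Set (Idx m → ℝ)} {x : ℝ → Idx m → ℝ}
    (hx : IsProc V x) {b : ℝ} (hb : 0 ≤ b) (u : Profile m → ℝ) (r : Profile m) (i : Fin N)
    (k : Fin (m i + 1)) :
    AbsolutelyContinuousOnInterval (fun t => adv u r i k (toWeights (x t))) 0 b :=
  (hx.ac_pay hb u i k).sub (hx.ac_pay hb u i (r i))

/-- The quadratic form used to show that a process stops in finite time. -/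
noncomputable def advForm (u : Profile m → ℝ) (s : Weights m) (r : Profile m)
    (B : Matrix (SuppIdx s r) (SuppIdx s r) ℝ) (σ : Weights m) : ℝ :=
  (∑ a, ∑ b, B a b * (advVec u s r σ a * advVec u s r σ b)) / 2

theorem abs_advForm_le (u : Profile m → ℝ) (s : Weights m) (r : Profile m)
    (B : Matrix (SuppIdx s r) (SuppIdx s r) ℝ) :
    ∃ K, 0 < K ∧ ∀ σ, |advForm u s r B σ| ≤ K * ‖advVec u s r σ‖ ^ 2 := by
  refine ⟨(∑ a, ∑ b, |B a b|) + 1, ?_, fun σ => ?_⟩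
  · have : 0 ≤ ∑ a, ∑ b, |B a b| :=
      Finset.sum_nonneg fun a _ => Finset.sum_nonneg fun b _ => abs_nonneg _
    linarith
  · have h1 : |∑ a, ∑ b, B a b * (advVec u s r σ a * advVec u s r σ b)| ≤
        (∑ a, ∑ b, |B a b|) * ‖advVec u s r σ‖ ^ 2 := by
      rw [Finset.sum_mul]
      refine (Finset.abs_sum_le_sum_abs _ _).trans (Finset.sum_le_sum fun a _ => ?_)
      rw [Finset.sum_mul]
      refine (Finset.abs_sum_le_sum_abs _ _).trans (Finset.sum_le_sum fun b _ => ?_)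
      rw [abs_mul, abs_mul, sq]
      refine mul_le_mul_of_nonneg_left ?_ (abs_nonneg _)
      exact mul_le_mul (norm_le_pi_norm (advVec u s r σ) a) (norm_le_pi_norm (advVec u s r σ) b)
        (abs_nonneg _) (norm_nonneg _)
    rw [advForm, abs_div, abs_of_pos (two_pos : (0 : ℝ) < 2)]
    have h2 := sq_nonneg ‖advVec u s r σ‖
    have h3 := abs_nonneg (∑ a, ∑ b, B a b * (advVec u s r σ a * advVec u s r σ b))
    rw [add_mul]
    linarith

theorem hasDerivAt_advForm (u : Profile m → ℝ) {s : Weights m} {r : Profile m}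
    {B : Matrix (SuppIdx s r) (SuppIdx s r) ℝ} (hB : B.IsSymm) {σ : ℝ → Weights m} {σ' : Weights m}
    {t : ℝ} (h : HasDerivAt σ σ' t) :
    HasDerivAt (fun t => advForm u s r B (σ t))
      (∑ a, advVec u s r (σ t) a * ∑ b, B a b * advDeriv u r b.1.1 b.1.2 (σ t) σ') t := by
  have hP : ∀ a : SuppIdx s r, HasDerivAt (fun t => advVec u s r (σ t) a)
      (advDeriv u r a.1.1 a.1.2 (σ t) σ') t := fun a =>
    (hasFDerivAt_adv u r a.1.1 a.1.2 (σ t)).comp_hasDerivAt t h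
  have h1 := (HasDerivAt.fun_sum (u := Finset.univ) fun (a : SuppIdx s r) _ =>
    HasDerivAt.fun_sum (u := Finset.univ) fun (b : SuppIdx s r) _ =>
      ((hP a).mul (hP b)).const_mul (B a b)).div_const 2
  refine h1.congr_deriv ?_
  simp only [mul_add, Finset.sum_add_distrib, Finset.mul_sum]
  have h2 : ∑ a, ∑ b, B a b * (advDeriv u r a.1.1 a.1.2 (σ t) σ' * advVec u s r (σ t) b) =
      ∑ a, ∑ b, advVec u s r (σ t) a * (B a b * advDeriv u r b.1.1 b.1.2 (σ t) σ') := by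
    rw [Finset.sum_comm]
    refine Finset.sum_congr rfl fun a _ => Finset.sum_congr rfl fun b _ => ?_
    rw [hB.apply a b]; ring
  have h3 : ∑ a, ∑ b, B a b * (advVec u s r (σ t) a * advDeriv u r b.1.1 b.1.2 (σ t) σ') =
      ∑ a, ∑ b, advVec u s r (σ t) a * (B a b * advDeriv u r b.1.1 b.1.2 (σ t) σ') :=
    Finset.sum_congr rfl fun a _ => Finset.sum_congr rfl fun b _ => by ring
  rw [h2, h3]
  ring

theorem continuous_advVec (u : Profile m → ℝ) (s : Weights m) (r : Profile m) :
    Continuous (advVec u s r) := continuous_pi fun a => continuous_adv u r a.1.1 a.1.2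

theorem IsProc.ac_advForm {V : (Idx m → ℝ) → Set (Idx m → ℝ)} {x : ℝ → Idx m → ℝ}
    (hx : IsProc V x) {b : ℝ} (hb : 0 ≤ b) (u : Profile m → ℝ) {s : Weights m} {r : Profile m}
    (B : Matrix (SuppIdx s r) (SuppIdx s r) ℝ) :
    AbsolutelyContinuousOnInterval (fun t => advForm u s r B (toWeights (x t))) 0 b := by
  simp only [advForm, advVec, div_eq_inv_mul]
  refine AbsolutelyContinuousOnInterval.const_mul _ ?_
  refine absolutelyContinuousOnInterval_sum _ fun a _ => ?_
  refine absolutelyContinuousOnInterval_sum _ fun c _ => ?_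
  refine AbsolutelyContinuousOnInterval.const_mul _ ?_
  exact (hx.ac_adv hb u r a.1.1 a.1.2).mul (hx.ac_adv hb u r c.1.1 c.1.2)

theorem IsProc.continuousOn {V : (Idx m → ℝ) → Set (Idx m → ℝ)} {x : ℝ → Idx m → ℝ}
    (hx : IsProc V x) : ContinuousOn x (Ici 0) := by
  refine continuousOn_pi.2 fun a t ht => ?_
  have h1 := (hx.ac (t + 1) (by linarith [mem_Ici.1 ht]) a).continuousOn
  rw [uIcc_of_le (by linarith [mem_Ici.1 ht])] at h1
  refine (h1 t ⟨ht, by linarith⟩).mono_of_mem_nhdsWithin ?_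
  rw [mem_nhdsWithin]
  exact ⟨Iio (t + 1), isOpen_Iio, by simp, fun y hy => ⟨hy.2, hy.1.le⟩⟩

/-- A process which converges to a nondegenerate equilibrium meets, at arbitrarily late times,
the set where all strategies in the support are indifferent. -/
theorem IsProc.exists_advVec_eq_zero {V : (Idx m → ℝ) → Set (Idx m → ℝ)} {x : ℝ → Idx m → ℝ}
    (hx : IsProc V x) {u : Profile m → ℝ}
    (hV : ∀ y, ∀ z ∈ V y, IsReply u (toWeights y) (toWeights z)) {r : Profile m} {s : Weights m}
    (hs : s ∈ Nash (fun _ : Fin N => u)) (hr : ∀ i, s i (r i) ≠ 0)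
    (hstrict : ∀ i k, s i k = 0 → pay u i k s < pay u i (r i) s) (hnd : IsNondegenerate u r s)
    (hlim : Tendsto (fun t => toWeights (x t)) atTop (𝓝 s)) (T₀ : ℝ) :
    ∃ t, T₀ ≤ t ∧ advVec u s r (toWeights (x t)) = 0 := by
  have hN := (mem_Nash_iff u s).1 hs
  obtain ⟨B, hBs, hB⟩ := exists_symm_inverse hr hnd
  obtain ⟨c, hc, hgrow⟩ := eventually_growth hN.1 hr hstrict hB
  obtain ⟨K, hK, hKq⟩ := abs_advForm_le u s r B
  obtain ⟨T₁, hT₁⟩ := eventually_atTop.1 (hlim.eventually hgrow)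
  by_contra! hne
  obtain ⟨T, hT⟩ : ∃ T, T = max (max T₀ T₁) 0 := ⟨_, rfl⟩
  have hTT₀ : T₀ ≤ T := hT ▸ (le_max_left _ _).trans (le_max_left _ _)
  have hTT₁ : T₁ ≤ T := hT ▸ (le_max_right _ _).trans (le_max_left _ _)
  have hT0 : 0 ≤ T := hT ▸ le_max_right _ _
  obtain ⟨q, hq⟩ : ∃ q : ℝ → ℝ, q = fun t => advForm u s r B (toWeights (x t)) := ⟨_, rfl⟩
  have hder : ∀ᵐ t : ℝ, T ≤ t →
      ∃ d, c * ‖advVec u s r (toWeights (x t))‖ ≤ d ∧ HasDerivAt q d t := by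
    filter_upwards [hx.deriv] with t ht hTt
    obtain ⟨z, hz, hd⟩ := ht (hT0.trans hTt)
    refine ⟨_, hT₁ t (hTT₁.trans hTt) _ (hV _ z hz), ?_⟩
    rw [hq]
    exact hasDerivAt_advForm u hBs (hasDerivAt_toWeights hd)
  have hac : ∀ a b, T ≤ a → a ≤ b → AbsolutelyContinuousOnInterval q a b := by
    intro a b ha hab
    rw [hq]
    refine (hx.ac_advForm (hT0.trans (ha.trans hab)) u B).mono ?_
    rw [uIcc_of_le hab, uIcc_of_le (hT0.trans (ha.trans hab))]
    exact Icc_subset_Icc_left (hT0.trans ha)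
  have hstep : ∀ a b η, T ≤ a → a ≤ b →
      (∀ t ∈ Icc a b, η ≤ ‖advVec u s r (toWeights (x t))‖) → c * η * (b - a) ≤ q b - q a := by
    intro a b η ha hab hη
    refine mul_sub_le_of_ae_hasDerivAt hab (hac a b ha hab) ?_
    filter_upwards [hder] with t ht hti
    obtain ⟨d, hd, hd'⟩ := ht (ha.trans hti.1)
    exact ⟨d, (mul_le_mul_of_nonneg_left (hη t hti) hc.le).trans hd, hd'⟩
  have hmono : ∀ a b, T ≤ a → a ≤ b → q a ≤ q b := by
    intro a b ha hab
    have := hstep a b 0 ha hab fun t _ => norm_nonneg _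
    simp only [mul_zero, zero_mul] at this
    linarith
  have hstrictmono : ∀ a, T ≤ a → q a < q (a + 1) := by
    intro a ha
    have hcont : ContinuousOn (fun t => ‖advVec u s r (toWeights (x t))‖) (Icc a (a + 1)) :=
      ((continuous_advVec u s r).comp continuous_toWeights).norm.comp_continuousOn
        (hx.continuousOn.mono fun t ht => hT0.trans (ha.trans ht.1))
    obtain ⟨t₀, ht₀, hmin⟩ := isCompact_Icc.exists_isMinOn (nonempty_Icc.2 (by linarith)) hcont
    have h1 := hstep a (a + 1) _ ha (by linarith) fun t ht => hmin ht
    have h2 : 0 < ‖advVec u s r (toWeights (x t₀))‖ :=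
      norm_pos_iff.2 (hne t₀ (hTT₀.trans (ha.trans ht₀.1)))
    have h3 := mul_pos hc h2
    simp only at h1
    linarith
  -- All advantages on the support vanish at the equilibrium `s`.
  have hqlim : Tendsto q atTop (𝓝 0) := by
    have h1 : Tendsto (fun t => K * ‖advVec u s r (toWeights (x t))‖ ^ 2) atTop
        (𝓝 (K * ‖advVec u s r s‖ ^ 2)) :=
      ((((continuous_advVec u s r).tendsto s).comp hlim).norm.pow 2).const_mul K
    have h2 : advVec u s r s = 0 := by
      ext a
      exact sub_eq_zero.2 (le_antisymm (hN.2 _ _ (hr _) _) (hN.2 _ _ a.2.1 _))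
    rw [h2, norm_zero] at h1
    simp only [ne_eq, OfNat.ofNat_ne_zero, not_false_eq_true, zero_pow, mul_zero] at h1
    rw [hq]
    exact squeeze_zero_norm (fun t => hKq _) h1
  -- An increasing function with limit 0 that gains strictly in each unit of time is negative.
  have hneg : ∀ t, T ≤ t → q t < 0 := by
    intro t ht
    refine (hstrictmono t ht).trans_le (ge_of_tendsto hqlim ?_)
    filter_upwards [eventually_ge_atTop (t + 1)] with t' ht'
    exact hmono _ _ (by linarith) ht'
  -- From `-q ≤ K‖P‖²` the growth rate `c‖P‖` is at least `(c / √K) * √(-q)`, where `P` is the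
  -- vector of advantages; so `-q` would have to die out in finite time.
  have hsq : 0 < √K := Real.sqrt_pos.2 hK
  refine not_forall_pos_of_deriv_le_sqrt (y := fun t => -q t) (T := T) (κ := c / √K)
    (by positivity) (fun b hb => (hac T b le_rfl hb).neg) (fun t ht => by
      have := hneg t ht; linarith) ?_
  filter_upwards [hder] with t ht hTt
  obtain ⟨d, hd, hd'⟩ := ht hTt
  refine ⟨-d, neg_le_neg (le_trans ?_ hd), hd'.neg⟩
  rw [div_mul_eq_mul_div, div_le_iff₀ hsq, mul_assoc]
  refine mul_le_mul_of_nonneg_left ?_ hc.le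
  rw [← Real.sqrt_sq (norm_nonneg (advVec u s r (toWeights (x t)))),
    ← Real.sqrt_mul (sq_nonneg _)]
  refine Real.sqrt_le_sqrt ?_
  rw [mul_comm]
  refine le_trans (neg_le_abs _) ?_
  rw [hq]
  exact hKq _

end FiniteTime

/-! ### Convergence from a Lyapunov function with isolated zeros. -/

section Convergence

/-- Since `g` is increasing and bounded, its increments over windows of fixed length tend to 0. By
uniform continuity a value `ψ t ≥ ε` would keep `ψ` above `ε / 2` on such a window and force a fixed
increment. -/
theorem tendsto_zero_of_le_deriv {g ψ : ℝ → ℝ} {C : ℝ}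
    (hac : ∀ b, 0 ≤ b → AbsolutelyContinuousOnInterval g 0 b) (hg : ∀ t, 0 ≤ t → g t ≤ C)
    (hψ : ∀ t, 0 ≤ t → 0 ≤ ψ t) (hu : UniformContinuousOn ψ (Ici 0))
    (hd : ∀ᵐ t : ℝ, 0 ≤ t → ∃ d, ψ t ≤ d ∧ HasDerivAt g d t) : Tendsto ψ atTop (𝓝 0) := by
  have hstep : ∀ a b η, 0 ≤ a → a ≤ b → (∀ t ∈ Icc a b, η ≤ ψ t) → η * (b - a) ≤ g b - g a := by
    intro a b η ha hab hη
    refine mul_sub_le_of_ae_hasDerivAt hab ((hac b (ha.trans hab)).mono ?_) ?_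
    · rw [uIcc_of_le hab, uIcc_of_le (ha.trans hab)]
      exact Icc_subset_Icc_left ha
    · filter_upwards [hd] with t ht hti
      obtain ⟨d, h1, h2⟩ := ht (ha.trans hti.1)
      exact ⟨d, (hη t hti).trans h1, h2⟩
  have hmono : MonotoneOn g (Ici 0) := fun a ha b _ hab => by
    have := hstep a b 0 ha hab fun t ht => hψ t (le_trans ha ht.1)
    linarith
  have hmono' : Monotone fun t => g (max t 0) := fun a b hab =>
    hmono (le_max_right a 0) (le_max_right b 0) (max_le_max_right 0 hab)
  have hbdd : BddAbove (range fun t => g (max t 0)) :=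
    ⟨C, by rintro _ ⟨t, rfl⟩; exact hg _ (le_max_right t 0)⟩
  have hL := tendsto_atTop_ciSup hmono' hbdd
  rw [Metric.tendsto_atTop]
  intro ε hε
  obtain ⟨δ, hδ, huδ⟩ := Metric.uniformContinuousOn_iff.1 hu (ε / 2) (by positivity)
  have hdiff := (hL.comp (tendsto_atTop_add_const_right atTop (δ / 2) tendsto_id)).sub hL
  rw [sub_self] at hdiff
  have hpos : 0 < ε / 2 * (δ / 2) := by positivity
  obtain ⟨T, hT⟩ := eventually_atTop.1 (hdiff.eventually (gt_mem_nhds hpos))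
  refine ⟨max T 0, fun t ht => ?_⟩
  have ht0 : 0 ≤ t := (le_max_right T 0).trans ht
  have h1 := hT t ((le_max_left T 0).trans ht)
  simp only [Function.comp_apply, id_eq, max_eq_left ht0,
    max_eq_left (show (0 : ℝ) ≤ t + δ / 2 by linarith)] at h1
  rw [Real.dist_eq, sub_zero, abs_of_nonneg (hψ t ht0)]
  by_contra hcon
  have h2 := hstep t (t + δ / 2) (ε / 2) ht0 (by linarith) fun t' ht' => by
    have h3 := huδ t ht0 t' (mem_Ici.2 (ht0.trans ht'.1)) (by
      rw [Real.dist_eq, abs_sub_comm, abs_of_nonneg (by linarith [ht'.1])]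
      linarith [ht'.2])
    rw [Real.dist_eq] at h3
    linarith [(abs_lt.1 h3).2]
  rw [add_sub_cancel_left] at h2
  linarith

/-- A cluster point `z` is an isolated zero of `φ`, so `φ` is bounded below by a positive number on
a small sphere around `z`. Once `φ (x t)` is smaller than that, a continuous trajectory inside the
sphere cannot leave. -/
theorem exists_tendsto_of_isolated {E : Type*} [MetricSpace E] {K : Set E} (hK : IsCompact K)
    {φ : E → ℝ} (hφ : Continuous φ) (hpos : ∀ z ∈ K, 0 ≤ φ z)
    (hiso : ∀ z ∈ K, φ z = 0 → ∀ᶠ w in 𝓝 z, w ∈ K → φ w = 0 → w = z) {x : ℝ → E}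
    (hx : ContinuousOn x (Ici 0)) (hxK : ∀ t, 0 ≤ t → x t ∈ K)
    (hlim : Tendsto (fun t => φ (x t)) atTop (𝓝 0)) :
    ∃ z ∈ K, φ z = 0 ∧ Tendsto x atTop (𝓝 z) := by
  obtain ⟨z, hzK, hz⟩ := hK (f := map x atTop) (by
    rw [le_principal_iff, mem_map]
    filter_upwards [eventually_ge_atTop 0] with t ht using hxK t ht)
  have hfreq : ∀ U ∈ 𝓝 z, ∃ᶠ t in atTop, x t ∈ U := fun U hU => mapClusterPt_iff_frequently.1 hz U hU
  have hφz : φ z = 0 := by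
    by_contra hne
    have h0 : 0 < φ z := lt_of_le_of_ne (hpos z hzK) (Ne.symm hne)
    obtain ⟨t, h1, h2⟩ := ((hfreq _ (hφ.continuousAt.eventually
      (lt_mem_nhds (half_lt_self h0)))).and_eventually
      (hlim.eventually (gt_mem_nhds (half_pos h0)))).exists
    have h3 : φ z / 2 < φ (x t) := h1
    exact absurd h3 (not_lt.2 h2.le)
  refine ⟨z, hzK, hφz, Metric.tendsto_atTop.2 fun ε hε => ?_⟩
  obtain ⟨R, hR, hball⟩ := Metric.eventually_nhds_iff_ball.1 (hiso z hzK hφz)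
  obtain ⟨ρ, hρ, hρε, hρR⟩ : ∃ ρ, 0 < ρ ∧ ρ ≤ ε ∧ ρ < R :=
    ⟨min ε (R / 2), lt_min hε (half_pos hR), min_le_left _ _,
      (min_le_right _ _).trans_lt (half_lt_self hR)⟩
  obtain ⟨δ, hδ, hδS⟩ : ∃ δ, 0 < δ ∧ ∀ w ∈ K, dist w z = ρ → δ ≤ φ w := by
    have hS : IsCompact (K ∩ {w | dist w z = ρ}) :=
      hK.inter_right (isClosed_eq (continuous_id.dist continuous_const) continuous_const)
    rcases (K ∩ {w | dist w z = ρ}).eq_empty_or_nonempty with he | hne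
    · exact ⟨1, one_pos, fun w hw hwρ => absurd (he ▸ (⟨hw, hwρ⟩ : w ∈ K ∩ {w | dist w z = ρ})
        : w ∈ (∅ : Set E)) (notMem_empty w)⟩
    · obtain ⟨w₀, hw₀, hmin⟩ := hS.exists_isMinOn hne hφ.continuousOn
      refine ⟨φ w₀, lt_of_le_of_ne (hpos w₀ hw₀.1) fun h0 => ?_, fun w hw hwρ => hmin ⟨hw, hwρ⟩⟩
      have hd : dist w₀ z = ρ := hw₀.2
      have := hball w₀ (Metric.mem_ball.2 (hd.trans_lt hρR)) hw₀.1 h0.symm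
      rw [this, dist_self] at hd
      exact hρ.ne hd
  obtain ⟨T, hT⟩ := eventually_atTop.1 (hlim.eventually (gt_mem_nhds hδ))
  obtain ⟨t₁, h1, h2⟩ := ((hfreq _ (Metric.ball_mem_nhds z hρ)).and_eventually
    (eventually_ge_atTop (max T 0))).exists
  refine ⟨t₁, fun t ht => ?_⟩
  by_contra hcon
  have ht₁0 : 0 ≤ t₁ := (le_max_right T 0).trans h2
  have hcont : ContinuousOn (fun t => dist (x t) z) (Icc t₁ t) :=
    (continuous_id.dist continuous_const).comp_continuousOn
      (hx.mono fun t' ht' => mem_Ici.2 (ht₁0.trans ht'.1))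
  obtain ⟨t', ht', hd⟩ := intermediate_value_Icc ht hcont
    ⟨(Metric.mem_ball.1 h1).le, hρε.trans (not_lt.1 hcon)⟩
  have h3 := hδS (x t') (hxK t' (ht₁0.trans ht'.1)) hd
  have h4 := hT t' (((le_max_left T 0).trans h2).trans ht'.1)
  linarith

end Convergence

/-! ### Expected utility as Lyapunov function, and exclusion of mixed limits. -/

section Lyapunov

variable {N : ℕ} {m : Fin N → ℕ}

/-- The total gain from unilateral best replies. -/
noncomputable def totalGain (u : Profile m → ℝ) (σ : Weights m) : ℝ :=
  ∑ i, ((Finset.univ : Finset (Fin (m i + 1))).sup' Finset.univ_nonempty (fun k => pay u i k σ) -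
    expectedUtility u σ)

theorem continuous_totalGain (u : Profile m → ℝ) : Continuous (totalGain u) :=
  continuous_finsetSum _ fun i _ =>
    (Continuous.finset_sup'_apply _ fun k _ => continuous_pay u i k).sub
      (continuous_expectedUtility u)

theorem gain_nonneg (u : Profile m → ℝ) {σ : Weights m} (h : σ ∈ Delta m) (i : Fin N) :
    0 ≤ (Finset.univ : Finset (Fin (m i + 1))).sup' Finset.univ_nonempty (fun k => pay u i k σ) -
      expectedUtility u σ := by
  rw [expectedUtility_eq_sum_pay u σ i, sub_nonneg]
  calc ∑ k, σ i k * pay u i k σ ≤ ∑ k, σ i k *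
      (Finset.univ : Finset (Fin (m i + 1))).sup' Finset.univ_nonempty (fun k => pay u i k σ) :=
        Finset.sum_le_sum fun k hk => mul_le_mul_of_nonneg_left
          (Finset.le_sup' (fun k => pay u i k σ) hk) ((h i).1 k)
    _ = _ := by rw [← Finset.sum_mul, (h i).2, one_mul]

theorem totalGain_nonneg (u : Profile m → ℝ) {σ : Weights m} (h : σ ∈ Delta m) :
    0 ≤ totalGain u σ := Finset.sum_nonneg fun i _ => gain_nonneg u h i

theorem mem_Nash_of_totalGain_eq_zero {u : Profile m → ℝ} {σ : Weights m} (h : σ ∈ Delta m)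
    (h0 : totalGain u σ = 0) : σ ∈ Nash (fun _ : Fin N => u) := by
  rw [mem_Nash_iff]
  refine ⟨h, fun i => ?_⟩
  have h1 := (Finset.sum_eq_zero_iff_of_nonneg fun i _ => gain_nonneg u h i).1 h0 i
    (Finset.mem_univ i)
  obtain ⟨M, hM⟩ : ∃ M, M = (Finset.univ : Finset (Fin (m i + 1))).sup' Finset.univ_nonempty
    (fun k => pay u i k σ) := ⟨_, rfl⟩
  have hle : ∀ k, pay u i k σ ≤ M := fun k =>
    hM ▸ Finset.le_sup' (fun k => pay u i k σ) (Finset.mem_univ k)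
  rw [← hM, expectedUtility_eq_sum_pay u σ i] at h1
  have h2 : ∑ k, σ i k * (M - pay u i k σ) = 0 := by
    simp only [mul_sub, Finset.sum_sub_distrib, ← Finset.sum_mul, (h i).2, one_mul]
    exact h1
  intro k hk l
  have h3 := (Finset.sum_eq_zero_iff_of_nonneg fun k _ =>
    mul_nonneg ((h i).1 k) (sub_nonneg.2 (hle k))).1 h2 k (Finset.mem_univ k)
  have h4 := (mul_eq_zero.1 h3).resolve_left hk
  linarith [hle l]

/-- By multilinearity the derivative is the sum over the players of the gains from switching alone
to `ζ i`, and each is maximal for a best reply. -/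
theorem IsReply.sum_eq_totalGain {u : Profile m → ℝ} {σ ζ : Weights m} (h : IsReply u σ ζ) :
    (utilityMultilinear u).linearDeriv σ (ζ - σ) = totalGain u σ := by
  rw [linearDeriv_utilityMultilinear]
  refine Finset.sum_congr rfl fun i _ => ?_
  simp only [Pi.sub_apply, sub_mul, Finset.sum_sub_distrib]
  rw [← expectedUtility_eq_sum_pay]
  congr 1
  obtain ⟨k₀, hk₀⟩ := exists_mem_support h.1 i
  have h1 : (Finset.univ : Finset (Fin (m i + 1))).sup' Finset.univ_nonempty
      (fun k => pay u i k σ) = pay u i k₀ σ :=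
    le_antisymm (Finset.sup'_le _ _ fun l _ => h.2 i k₀ hk₀ l)
      (Finset.le_sup' (fun k => pay u i k σ) (Finset.mem_univ k₀))
  rw [h1]
  have h2 : ∀ k, ζ i k * pay u i k σ = ζ i k * pay u i k₀ σ := fun k => by
    by_cases hk : ζ i k = 0
    · rw [hk, zero_mul, zero_mul]
    · rw [le_antisymm (h.2 i k₀ hk₀ k) (h.2 i k hk k₀)]
  rw [Finset.sum_congr rfl fun k _ => h2 k, ← Finset.sum_mul, (h.1 i).2, one_mul]

theorem IsProc.ac_expectedUtility {V : (Idx m → ℝ) → Set (Idx m → ℝ)} {x : ℝ → Idx m → ℝ}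
    (hx : IsProc V x) {b : ℝ} (hb : 0 ≤ b) (u : Profile m → ℝ) :
    AbsolutelyContinuousOnInterval (fun t => expectedUtility u (toWeights (x t))) 0 b := by
  simp only [expectedUtility]
  exact absolutelyContinuousOnInterval_sum _ fun y _ =>
    (absolutelyContinuousOnInterval_prod _ fun j _ => hx.ac_toWeights hb j (y j)).const_mul _

theorem isCompact_strategySpace : IsCompact {z : Idx m → ℝ | toWeights z ∈ Delta m} := by
  refine (isCompact_closedBall (0 : Idx m → ℝ) 1).of_isClosed_subset
    (isCompact_Delta.isClosed.preimage continuous_toWeights) fun z hz => ?_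
  rw [mem_closedBall_zero_iff]
  exact norm_le_one_of_mem_Delta hz

theorem IsProc.uniformContinuousOn {V : (Idx m → ℝ) → Set (Idx m → ℝ)} {x : ℝ → Idx m → ℝ}
    (hx : IsProc V x) (hV : ∀ y, ∀ z ∈ V y, ‖z‖ ≤ 1) : UniformContinuousOn x (Ici 0) := by
  refine LipschitzOnWith.uniformContinuousOn (K := 2) (LipschitzOnWith.of_dist_le_mul ?_)
  have key : ∀ s t : ℝ, 0 ≤ s → s ≤ t → dist (x s) (x t) ≤ 2 * dist s t := by
    intro s t hs hst
    rw [dist_comm, dist_eq_norm, dist_comm, Real.dist_eq, abs_of_nonneg (by linarith)]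
    exact hx.isSol.norm_sub_le hV hs hst
  intro s hs t ht
  rcases le_total s t with hst | hst
  · exact key s t hs hst
  · rw [dist_comm, dist_comm s t]; exact key t s ht hst

/-- In a regular game with common interests every process converges to an equilibrium. -/
theorem IsProc.exists_tendsto {V : (Idx m → ℝ) → Set (Idx m → ℝ)} {x : ℝ → Idx m → ℝ}
    (hx : IsProc V x) {u : Profile m → ℝ}
    (hV : ∀ y, ∀ z ∈ V y, IsReply u (toWeights y) (toWeights z))
    (hreg : IsRegularGame (fun _ : Fin N => u)) :
    ∃ s ∈ Nash (fun _ : Fin N => u), Tendsto (fun t => toWeights (x t)) atTop (𝓝 s) := by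
  have hφ : Continuous fun z : Idx m → ℝ => totalGain u (toWeights z) :=
    (continuous_totalGain u).comp continuous_toWeights
  have hK := isCompact_strategySpace (m := m)
  obtain ⟨C, hC⟩ := isCompact_Delta.bddAbove_image (continuous_expectedUtility u).continuousOn
  have hlim : Tendsto (fun t => totalGain u (toWeights (x t))) atTop (𝓝 0) := by
    refine tendsto_zero_of_le_deriv (g := fun t => expectedUtility u (toWeights (x t))) (C := C)
      (fun b hb => hx.ac_expectedUtility hb u)
      (fun t ht => hC (mem_image_of_mem _ (hx.mem t ht)))
      (fun t ht => totalGain_nonneg u (hx.mem t ht)) ?_ ?_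
    · exact (hK.uniformContinuousOn_of_continuous hφ.continuousOn).comp
        (hx.uniformContinuousOn fun y z hz => norm_le_one_of_mem_Delta (hV y z hz).1)
        fun t ht => hx.mem t ht
    · filter_upwards [hx.deriv] with t ht ht0
      obtain ⟨z, hz, hd⟩ := ht ht0
      refine ⟨_, (hV _ z hz).sum_eq_totalGain.ge, ?_⟩
      exact (hasFDerivAt_expectedUtility u _).comp_hasDerivAt t (hasDerivAt_toWeights hd)
  obtain ⟨z, hz, hz0, hzlim⟩ := exists_tendsto_of_isolated hK hφ
    (fun z hz => totalGain_nonneg u hz) (fun z hz hz0 => by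
      obtain ⟨r, hr, hdet⟩ := hreg _ (mem_Nash_of_totalGain_eq_zero hz hz0)
      filter_upwards [continuous_toWeights.continuousAt.eventually
        (eventually_eq_of_mem_Nash hr hdet)] with w hw hwK hw0
      exact toWeights_injective (hw (mem_Nash_of_totalGain_eq_zero hwK hw0)))
    hx.continuousOn hx.mem hlim
  exact ⟨_, mem_Nash_of_totalGain_eq_zero hz hz0, (continuous_toWeights.tendsto z).comp hzlim⟩

/-- Choose irreducible factors `a` and `b` of the two differences, both vanishing at `x`. If they
were associated, `a` would contain no coordinate of player `j`, so `a`, and with it the difference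
of player `i`, would still vanish after a move of player `j` in direction `dir r j l`. But that
difference is affine along this move, with slope nonzero by `h`. -/
theorem mem_multiZeros_of_advVec_eq_zero {u : Profile m → ℝ} {r : Profile m} {x : Idx m → ℝ}
    {i j : Fin N} {k : Fin (m i + 1)} {l : Fin (m j + 1)}
    (hi : adv u r i k (toWeights x) = 0) (hj : adv u r j l (toWeights x) = 0)
    (h : advDeriv u r i k (toWeights x) (dir r j l) ≠ 0) : x ∈ multiZeros (indiffPoly u) := by
  have hij : j ≠ i := by
    rintro rfl
    exact h (advDeriv_dir_self u r j k l _)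
  -- Duplicates have constant advantage 0, hence zero slope.
  have hnd : ∀ {i j : Fin N} {k : Fin (m i + 1)} {l : Fin (m j + 1)}, j ≠ i →
      advDeriv u r i k (toWeights x) (dir r j l) ≠ 0 → ¬ Duplicate u i k (r i) := by
    intro i j k l hij h hd
    apply h
    rw [advDeriv_dir u r hij, adv, adv, hd.pay_eq, hd.pay_eq]
    ring
  have hdi := hnd hij h
  have hdj := hnd hij.symm (by rwa [advDeriv_dir_comm] at h)
  obtain ⟨a, ha, had, hax⟩ := exists_irreducible_dvd_eval_eq_zero (diffPoly_ne_zero hdi)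
    (x := x) (by rw [eval_diffPoly]; exact hi)
  obtain ⟨b, hb, hbd, hbx⟩ := exists_irreducible_dvd_eval_eq_zero (diffPoly_ne_zero hdj)
    (x := x) (by rw [eval_diffPoly]; exact hj)
  refine ⟨a, b, ha, hb, had.trans (diffPoly_dvd_indiffPoly hdi),
    hbd.trans (diffPoly_dvd_indiffPoly hdj), fun hab => ?_, hax, hbx⟩
  have hvars : ∀ c ∈ a.vars, c.1 ≠ j := fun c hc =>
    vars_diffPoly u j l (r j) c (vars_subset_of_dvd (diffPoly_ne_zero hdj)
      (hab.dvd.trans hbd) hc)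
  have hw : toWeights (toCoord (toWeights x + dir r j l)) = toWeights x + dir r j l :=
    toWeights_toCoord fun i => by
      simp only [Pi.add_apply, Finset.sum_add_distrib, sum_toWeights, sum_dir, add_zero]
  have h1 : MvPolynomial.eval (toCoord (toWeights x + dir r j l)) a = 0 := by
    rw [← hax]
    refine eval_eq_of_notMem_vars fun c hc => ?_
    have h2 := hvars c hc
    have h3 : dir r j l c.1 = 0 := by simp [dir, h2]
    simp only [toCoord, Pi.add_apply, h3, Pi.zero_apply, add_zero]
    exact toWeights_succ x c.1 c.2
  obtain ⟨g, hg⟩ := had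
  have h4 := eval_diffPoly u i k (r i) (toCoord (toWeights x + dir r j l))
  rw [hg, map_mul, h1, zero_mul, hw] at h4
  have h5 := adv_update_add u r hij k l (toWeights x)
  rw [hi, zero_add, adv, ← h4] at h5
  exact h h5.symm

/-- A process which avoids the multiple zeros ends at a pure equilibrium. -/
theorem IsProc.exists_forall_reply_eq {V : (Idx m → ℝ) → Set (Idx m → ℝ)} {x : ℝ → Idx m → ℝ}
    (hx : IsProc V x) {u : Profile m → ℝ}
    (hV : ∀ y, ∀ z ∈ V y, IsReply u (toWeights y) (toWeights z))
    (hreg : IsRegularGame (fun _ : Fin N => u))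
    (hnot : ∀ t, 0 ≤ t → x t ∉ multiZeros (indiffPoly u)) :
    ∃ T, 0 ≤ T ∧ ∃ s ∈ Nash (fun _ : Fin N => u),
      ∀ t, T ≤ t → ∀ ζ, IsReply u (toWeights (x t)) ζ → ζ = s := by
  obtain ⟨s, hs, hlim⟩ := hx.exists_tendsto hV hreg
  obtain ⟨r, hr, hdet⟩ := hreg s hs
  obtain ⟨hstrict, hnd⟩ := (det_harsanyi_ne_zero_iff hs hr).1 hdet
  have hsΔ := ((mem_Nash_iff u s).1 hs).1
  by_cases hne : Nonempty (SuppIdx s r)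
  · exfalso
    obtain ⟨⟨⟨j, l⟩, hjs, hjr⟩⟩ := hne
    -- Nondegeneracy is applied to the nonzero tangent direction `dir r j l`: some used strategy
    -- must react to it.
    obtain ⟨i, k, hik, hA⟩ : ∃ i k, s i k ≠ 0 ∧ advDeriv u r i k s (dir r j l) ≠ 0 := by
      by_contra! hcon
      have h0 := hnd (dir r j l) (fun i k hk => by
        have hkr : k ≠ r i := fun hkr => (hr i).ne' (hkr ▸ hk)
        rw [dir_apply_of_ne r j i l k hkr, if_neg]
        intro hc
        cases hc
        exact hjs hk) (fun i => sum_dir r j i l) fun i k hk => sub_eq_zero.1 (hcon i k hk)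
      have h1 := congrFun (congrFun h0 j) l
      rw [dir_apply_of_ne r j j l l hjr, if_pos rfl] at h1
      exact one_ne_zero h1
    have hkr : k ≠ r i := by
      rintro rfl
      exact hA (by simp [advDeriv])
    have hev : ∀ᶠ σ in 𝓝 s, advDeriv u r i k σ (dir r j l) ≠ 0 :=
      (((continuous_advDeriv_apply u r i k).comp
        (continuous_id.prodMk continuous_const)).tendsto s).eventually (isOpen_ne.mem_nhds hA)
    obtain ⟨T, hT⟩ := eventually_atTop.1 (hlim.eventually hev)
    obtain ⟨t, ht, hadv⟩ := hx.exists_advVec_eq_zero hV hs (fun i => (hr i).ne') hstrict hnd hlim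
      (max T 0)
    exact hnot t ((le_max_right T 0).trans ht) (mem_multiZeros_of_advVec_eq_zero
      (congrFun hadv ⟨⟨i, k⟩, hik, hkr⟩) (congrFun hadv ⟨⟨j, l⟩, hjs, hjr⟩)
      (hT t ((le_max_left T 0).trans ht)))
  -- Here `s` uses only the reference strategies, so it is pure, and late replies supported in it
  -- must equal it.
  · rw [not_nonempty_iff] at hne
    obtain ⟨T, hT⟩ := eventually_atTop.1 (hlim.eventually (eventually_reply_support hstrict))
    refine ⟨max T 0, le_max_right T 0, s, hs, fun t ht ζ hζ => ?_⟩
    have h1 := hT t ((le_max_left T 0).trans ht) ζ hζ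
    have h2 : ζ - s = 0 := eq_of_support_of_sum (s := s) (r := r)
      (fun i k hk => by simp [hk, h1 i k hk]) (fun _ _ _ => rfl)
      (fun i => by simp [Finset.sum_sub_distrib, (hζ.1 i).2, (hsΔ i).2]) (fun i => by simp)
      fun a => (hne.false a).elim
    exact sub_eq_zero.1 h2

end Lyapunov

/-! ### The exponential rate, with one constant for all processes from a start. -/

section ExponentialConvergence

variable {N : ℕ} {m : Fin N → ℕ}

theorem exists_dist_le_of_mem_X (m : Fin N → ℕ) :
    ∃ D : ℝ, 0 ≤ D ∧ ∀ x ∈ X m, ∀ y ∈ X m, dist x y ≤ D := by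
  have hsub : X m ⊆ (PiLp.continuousLinearEquiv 2 ℝ (fun _ : Idx m => ℝ)).symm ''
      {z : Idx m → ℝ | toWeights z ∈ Delta m} := fun x hx =>
    ⟨x.ofLp, (mem_X_iff x).1 hx, rfl⟩
  have hb : Bornology.IsBounded (X m) := (isCompact_strategySpace.image
    (PiLp.continuousLinearEquiv 2 ℝ (fun _ : Idx m => ℝ)).symm.continuous).isBounded.subset hsub
  exact ⟨Metric.diam (X m), Metric.diam_nonneg, fun x hx y hy => Metric.dist_le_diam_of_mem hb hx hy⟩

theorem isReply_of_mem_canonicalBR {u : Profile m → ℝ} {x z : Idx m → ℝ}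
    (h : z ∈ canonicalBR u x) : IsReply u (toWeights x) (toWeights z) :=
  ⟨h.1, fun i k hk => (h.2 i k hk).1⟩

/-- A process which aims at one point from time `T` on. -/
theorem IsProc.sub_eq_exp_smul {V : (Idx m → ℝ) → Set (Idx m → ℝ)} {x : ℝ → Idx m → ℝ}
    (hx : IsProc V x) {T : ℝ} (hT : 0 ≤ T) {p : Idx m → ℝ}
    (hV : ∀ t, T ≤ t → ∀ z ∈ V (x t), z = p) {t : ℝ} (ht : T ≤ t) :
    x t - p = Real.exp (T - t) • (x T - p) := by
  ext a
  have hac : AbsolutelyContinuousOnInterval (Real.exp * fun s => x s a - p a) T t :=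
    ((absolutelyContinuousOnInterval_exp 0 t).mul ((hx.ac t (hT.trans ht) a).sub
      (absolutelyContinuousOnInterval_const (p a) 0 t))).mono (by
        rw [uIcc_of_le ht, uIcc_of_le (hT.trans ht)]
        exact Icc_subset_Icc_left hT)
  have hd : ∀ᵐ s : ℝ, s ∈ Icc T t → HasDerivAt (Real.exp * fun s => x s a - p a) 0 s := by
    filter_upwards [hx.deriv] with s hs hsi
    obtain ⟨z, hz, hd⟩ := hs (hT.trans hsi.1)
    have h1 := (Real.hasDerivAt_exp s).mul ((hasDerivAt_pi.1 hd a).sub_const (p a))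
    refine h1.congr_deriv ?_
    rw [hV s hsi.1 z hz, Pi.sub_apply]
    ring
  have h1 := mul_sub_le_of_ae_hasDerivAt (c := 0) ht hac
    (hd.mono fun s hs hsi => ⟨0, le_rfl, hs hsi⟩)
  have h2 := sub_le_mul_of_ae_hasDerivAt (c := 0) ht hac
    (hd.mono fun s hs hsi => ⟨0, le_rfl, hs hsi⟩)
  simp only [Pi.mul_apply, zero_mul] at h1 h2
  rw [Pi.sub_apply, Pi.smul_apply, Pi.sub_apply, smul_eq_mul, Real.exp_sub, div_mul_eq_mul_div,
    eq_div_iff (Real.exp_pos t).ne']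
  linarith

/-- Regular games with common interests: convergence to equilibrium at an exponential rate. -/
theorem convergesExponentially_of_isRegularGame {u : Profile m → ℝ}
    (hreg : IsRegularGame (fun _ : Fin N => u)) :
    ConvergesExponentially (fun _ : Fin N => u) := by
  have hae := (PiLp.volume_preserving_ofLp (Idx m)).quasiMeasurePreserving.ae
    (ae_unique_and_not_hit u)
  filter_upwards [hae] with x₀ hx₀ hX
  by_cases hex : ∃ x, IsFPProcess (fun _ : Fin N => u) x₀ x
  swap
  · exact ⟨0, fun x hx => absurd ⟨x, hx⟩ hex⟩
  obtain ⟨hnot, huniq⟩ := hx₀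
  obtain ⟨x₁, hx₁⟩ := hex
  have hcan : ∀ x, IsFPProcess (fun _ : Fin N => u) x₀ x →
      IsProc (canonicalBR u) (canonicalCurve u fun t => (x t).ofLp) ∧
        canonicalCurve u (fun t => (x t).ofLp) 0 = x₀.ofLp := fun x hx =>
    ⟨hx.isProc.canonicalCurve, by rw [canonicalCurve_zero, hx.1]⟩
  obtain ⟨hy₁, hy₁0⟩ := hcan x₁ hx₁
  obtain ⟨T, hT, s, hs, hTs⟩ := hy₁.exists_forall_reply_eq
    (fun _ _ hz => isReply_of_mem_canonicalBR hz) hreg (hnot _ hy₁.isSol hy₁0)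
  have hsΔ := ((mem_Nash_iff u s).1 hs).1
  obtain ⟨p, hp⟩ : ∃ p : Coord m, p.ofLp = toCoord s := ⟨WithLp.toLp 2 (toCoord s), rfl⟩
  have hps : toWeights p.ofLp = s := by rw [hp, toWeights_toCoord fun i => (hsΔ i).2]
  have hpX : p ∈ X m := (mem_X_iff p).2 (hps ▸ hsΔ)
  have hpN : p ∈ NashX (fun _ : Fin N => u) := ⟨hpX, by rw [T_eq, hps]; exact hs⟩
  obtain ⟨D, hD, hdist⟩ := exists_dist_le_of_mem_X m
  refine ⟨Real.exp T * D, fun x hx t ht => ?_⟩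
  obtain ⟨hy, hy0⟩ := hcan x hx
  have hrep : ∀ t, T ≤ t → ∀ z ∈ coordBR u (x t).ofLp, z = p.ofLp := by
    intro t ht z hz
    apply toWeights_injective
    rw [hps]
    -- The canonical curves of `x` and `x₁` coincide, so the time `T` and the equilibrium found for
    -- `x₁` serve every process from `x₀`.
    have heq := huniq _ _ hy.isSol hy₁.isSol hy0 hy₁0 t (hT.trans ht)
    refine hTs t ht _ ?_
    rw [← heq]
    exact ⟨hz.1, fun i k hk l => by
      rw [pay_canonicalCurve, pay_canonicalCurve]; exact hz.2 i k hk l⟩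
  refine (Metric.infEDist_le_edist_of_mem hpN).trans ?_
  rw [edist_dist]
  refine ENNReal.ofReal_le_ofReal ?_
  -- Before `T` the diameter bound suffices, as `exp (T - t) ≥ 1`; after `T` the process runs
  -- straight towards `p`.
  rcases le_total t T with htT | htT
  · calc dist (x t) p ≤ D := hdist _ (hx.2.1 t ht) _ hpX
      _ ≤ Real.exp (T + -t) * D := by
        have : 1 ≤ Real.exp (T + -t) := Real.one_le_exp (by linarith)
        nlinarith
      _ = _ := by rw [Real.exp_add]; ring
  · have h1 := hx.isProc.sub_eq_exp_smul hT hrep htT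
    have h2 : x t - p = Real.exp (T - t) • (x T - p) := by
      ext a
      exact congrFun h1 a
    rw [dist_eq_norm, h2, norm_smul, Real.norm_eq_abs, abs_of_pos (Real.exp_pos _), ← dist_eq_norm]
    calc Real.exp (T - t) * dist (x T) p ≤ Real.exp (T - t) * D :=
          mul_le_mul_of_nonneg_left (hdist _ (hx.2.1 T hT) _ hpX) (Real.exp_pos _).le
      _ = _ := by rw [sub_eq_add_neg, Real.exp_add]; ring

end ExponentialConvergence

/-! ### Separable perturbations and a Sard argument. -/

section Perturbation

open scoped Classical

variable {N : ℕ} {m : Fin N → ℕ}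

/-- The common utility which is the sum of the terms `c i (y i)`. -/
def separable (c : Weights m) : Profile m → ℝ := fun y => ∑ i, c i (y i)

theorem expectedUtility_add (u v : Profile m → ℝ) (σ : Weights m) :
    expectedUtility (u + v) σ = expectedUtility u σ + expectedUtility v σ := by
  simp [expectedUtility, add_mul, Finset.sum_add_distrib]

theorem expectedUtility_const (c : ℝ) {σ : Weights m} (h : ∀ i, ∑ k, σ i k = 1) :
    expectedUtility (fun _ => c) σ = c := by
  have h1 := Finset.prod_univ_sum (fun i : Fin N => (Finset.univ : Finset (Fin (m i + 1))))
    (fun i k => σ i k)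
  rw [Finset.prod_congr rfl fun i _ => h i, Finset.prod_const_one, Fintype.piFinset_univ] at h1
  rw [expectedUtility, ← Finset.mul_sum, ← h1, mul_one]

theorem sum_update_single {σ : Weights m} (h : ∀ i, ∑ k, σ i k = 1) (i : Fin N)
    (k : Fin (m i + 1)) (j : Fin N) : ∑ l, Function.update σ i (Pi.single k 1) j l = 1 := by
  by_cases hj : j = i
  · subst hj; simp
  · simp [hj, h]

theorem pay_separable_sub (c : Weights m) {σ : Weights m} (h : ∀ i, ∑ k, σ i k = 1) (i : Fin N)
    (k l : Fin (m i + 1)) :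
    pay (separable c) i k σ - pay (separable c) i l σ = c i k - c i l := by
  have h1 : ∀ k, pay (fun y => c i (y i)) i k σ = c i k := fun k => by
    rw [pay_eq_pay_update _ i k k]
    simp only [Function.update_self]
    exact expectedUtility_const _ (sum_update_single h i k)
  rw [pay_sub_eq (separable c) (fun y => c i (y i)) i σ (fun y a b => ?_) k l, h1, h1]
  simp only [separable, ← Finset.sum_sub_distrib]
  rw [Finset.sum_eq_single i]
  · intro j _ hj; simp [hj]
  · simp

theorem adv_add_separable (u : Profile m → ℝ) (c : Weights m) {σ : Weights m}
    (h : ∀ i, ∑ k, σ i k = 1) (r : Profile m) (i : Fin N) (k : Fin (m i + 1)) :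
    adv (u + separable c) r i k σ = adv u r i k σ + (c i k - c i (r i)) := by
  rw [← pay_separable_sub c h i k (r i)]
  simp only [adv, pay, expectedUtility_add]
  ring

/-- The perturbation adds the same linear form to the derivative of every payoff of player `i`, so
it cancels in the differences. The advantages themselves move only by constants. -/
theorem advDeriv_add_separable (u : Profile m → ℝ) (c : Weights m) {σ h : Weights m}
    (hσ : ∀ i, ∑ k, σ i k = 1) (hh : ∀ i, ∑ k, h i k = 0) (r : Profile m) (i : Fin N)
    (k : Fin (m i + 1)) :
    advDeriv (u + separable c) r i k σ h = advDeriv u r i k σ h := by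
  have h1 : ∀ (v : Profile m → ℝ) (j : Fin N) (τ : Weights m),
      ∑ l, h j l * pay v j l τ = ∑ l, h j l * adv v r j l τ := fun v j τ => by
    simp only [adv, mul_sub, Finset.sum_sub_distrib, ← Finset.sum_mul, hh, zero_mul, sub_zero]
  have h2 : ∀ k, payDeriv (u + separable c) i k σ h = payDeriv u i k σ h +
      ∑ j ∈ Finset.univ.erase i, ∑ l, h j l * (c j l - c j (r j)) := fun k => by
    simp only [payDeriv_apply, h1, adv_add_separable u c (sum_update_single hσ i k), mul_add,
      Finset.sum_add_distrib]
  rw [advDeriv, advDeriv, sub_apply, sub_apply, h2, h2]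
  ring

/-- The moves in the support `C` that are described by a parameter. -/
noncomputable def supportShift (r : Profile m) (C : Set ((i : Fin N) × Fin (m i + 1))) :
    Weights m →L[ℝ] Weights m :=
  ∑ a : (i : Fin N) × Fin (m i + 1), if a ∈ C ∧ a.2 ≠ r a.1 then
    (coordForm a.1 a.2).smulRight (dir r a.1 a.2) else 0

theorem supportShift_apply (r : Profile m) (C : Set ((i : Fin N) × Fin (m i + 1)))
    (p : Weights m) {i : Fin N} {k : Fin (m i + 1)} (hk : k ≠ r i) :
    supportShift r C p i k = if ⟨i, k⟩ ∈ C then p i k else 0 := by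
  rw [supportShift, _root_.sum_apply, Finset.sum_apply, Finset.sum_apply,
    Finset.sum_eq_single ⟨i, k⟩]
  · by_cases hC : (⟨i, k⟩ : (i : Fin N) × Fin (m i + 1)) ∈ C
    · rw [if_pos ⟨hC, hk⟩, if_pos hC]
      simp [coordForm_apply, dir_apply_of_ne _ _ _ _ _ hk]
    · rw [if_neg fun h => hC h.1, if_neg hC]; rfl
  · intro b _ hb
    split_ifs
    · simp [dir_apply_of_ne _ _ _ _ _ hk, hb]
    · rfl
  · simp

theorem sum_supportShift (r : Profile m) (C : Set ((i : Fin N) × Fin (m i + 1)))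
    (p : Weights m) (i : Fin N) : ∑ k, supportShift r C p i k = 0 := by
  simp only [supportShift, _root_.sum_apply, Finset.sum_apply]
  rw [Finset.sum_comm]
  refine Finset.sum_eq_zero fun a _ => ?_
  split_ifs
  · simp [coordForm_apply, ← Finset.mul_sum, sum_dir]
  · simp

theorem eq_of_eq_off_reference {σ τ : Weights m} {r : Profile m}
    (hs : ∀ i, ∑ k, σ i k = ∑ k, τ i k) (h : ∀ i k, k ≠ r i → σ i k = τ i k) : σ = τ := by
  ext i k
  by_cases hk : k = r i
  · subst hk
    have h1 := hs i
    rw [← Finset.add_sum_erase _ _ (Finset.mem_univ (r i)),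
      ← Finset.add_sum_erase _ (τ i) (Finset.mem_univ (r i)),
      Finset.sum_congr rfl fun l hl => h i l (Finset.ne_of_mem_erase hl)] at h1
    exact add_right_cancel h1
  · exact h i k hk

/-- The profile with support in `C` that belongs to a parameter. -/
noncomputable def paramProfile (r : Profile m) (C : Set ((i : Fin N) × Fin (m i + 1)))
    (p : Weights m) : Weights m := (fun i => Pi.single (r i) 1) + supportShift r C p

theorem sum_paramProfile (r : Profile m) (C : Set ((i : Fin N) × Fin (m i + 1)))
    (p : Weights m) (i : Fin N) : ∑ k, paramProfile r C p i k = 1 := by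
  simp [paramProfile, Finset.sum_add_distrib, sum_supportShift]

theorem paramProfile_apply (r : Profile m) (C : Set ((i : Fin N) × Fin (m i + 1)))
    (p : Weights m) {i : Fin N} {k : Fin (m i + 1)} (hk : k ≠ r i) :
    paramProfile r C p i k = if ⟨i, k⟩ ∈ C then p i k else 0 := by
  rw [paramProfile, Pi.add_apply, Pi.add_apply, supportShift_apply r C p hk,
    Pi.single_eq_of_ne hk, zero_add]

/-- The perturbation for which the profile of a parameter is an equilibrium, where the parameters
off the support are the payoff losses. -/
noncomputable def paramPerturbation (u : Profile m → ℝ) (r : Profile m)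
    (C : Set ((i : Fin N) × Fin (m i + 1))) (p : Weights m) : Weights m := fun i k =>
  p i (r i) - adv u r i k (paramProfile r C p) + if ⟨i, k⟩ ∈ C then 0 else p i k

/-- The derivative of `paramPerturbation`. -/
noncomputable def paramDeriv (u : Profile m → ℝ) (r : Profile m)
    (C : Set ((i : Fin N) × Fin (m i + 1))) (p : Weights m) : Weights m →L[ℝ] Weights m :=
  ContinuousLinearMap.pi fun i => ContinuousLinearMap.pi fun k =>
    coordForm i (r i) - advDeriv u r i k (paramProfile r C p) ∘L supportShift r C +
      if ⟨i, k⟩ ∈ C then 0 else coordForm i k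

theorem paramDeriv_apply (u : Profile m → ℝ) (r : Profile m)
    (C : Set ((i : Fin N) × Fin (m i + 1))) (p q : Weights m) (i : Fin N) (k : Fin (m i + 1)) :
    paramDeriv u r C p q i k = q i (r i) -
      advDeriv u r i k (paramProfile r C p) (supportShift r C q) +
        if ⟨i, k⟩ ∈ C then 0 else q i k := by
  change (coordForm i (r i) - advDeriv u r i k (paramProfile r C p) ∘L supportShift r C +
      if ⟨i, k⟩ ∈ C then 0 else coordForm i k : Weights m →L[ℝ] ℝ) q = _
  split_ifs <;> simp [coordForm_apply]

theorem hasFDerivAt_paramPerturbation (u : Profile m → ℝ) (r : Profile m)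
    (C : Set ((i : Fin N) × Fin (m i + 1))) (p : Weights m) :
    HasFDerivAt (paramPerturbation u r C) (paramDeriv u r C p) p := by
  refine hasFDerivAt_pi.2 fun i => hasFDerivAt_pi.2 fun k => ?_
  have h1 : HasFDerivAt (paramProfile r C) (supportShift r C) p :=
    (supportShift r C).hasFDerivAt.const_add _
  refine HasFDerivAt.add (HasFDerivAt.sub (coordForm i (r i)).hasFDerivAt
    ((hasFDerivAt_adv u r i k (paramProfile r C p)).comp p h1)) ?_
  split_ifs
  · exact hasFDerivAt_const _ _
  · exact (coordForm i k).hasFDerivAt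

/-- The parameters at which regularity may fail. -/
def criticalParams (u : Profile m → ℝ) (r : Profile m) (C : Set ((i : Fin N) × Fin (m i + 1))) :
    Set (Weights m) :=
  {p | (paramDeriv u r C p).det = 0} ∪ ⋃ i, ⋃ k, {p : Weights m | p i k = 0}

/-- Sard's theorem in equal dimensions handles the singular parameters; a differentiable map sends
the coordinate hyperplanes, which are null, to null sets. -/
theorem volume_image_criticalParams (u : Profile m → ℝ) (r : Profile m)
    (C : Set ((i : Fin N) × Fin (m i + 1))) :
    volume (paramPerturbation u r C '' criticalParams u r C) = 0 := by
  rw [criticalParams, image_union, measure_union_null_iff]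
  constructor
  · exact addHaar_image_eq_zero_of_det_fderivWithin_eq_zero volume
      (fun p _ => (hasFDerivAt_paramPerturbation u r C p).hasFDerivWithinAt) fun p hp => hp
  · refine addHaar_image_eq_zero_of_differentiableOn_of_addHaar_eq_zero volume
      (fun p _ => (hasFDerivAt_paramPerturbation u r C p).differentiableAt.differentiableWithinAt)
      ?_
    refine measure_iUnion_null fun i => measure_iUnion_null fun k => ?_
    refine Measure.addHaar_submodule volume (LinearMap.ker (coordForm i k : Weights m →ₗ[ℝ] ℝ))
      fun htop => ?_
    have h1 : (fun _ _ => 1 : Weights m) ∈ LinearMap.ker (coordForm i k : Weights m →ₗ[ℝ] ℝ) :=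
      htop ▸ Submodule.mem_top
    exact one_ne_zero h1

/-- By `det_harsanyi_ne_zero_iff` regularity fails in one of two ways. A tie at an unused strategy
puts the parameter on a coordinate hyperplane, and a degenerate direction extends to a kernel vector
of the derivative of the parametrization. -/
theorem mem_image_criticalParams {u : Profile m → ℝ} {c σ : Weights m} {r : Profile m}
    (hN : σ ∈ Nash (fun _ : Fin N => u + separable c)) (hr : ∀ i, 0 < σ i (r i))
    (hdet : (fderiv ℝ (harsanyiMap (fun _ => u + separable c) r) σ).det = 0) :
    c ∈ paramPerturbation u r {a | σ a.1 a.2 ≠ 0} ''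
      criticalParams u r {a | σ a.1 a.2 ≠ 0} := by
  have hN' := (mem_Nash_iff _ σ).1 hN
  have hσ : ∀ i, ∑ k, σ i k = 1 := fun i => (hN'.1 i).2
  obtain ⟨C, hC⟩ : ∃ C : Set ((i : Fin N) × Fin (m i + 1)), C = {a | σ a.1 a.2 ≠ 0} := ⟨_, rfl⟩
  have hmem : ∀ i k, (⟨i, k⟩ : (i : Fin N) × Fin (m i + 1)) ∈ C ↔ σ i k ≠ 0 := by
    intro i k; rw [hC]; rfl
  rw [← hC]
  -- At the reference strategy `p` stores the free additive constant of `c`, on the rest of the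
  -- support the weight, and off the support the payoff advantage in the perturbed game.
  let p : Weights m := fun i k => if k = r i then c i k else if ⟨i, k⟩ ∈ C then σ i k else
    adv u r i k σ + (c i k - c i (r i))
  have hp : paramProfile r C p = σ := by
    refine eq_of_eq_off_reference (r := r) (fun i => by rw [sum_paramProfile, hσ]) fun i k hk => ?_
    rw [paramProfile_apply r C p hk]
    split_ifs with h
    · simp only [p, if_neg hk, if_pos h]
    · exact (not_not.1 (mt (hmem i k).2 h)).symm
  have hadv : ∀ i k, adv (u + separable c) r i k σ = adv u r i k σ + (c i k - c i (r i)) :=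
    fun i k => adv_add_separable u c hσ r i k
  have hadv0 : ∀ i k, σ i k ≠ 0 → adv (u + separable c) r i k σ = 0 := fun i k hk =>
    sub_eq_zero.2 (le_antisymm (hN'.2 i (r i) (hr i).ne' k) (hN'.2 i k hk (r i)))
  refine ⟨p, ?_, ?_⟩
  · have hnot : ¬ ((∀ i k, σ i k = 0 → pay (u + separable c) i k σ <
        pay (u + separable c) i (r i) σ) ∧ IsNondegenerate (u + separable c) r σ) := fun h =>
      (det_harsanyi_ne_zero_iff hN hr).2 h hdet
    by_cases hstrict : ∀ i k, σ i k = 0 →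
        pay (u + separable c) i k σ < pay (u + separable c) i (r i) σ
    · left
      have hnd : ¬ IsNondegenerate (u + separable c) r σ := fun h => hnot ⟨hstrict, h⟩
      simp only [IsNondegenerate, not_forall] at hnd
      obtain ⟨h, h1, h2, h3, h4⟩ := hnd
      -- Off the support, `q` compensates the change of the payoff advantages caused by `h`, so that
      -- the perturbation is stationary.
      let q : Weights m := fun i k => if k = r i then 0 else if ⟨i, k⟩ ∈ C then h i k else
        advDeriv u r i k σ h
      have hq : supportShift r C q = h := by
        refine eq_of_eq_off_reference (r := r) (fun i => by rw [sum_supportShift, h2])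
          fun i k hk => ?_
        rw [supportShift_apply r C q hk]
        split_ifs with hkC
        · simp only [q, if_neg hk, if_pos hkC]
        · exact (h1 i k (not_not.1 (mt (hmem i k).2 hkC))).symm
      change (paramDeriv u r C p).det = 0
      by_contra hdet'
      have hq0 : q = 0 := by
        refine (det_ne_zero_iff_injective _).1 hdet' ?_
        rw [map_zero]
        ext i k
        rw [paramDeriv_apply, hq, hp]
        have hqr : q i (r i) = 0 := by simp [q]
        rw [hqr, zero_sub]
        split_ifs with hkC
        · have h5 := h3 i k ((hmem i k).1 hkC)
          have h6 := advDeriv_add_separable u c hσ h2 r i k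
          rw [advDeriv, sub_apply, h5, sub_self] at h6
          rw [← h6]; simp
        · have hk : k ≠ r i := by
            rintro rfl
            exact hkC ((hmem i _).2 (hr i).ne')
          simp only [q, if_neg hk, if_neg hkC]
          simp
      rw [hq0, map_zero] at hq
      exact h4 hq.symm
    · right
      push Not at hstrict
      obtain ⟨i, k, hk, hle⟩ := hstrict
      have hkr : k ≠ r i := by
        rintro rfl
        exact (hr i).ne' hk
      have hkC : (⟨i, k⟩ : (i : Fin N) × Fin (m i + 1)) ∉ C := fun h => (hmem i k).1 h hk
      refine mem_iUnion.2 ⟨i, mem_iUnion.2 ⟨k, ?_⟩⟩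
      change p i k = 0
      simp only [p, if_neg hkr, if_neg hkC]
      rw [← hadv]
      exact sub_eq_zero.2 (le_antisymm (hN'.2 i (r i) (hr i).ne' k) hle)
  · ext i k
    rw [paramPerturbation, hp]
    have hpr : p i (r i) = c i (r i) := by simp [p]
    rw [hpr]
    split_ifs with hkC
    · have h1 := hadv i k
      rw [hadv0 i k ((hmem i k).1 hkC)] at h1
      linarith
    · have hk : k ≠ r i := by
        rintro rfl
        exact hkC ((hmem i _).2 (hr i).ne')
      simp only [p, if_neg hk, if_neg hkC]
      ring

theorem ae_isRegularGame_add_separable (u : Profile m → ℝ) :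
    ∀ᵐ c : Weights m, IsRegularGame (fun _ : Fin N => u + separable c) := by
  have h0 : volume (⋃ r : Profile m, ⋃ C : Set ((i : Fin N) × Fin (m i + 1)),
      paramPerturbation u r C '' criticalParams u r C) = 0 :=
    measure_iUnion_null fun r => measure_iUnion_null fun C => volume_image_criticalParams u r C
  filter_upwards [measure_eq_zero_iff_ae_notMem.1 h0] with c hc σ hσ
  have hΔ := ((mem_Nash_iff _ σ).1 hσ).1
  choose r hr using exists_mem_support hΔ
  have hr' : ∀ i, 0 < σ i (r i) := fun i => lt_of_le_of_ne ((hΔ i).1 _) (hr i).symm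
  exact ⟨r, hr', fun hdet => hc (mem_iUnion.2 ⟨r, mem_iUnion.2 ⟨_,
    mem_image_criticalParams hσ hr' hdet⟩⟩)⟩

end Perturbation

/-! ### Almost every potential game is regular. -/

section Generic

variable {N : ℕ} {m : Fin N → ℕ}

theorem continuous_pay_game (i j : Fin N) (k : Fin (m j + 1)) :
    Continuous fun q : Game m × Weights m => pay (q.1 i) j k q.2 := by
  have h1 : Continuous fun q : Game m × Weights m =>
      Function.update q.2 j (Pi.single k 1) := continuous_snd.update j continuous_const
  unfold pay expectedUtility
  fun_prop

theorem continuous_harsanyiDeriv (r : Profile m) :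
    Continuous fun q : Game m × Weights m => harsanyiDeriv q.1 r q.2 := by
  have hpay : ∀ (i : Fin N) (k : Fin (m i + 1)) (h : Weights m),
      Continuous fun q : Game m × Weights m => payDeriv (q.1 i) i k q.2 h := fun i k h => by
    simp only [payDeriv_apply]
    refine continuous_finsetSum _ fun j _ => continuous_finsetSum _ fun l _ =>
      continuous_const.mul ?_
    exact (continuous_pay_game i j l).comp
      (continuous_fst.prodMk (continuous_snd.update i continuous_const))
  refine continuous_clm_apply.2 fun h => continuous_pi fun i => continuous_pi fun k => ?_
  simp only [harsanyiDeriv_apply]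
  split_ifs
  · exact continuous_const
  · have h1 : Continuous fun q : Game m × Weights m => q.2 i k := by fun_prop
    exact (h1.mul ((hpay i k h).sub (hpay i (r i) h))).add
      (((continuous_pay_game i i k).sub (continuous_pay_game i i (r i))).mul continuous_const)

/-- Pairs of a game and a nonregular equilibrium form a closed set, and projecting along the compact
space of profiles keeps it closed. Measurability is what the Fubini argument needs. -/
theorem isClosed_not_isRegularGame : IsClosed {Γ : Game m | ¬ IsRegularGame Γ} := by
  have : CompactSpace (Delta m) := isCompact_iff_compactSpace.1 isCompact_Delta
  have hU : ∀ i, Continuous fun q : Game m × Weights m => expectedUtility (q.1 i) q.2 := fun i => by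
    unfold expectedUtility
    fun_prop
  let Z : Set (Game m × Delta m) := {q | (∀ i, ∀ s' ∈ stdSimplex ℝ (Fin (m i + 1)),
    expectedUtility (q.1 i) (Function.update q.2.1 i s') ≤ expectedUtility (q.1 i) q.2.1) ∧
    ∀ r : Profile m, (∃ i, q.2.1 i (r i) ≤ 0) ∨ (harsanyiDeriv q.1 r q.2.1).det = 0}
  have hval : Continuous fun q : Game m × Delta m => (q.1, q.2.1) :=
    continuous_fst.prodMk (continuous_subtype_val.comp continuous_snd)
  have hZ : IsClosed Z := by
    refine IsClosed.inter (s₁ := {q | _}) (s₂ := {q | _}) ?_ ?_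
    · simp only [ofPred_forall]
      refine isClosed_iInter fun i => isClosed_iInter fun s' => isClosed_iInter fun _ => ?_
      refine isClosed_le ((hU i).comp (continuous_fst.prodMk
        ((continuous_subtype_val.comp continuous_snd).update i continuous_const)))
        ((hU i).comp hval)
    · simp only [ofPred_forall]
      refine isClosed_iInter fun r => ?_
      refine IsClosed.union (s₁ := {q | _}) (s₂ := {q | _}) ?_ ?_
      · simp only [ofPred_exists]
        refine isClosed_iUnion_of_finite fun i => ?_
        refine isClosed_le ?_ continuous_const
        have h1 : Continuous fun σ : Weights m => σ i (r i) := by fun_prop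
        exact h1.comp (continuous_subtype_val.comp continuous_snd)
      · exact isClosed_eq (ContinuousLinearMap.continuous_det.comp
          ((continuous_harsanyiDeriv r).comp hval)) continuous_const
  have heq : {Γ : Game m | ¬ IsRegularGame Γ} = Prod.fst '' Z := by
    ext Γ
    simp only [mem_ofPred_eq, mem_image]
    constructor
    · intro h
      simp only [IsRegularGame, not_forall] at h
      obtain ⟨σ, hσ, hnot⟩ := h
      refine ⟨(Γ, ⟨σ, hσ.1⟩), ⟨fun i s' hs' => ?_, fun r => ?_⟩, rfl⟩
      · have := (hσ.2 i).2 s' hs'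
        rwa [Function.update_eq_self] at this
      · by_contra! hcon
        exact hnot ⟨r, hcon.1, by rw [(hasFDerivAt_harsanyiMap Γ r σ).fderiv]; exact hcon.2⟩
    · rintro ⟨⟨Γ', σ, hσ⟩, ⟨h1, h2⟩, rfl⟩ hreg
      obtain ⟨r, hr, hdet⟩ := hreg σ ⟨hσ, fun i => ⟨hσ i, fun s' hs' => by
        rw [Function.update_eq_self]; exact h1 i s' hs'⟩⟩
      rw [(hasFDerivAt_harsanyiMap Γ' r σ).fderiv] at hdet
      rcases h2 r with ⟨i, hi⟩ | h3
      · exact absurd (hr i) (not_lt.2 hi)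
      · exact hdet h3
  rw [heq]
  exact isClosedMap_fst_of_compactSpace Z hZ

/-- The separable games as potential games. -/
def separableGame (m : Fin N → ℕ) : Weights m →ₗ[ℝ] potentialGames m where
  toFun c := ⟨fun _ => separable c, separable c, fun _ _ _ _ => rfl⟩
  map_add' c d := by
    ext i y
    simp [separable, Finset.sum_add_distrib]
  map_smul' a c := by
    ext i y
    simp [separable, Finset.mul_sum]

/-- Along every translate of the separable games almost every point is regular, since adding
`separable c` to a game adds it to the potential. Fubini along these directions gives the full
measure statement. -/
theorem ae_isRegularGame (m : Fin N → ℕ) :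
    ∀ᵐ Γ : potentialGames m ∂Measure.addHaar, IsRegularGame (Γ : Game m) := by
  have hs : MeasurableSet {Γ : potentialGames m | IsRegularGame (Γ : Game m)} :=
    (isClosed_not_isRegularGame.preimage continuous_subtype_val).measurableSet.of_compl
  refine ae_mem_of_ae_add_linearMap_mem (separableGame m) (volume : Measure (Weights m))
    Measure.addHaar hs fun Γ => ?_
  obtain ⟨u, hu⟩ := Γ.2
  filter_upwards [ae_isRegularGame_add_separable u] with c hc
  have hpot : IsPotential ((Γ + separableGame m c : potentialGames m) : Game m)
      (u + separable c) := by
    intro i y a b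
    have := hu i y a b
    simp only [Submodule.coe_add, Pi.add_apply, separableGame, LinearMap.coe_mk, AddHom.coe_mk]
    linarith
  exact hpot.isRegularGame_iff.2 hc

end Generic

end FP

/-- The first part is about every regular potential game. In the second, `addHaar` is Lebesgue
measure, up to a constant factor, on the finite-dimensional space of potential games. -/
theorem theorem2 {N : ℕ} (hN : 2 ≤ N) (m : Fin N → ℕ) :
    (∀ Γ : FP.Game m, Γ ∈ FP.potentialGames m → FP.IsRegularGame Γ →
      FP.ConvergesExponentially Γ) ∧
    (∀ᵐ Γ : FP.potentialGames m ∂MeasureTheory.Measure.addHaar,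
      FP.IsRegularGame (Γ : FP.Game m) ∧ FP.ConvergesExponentially (Γ : FP.Game m)) := by
  have key : ∀ Γ : FP.Game m, Γ ∈ FP.potentialGames m → FP.IsRegularGame Γ →
      FP.ConvergesExponentially Γ := by
    rintro Γ ⟨u, hu⟩ hreg
    have hpot : FP.IsPotential Γ u := hu
    exact hpot.convergesExponentially_iff.2
      (FP.convergesExponentially_of_isRegularGame (hpot.isRegularGame_iff.1 hreg))
  refine ⟨key, ?_⟩
  filter_upwards [FP.ae_isRegularGame m] with Γ hΓ
  exact ⟨hΓ, key Γ Γ.2 hΓ⟩
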